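/- Write $\mathbb R^2_+=\{x\in\mathbb R^2: x_2>0\}$ and, for $A\subset\mathbb R^2_+$, $A_-=\{(x_1,x_2):(x_1,-x_2)\in A\}$. For an integrable function $\omega$ on $\mathbb R^2$ let $u=k*\omega$ with $k(x)=\frac{1}{2\pi}\frac{(-x_2,x_1)}{|x|^2}$, and let $\psi[\omega]=-\bigl(\frac1{2\pi}\log|\cdot|\bigr)*\omega$. Let $K$ be the set of all $\omega\in L^1(\mathbb R^2)$ with $\omega=\mathbf 1_A-\mathbf 1_{A_-}$ a.e. in $\mathbb R^2$ for some bounded open set $A\subset\mathbb R^2_+$ satisfying $\int_A x_2\,dx=1$ (no bound is imposed on the mass $|A|$), and let $S\subset K$ be the set of maximizers over $K$ of the kinetic energy $\int_{\mathbb R^2}|u|^2\,dx$. On the half-plane let $G(x,y)=\frac1{4\pi}\log\bigl(1+\frac{4x_2y_2}{|x-y|^2}\bigr)$, $\mathcal G[\omega](x)=\int_{\mathbb R^2_+}G(x,y)\omega(y)\,dy$ and $E(\omega)=\frac12\int_{\mathbb R^2_+}\int_{\mathbb R^2_+}G(x,y)\,\omega(x)\omega(y)\,dy\,dx$. Let $K_\infty$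 be the set of all $\omega\in L^1(\mathbb R^2_+)$ with $\omega=\mathbf 1_A$ a.e. for some measurable $A\subset\mathbb R^2_+$ and $\int_{\mathbb R^2_+}x_2\omega\,dx=1$; let $I=\sup_{\omega\in K_\infty}E(\omega)$ and let $S_\infty=\{\omega\in K_\infty: E(\omega)=I\}$. **Theorem.** The maximal kinetic energy $\sup_{\omega\in K}\int_{\mathbb R^2}|u|^2\,dx$ and $I$ are finite, and $S$ and $S_\infty$ are nonempty. Moreover, there are absolute constants $C_0>0$ and $0<C_1<C_2$ with the following properties. (a) For each $\omega\in S$ there are $\tau\in\mathbb R$ and a bounded open set $\Omega\subset\mathbb R^2_+$ such that, with $\omega_\tau(x_1,x_2)=\omega(x_1-\tau,x_2)$ and $$W:=\frac13\int_{\mathbb R^2}|k*\omega|^2\,dx=\frac43\,I>0,$$ we have $\omega_\tau=\mathbf 1_\Omega-\mathbf 1_{\Omega_-}$ a.e. in $\mathbb R^2$ and $$\Omega=\{x\in\mathbb R^2_+:\psi[\omega_\tau](x)-Wx_2>0\};$$ there is a function $l:(0,\infty)\to[0,\infty)$ with $\{x\in\Omega: x_2=s\}=\{(x_1,s):|x_1|<l(s)\}$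 for every $s>0$; and $\Omega\subset\{|x|<C_0\}$, $C_1<|\Omega|<C_2$. (b) For each $\omega\in S_\infty$ there are $\tau\in\mathbb R$ and a bounded open set $\Omega\subset\mathbb R^2_+$ such that, with $\omega_\tau(x_1,x_2)=\omega(x_1-\tau,x_2)$ and $W:=\frac43 I>0$, we have $\omega_\tau=\mathbf 1_\Omega$ a.e. in $\mathbb R^2_+$ and $$\Omega=\{x\in\mathbb R^2_+:\mathcal G[\omega_\tau](x)-Wx_2>0\};$$ there is a function $l:(0,\infty)\to[0,\infty)$ with $\{x\in\Omega: x_2=s\}=\{(x_1,s):|x_1|<l(s)\}$ for every $s>0$; and $\Omega\subset\{|x|<C_0\}$, $C_1<\|\omega\|_{L^1(\mathbb R^2_+)}<C_2$. -/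

import Mathlib

open MeasureTheory Set
open scoped ENNReal

noncomputable section

namespace Sadovskii

/-- The plane `ℝ²` with its Euclidean norm and Lebesgue measure. The coordinates of the
mathematical point `(x₁, x₂)` are `x 0` and `x 1`. -/
abbrev Plane : Type := EuclideanSpace ℝ (Fin 2)

/-- The open upper half-plane `{x₂ > 0}`. -/
def upperHalf : Set Plane := {x | 0 < x 1}

/-- The reflection `(x₁, x₂) ↦ (x₁, -x₂)`. -/
def reflect (x : Plane) : Plane := !₂[x 0, -x 1]

/-- The odd patch `1_A - 1_{A₋}`, where `A₋ = {x | (x₁, -x₂) ∈ A}`. -/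
def oddPatch (A : Set Plane) : Plane → ℝ :=
  fun x => A.indicator (fun _ => (1 : ℝ)) x - (reflect ⁻¹' A).indicator (fun _ => (1 : ℝ)) x

/-- The horizontal translate `f_τ(x₁, x₂) = f(x₁ - τ, x₂)`. -/
def shift (τ : ℝ) (f : Plane → ℝ) : Plane → ℝ := fun x => f (x - !₂[τ, 0])

/-- The Biot–Savart kernel `k(x) = (2π)⁻¹ (-x₂, x₁) / |x|²`. -/
def biotSavartKernel (x : Plane) : Plane :=
  (1 / (2 * Real.pi * ‖x‖ ^ 2)) • !₂[-x 1, x 0]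

/-- The velocity `u = k * ω`. -/
def velocity (ω : Plane → ℝ) (x : Plane) : Plane :=
  ∫ y, ω y • biotSavartKernel (x - y)

/-- The stream function `ψ[ω] = -((2π)⁻¹ log |·|) * ω`. -/
def stream (ω : Plane → ℝ) (x : Plane) : ℝ :=
  ∫ y, -(1 / (2 * Real.pi) * Real.log ‖x - y‖) * ω y

/-- The kinetic energy `∫_{ℝ²} |k * ω|² dx`, with value in `[0, ∞]`. -/
def kineticEnergy (ω : Plane → ℝ) : ℝ≥0∞ := ∫⁻ x, ‖velocity ω x‖ₑ ^ 2

/-- The class `K` of (functions a.e. equal to) odd patches `1_A - 1_{A₋}`, with `A` a bounded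
open subset of the upper half-plane of impulse `∫_A x₂ dx = 1`. -/
def patchClass : Set (Plane → ℝ) :=
  {ω | Integrable ω ∧ ∃ A : Set Plane, IsOpen A ∧ Bornology.IsBounded A ∧ A ⊆ upperHalf ∧
    ∫ x in A, x 1 = 1 ∧ ω =ᵐ[volume] oddPatch A}

/-- The maximal kinetic energy in the class `K`. -/
def maxKineticEnergy : ℝ≥0∞ := ⨆ ω ∈ patchClass, kineticEnergy ω

/-- The set `S` of maximizers of the kinetic energy in `K`. -/
def patchMaximizers : Set (Plane → ℝ) :=
  {ω | ω ∈ patchClass ∧ kineticEnergy ω = maxKineticEnergy}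

/-- The Green function of the upper half-plane,
`G(x, y) = (4π)⁻¹ log (1 + 4 x₂ y₂ / |x - y|²)` for `x ≠ y`. -/
def green (x y : Plane) : ℝ :=
  1 / (4 * Real.pi) * Real.log (1 + 4 * x 1 * y 1 / ‖x - y‖ ^ 2)

/-- `𝒢[ω](x) = ∫_{y₂ > 0} G(x, y) ω(y) dy`. Only the values of `ω` on the upper half-plane
matter. -/
def greenPotential (ω : Plane → ℝ) (x : Plane) : ℝ :=
  ∫ y in upperHalf, green x y * ω y

/-- The mass `‖ω‖₁ = ∫_{x₂ > 0} |ω| dx`. -/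
def mass (ω : Plane → ℝ) : ℝ≥0∞ := ∫⁻ x in upperHalf, ‖ω x‖ₑ

/-- The impulse `‖x₂ ω‖₁ = ∫_{x₂ > 0} x₂ |ω| dx`. -/
def impulse (ω : Plane → ℝ) : ℝ≥0∞ := ∫⁻ x in upperHalf, ENNReal.ofReal (x 1) * ‖ω x‖ₑ

/-- The energy `E(ω) = (1/2) ∫∫ G(x, y) ω(y) ω(x) dy dx` over the upper half-plane, of a
function that is nonnegative there, with value in `[0, ∞]`. -/
def energy (ω : Plane → ℝ) : ℝ≥0∞ :=
  (1 / 2) * ∫⁻ x in upperHalf, ∫⁻ y in upperHalf, ENNReal.ofReal (green x y * ω y * ω x)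

/-- The class `K_{1,∞}` of integrable functions on the upper half-plane that are a.e. equal to
`1_A` for a measurable set `A`, with unit impulse and no bound on the mass. -/
def halfClass : Set (Plane → ℝ) :=
  {ω | IntegrableOn ω upperHalf ∧ impulse ω = 1 ∧
    ∃ A : Set Plane, MeasurableSet A ∧ A ⊆ upperHalf ∧
      ω =ᵐ[volume.restrict upperHalf] A.indicator (fun _ => (1 : ℝ))}

/-- The maximal energy `I_{1,∞}`. -/
def maxEnergy : ℝ≥0∞ := ⨆ ω ∈ halfClass, energy ω

/-- The set `S_{1,∞}` of maximizers of the energy in `K_{1,∞}`. -/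
def halfMaximizers : Set (Plane → ℝ) := {ω | ω ∈ halfClass ∧ energy ω = maxEnergy}

/-- A subset `Ω` of the upper half-plane each of whose horizontal slices, at height `s > 0`, is
the open interval `|x₁| < l(s)`, for some function `l : (0, ∞) → [0, ∞)`. -/
def IsSteiner (Ω : Set Plane) : Prop :=
  ∃ l : ℝ → ℝ, (∀ s, 0 < s → 0 ≤ l s) ∧
    ∀ s, 0 < s → ∀ a : ℝ, !₂[a, s] ∈ Ω ↔ |a| < l s

end Sadovskii

end

open Sadovskii

noncomputable section

namespace Sadovskii

/-! ### Coordinates of the plane and the integrable singularity of the kernels -/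

section

/-! The problem is relaxed to densities `0 ≤ θ ≤ 1` on the half-plane with impulse at most one
(`Admissible`). The functional `interaction θ θ` is twice the energy, and everything is valued in
`[0, ∞]`, so symmetry, bilinearity and Tonelli cost no integrability. The relaxed class is closed
under weak limits, in which impulse may be lost. Mass is never bounded: near the singularity `θ ≤ 1`
suffices, and far from it the Green function is at most `x₂ y₂ / (π |x - y|²)`, so the impulse
controls the tail (`Admissible.pot_le`).

Existence. Translations destroy compactness, so near-maximizers are replaced by symmetric ones.
Polarization in a vertical line does not lower the energy, with an explicit defect
(`interaction_polarize`). On a ball the energy minus a small multiple of `∫ x₁² x₂ θ` has a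
maximizer, and since polarization towards the axis lowers that penalty, the maximizer dominates its
mirror images on either side of the axis (`IsPenalizedMaximizer.leftOrdered`). Such order spreads
the impulse over disjoint strips and forces the potential below `ε x₂` outside a ball depending only
on `ε` (`exists_pot_le`). Tails are then uniformly small, truncated energies are weakly continuous
(`WeakLimit.tendsto_interaction`), and a maximizer exists (`exists_maximizer`).

Structure. For a maximizer the polarization defect vanishes, so it is comparable with each of its
mirror images. The median of the horizontal impulse distribution is an axis of symmetry, and
comparison with lines to its left is strict (`exists_symmetry_axis`); hence the potential is
strictly decreasing in `|x₁|`. By scaling, the maximum at impulse `m` is proportional to `m^(4/3)`,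
so the first variation has the single multiplier `W = (4/3) I`, and there is no flux constant
because the mass is free. This gives `θ = 1` where the potential exceeds `W x₂` and `θ = 0` where it
is smaller. The level set itself is null, because a horizontal line meets it in at most two points.
So a centered maximizer is the indicator of `core θ`, which is open by lower semicontinuity, bounded
by the decay with `ε = W`, and Steiner symmetric. The relaxed maximum is therefore attained in both
original classes.

Kinetic energy. Writing the velocity kernel as `i / (2π z̄)`, Cauchy's formula on circles gives `2
G(y, z)` for the integral of the product of the velocities of two vortex pairs. Fubini then yields
`∫ |u|² = 2 * interaction` for odd patches (`kineticEnergy_oddPatch`), which turns the first problem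
into the second. -/

theorem norm_sub_sq_eq (x y : Plane) : ‖x - y‖ ^ 2 = (x 0 - y 0) ^ 2 + (x 1 - y 1) ^ 2 := by
  simp [EuclideanSpace.norm_sq_eq, Fin.sum_univ_two]

theorem abs_coord_le (x : Plane) (i : Fin 2) : |x i| ≤ ‖x‖ := by
  simpa using PiLp.norm_apply_le x i

theorem norm_le_abs_add_abs (x : Plane) : ‖x‖ ≤ |x 0| + |x 1| := by
  have h := norm_sub_sq_eq x 0
  simp only [sub_zero, PiLp.zero_apply] at h
  refine abs_le_of_sq_le_sq' ?_ (by positivity) |>.2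
  rw [h]
  nlinarith [sq_abs (x 0), sq_abs (x 1), abs_nonneg (x 0), abs_nonneg (x 1)]

@[fun_prop]
theorem measurable_coord (i : Fin 2) : Measurable fun x : Plane => x i := by fun_prop

theorem isOpen_upperHalf : IsOpen upperHalf :=
  isOpen_lt continuous_const (by fun_prop)

theorem measurableSet_upperHalf : MeasurableSet upperHalf := isOpen_upperHalf.measurableSet

/-- The linear isometry identifying `ℂ` with the plane. -/
def complexToPlane : ℂ ≃ₗᵢ[ℝ] Plane := Complex.orthonormalBasisOneI.repr

theorem complexToPlane_apply_zero (z : ℂ) : complexToPlane z 0 = z.re := by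
  simp [complexToPlane]

theorem complexToPlane_apply_one (z : ℂ) : complexToPlane z 1 = z.im := by
  simp [complexToPlane]

/-- In polar coordinates centred at `x` the Jacobian `r` cancels the singularity `1 / r`. -/
theorem lintegral_ball_inv_norm (x : Plane) {δ : ℝ} (hδ : 0 ≤ δ) :
    ∫⁻ y in Metric.ball x δ, ‖x - y‖ₑ⁻¹ = ENNReal.ofReal (2 * Real.pi * δ) := by
  have hm : Measurable fun y : Plane => (Metric.ball (0 : Plane) δ).indicator (fun y => ‖y‖ₑ⁻¹) y :=
    (by fun_prop : Measurable fun y : Plane => ‖y‖ₑ⁻¹).indicator Metric.isOpen_ball.measurableSet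
  rw [← lintegral_indicator Metric.isOpen_ball.measurableSet]
  have h1 : ∀ y, (Metric.ball x δ).indicator (fun y => ‖x - y‖ₑ⁻¹) y =
      (Metric.ball (0 : Plane) δ).indicator (fun y => ‖y‖ₑ⁻¹) (x - y) := by
    intro y
    by_cases h : y ∈ Metric.ball x δ
    · rw [indicator_of_mem h, indicator_of_mem (by simpa [dist_eq_norm, norm_sub_rev x y] using h)]
    · rw [indicator_of_notMem h,
        indicator_of_notMem (by simpa [dist_eq_norm, norm_sub_rev x y] using h)]
  simp_rw [h1]
  rw [lintegral_sub_left_eq_self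
    (fun y => (Metric.ball (0 : Plane) δ).indicator (fun y => ‖y‖ₑ⁻¹) y) x,
    ← complexToPlane.measurePreserving.lintegral_comp hm,
    ← Complex.lintegral_comp_polarCoord_symm, polarCoord_target]
  have h2 : ∀ p ∈ Ioi (0 : ℝ) ×ˢ Ioo (-Real.pi) Real.pi,
      ENNReal.ofReal p.1 • (Metric.ball (0 : Plane) δ).indicator (fun y => ‖y‖ₑ⁻¹)
        (complexToPlane (Complex.polarCoord.symm p)) =
      (Ioo 0 δ ×ˢ Ioo (-Real.pi) Real.pi).indicator (fun _ => (1 : ℝ≥0∞)) p := by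
    rintro p ⟨hp1, hp2⟩
    have hp1 : 0 < p.1 := hp1
    have hn : ‖complexToPlane (Complex.polarCoord.symm p)‖ = p.1 := by
      rw [LinearIsometryEquiv.norm_map, Complex.norm_polarCoord_symm, abs_of_pos hp1]
    by_cases h : p.1 < δ
    · rw [indicator_of_mem (by rwa [mem_ball_zero_iff, hn]),
        indicator_of_mem (show p ∈ Ioo 0 δ ×ˢ Ioo (-Real.pi) Real.pi from ⟨⟨hp1, h⟩, hp2⟩),
        ← ofReal_norm, hn, smul_eq_mul, ENNReal.mul_inv_cancel]
      · simpa using hp1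
      · simp
    · rw [indicator_of_notMem (by rwa [mem_ball_zero_iff, hn]),
        indicator_of_notMem (fun h' => h h'.1.2)]
      simp
  rw [setLIntegral_congr_fun (measurableSet_Ioi.prod measurableSet_Ioo) h2,
    lintegral_indicator (measurableSet_Ioo.prod measurableSet_Ioo),
    Measure.restrict_restrict (measurableSet_Ioo.prod measurableSet_Ioo), inter_eq_left.2]
  · simp only [lintegral_const, one_mul, Measure.restrict_apply MeasurableSet.univ, univ_inter]
    rw [Measure.volume_eq_prod, Measure.prod_prod, Real.volume_Ioo, Real.volume_Ioo,
      ← ENNReal.ofReal_mul (by linarith)]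
    congr 1; ring
  · exact prod_mono Ioo_subset_Ioi_self le_rfl

/-! ### The Green function -/

theorem green_comm (x y : Plane) : green x y = green y x := by
  simp only [green, norm_sub_rev x y]
  ring_nf

theorem measurable_green : Measurable fun p : Plane × Plane => green p.1 p.2 := by
  unfold green; fun_prop

theorem green_nonneg {x y : Plane} (hx : x ∈ upperHalf) (hy : y ∈ upperHalf) : 0 ≤ green x y := by
  have hx : 0 < x 1 := hx
  have hy : 0 < y 1 := hy
  unfold green
  refine mul_nonneg (by positivity) (Real.log_nonneg ?_)
  have : 0 ≤ 4 * x 1 * y 1 / ‖x - y‖ ^ 2 := by positivity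
  linarith

theorem green_pos {x y : Plane} (hx : x ∈ upperHalf) (hy : y ∈ upperHalf) (hxy : x ≠ y) :
    0 < green x y := by
  have hx : 0 < x 1 := hx
  have hy : 0 < y 1 := hy
  have hn : 0 < ‖x - y‖ := norm_pos_iff.2 (sub_ne_zero.2 hxy)
  unfold green
  refine mul_pos (by positivity) (Real.log_pos ?_)
  have : 0 < 4 * x 1 * y 1 / ‖x - y‖ ^ 2 := by positivity
  linarith

theorem coord_le_add_norm (x y : Plane) : y 1 ≤ x 1 + ‖x - y‖ := by
  have := abs_coord_le (x - y) 1
  simp only [PiLp.sub_apply] at this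
  linarith [neg_abs_le (x 1 - y 1)]

/-- Since `y₂ ≤ x₂ + r`, the argument of the logarithm is at most `(1 + 2 x₂ / r)²`, which removes
the dependence on `y₂`. This bound is integrable at the diagonal and serves the near field. -/
theorem green_le_div {x y : Plane} (hx : x ∈ upperHalf) (hy : y ∈ upperHalf) :
    green x y ≤ x 1 / (Real.pi * ‖x - y‖) := by
  have hx : 0 < x 1 := hx
  have hy : 0 < y 1 := hy
  rcases eq_or_ne x y with rfl | hxy
  · simp [green]
  have hn : 0 < ‖x - y‖ := norm_pos_iff.2 (sub_ne_zero.2 hxy)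
  have h := coord_le_add_norm x y
  set r := ‖x - y‖
  have h1 : 1 + 4 * x 1 * y 1 / r ^ 2 ≤ (1 + 2 * (x 1 / r)) ^ 2 := by
    have : 4 * x 1 * y 1 / r ^ 2 ≤ 4 * x 1 * (x 1 + r) / r ^ 2 := by gcongr
    have h3 : (1 + 2 * (x 1 / r)) ^ 2 = 1 + 4 * x 1 * (x 1 + r) / r ^ 2 := by field_simp; ring
    linarith
  have h2 : Real.log (1 + 4 * x 1 * y 1 / r ^ 2) ≤ 4 * (x 1 / r) := by
    refine (Real.log_le_log (by positivity) h1).trans ?_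
    rw [Real.log_pow]
    have := Real.log_le_sub_one_of_pos (x := 1 + 2 * (x 1 / r)) (by positivity)
    push_cast; linarith
  calc green x y ≤ 1 / (4 * Real.pi) * (4 * (x 1 / r)) := by unfold green; gcongr
    _ = x 1 / (Real.pi * r) := by field_simp

/-- From `log (1 + s) ≤ s`. The factor `y₂` is exactly the impulse weight, so the far field needs no
bound on the mass. -/
theorem green_le_div_sq {x y : Plane} (hx : x ∈ upperHalf) (hy : y ∈ upperHalf) :
    green x y ≤ x 1 * y 1 / (Real.pi * ‖x - y‖ ^ 2) := by
  have hx : 0 < x 1 := hx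
  have hy : 0 < y 1 := hy
  have h2 := Real.log_le_sub_one_of_pos (x := 1 + 4 * x 1 * y 1 / ‖x - y‖ ^ 2) (by positivity)
  calc green x y ≤ 1 / (4 * Real.pi) * (4 * x 1 * y 1 / ‖x - y‖ ^ 2) := by
        unfold green; gcongr; linarith
    _ = _ := by
      rw [div_mul_div_comm, mul_assoc 4 Real.pi, show 1 * (4 * x 1 * y 1) = 4 * (x 1 * y 1) by ring]
      exact mul_div_mul_left _ _ (by norm_num)

/-- Local square integrability of the Green function is needed to test it against weak limits. With
`q⁴ = x₂ y₂ / r²`, the inequality `1 + 4 q⁴ ≤ (1 + 2 q)⁴` gives a logarithm of at most `8 q`, and `2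
/ π ≤ 1`. -/
theorem green_sq_le {x y : Plane} (hx : x ∈ upperHalf) (hy : y ∈ upperHalf) :
    green x y ^ 2 ≤ √(x 1 * y 1) / ‖x - y‖ := by
  have hx : 0 < x 1 := hx
  have hy : 0 < y 1 := hy
  rcases eq_or_ne x y with rfl | hxy
  · simp [green]
  have hn : 0 < ‖x - y‖ := norm_pos_iff.2 (sub_ne_zero.2 hxy)
  set r := ‖x - y‖
  set q := √(√(x 1 * y 1) / r) with hq
  have hq0 : 0 < q := by positivity
  have hq2 : q ^ 2 = √(x 1 * y 1) / r := Real.sq_sqrt (by positivity)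
  have hq4 : q ^ 4 = x 1 * y 1 / r ^ 2 := by
    rw [show q ^ 4 = (q ^ 2) ^ 2 by ring, hq2, div_pow, Real.sq_sqrt (by positivity)]
  have h1 : Real.log (1 + 4 * x 1 * y 1 / r ^ 2) ≤ 8 * q := by
    have : 1 + 4 * x 1 * y 1 / r ^ 2 ≤ (1 + 2 * q) ^ 4 := by
      rw [show 4 * x 1 * y 1 / r ^ 2 = 4 * (x 1 * y 1 / r ^ 2) by ring, ← hq4]
      nlinarith [pow_pos hq0 2, pow_pos hq0 3, pow_pos hq0 4]
    refine (Real.log_le_log (by positivity) this).trans ?_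
    rw [Real.log_pow]
    have := Real.log_le_sub_one_of_pos (x := 1 + 2 * q) (by positivity)
    push_cast; linarith
  have h2 : green x y ≤ q := by
    calc green x y ≤ 1 / (4 * Real.pi) * (8 * q) := by unfold green; gcongr
      _ = 2 / Real.pi * q := by field_simp; norm_num
      _ ≤ 1 * q := by gcongr; rw [div_le_one Real.pi_pos]; exact Real.two_le_pi
      _ = q := one_mul q
  rw [← hq2]
  exact pow_le_pow_left₀ (green_nonneg hx hy) h2 2

/-- The Green function of the half-plane, with value `∞` on the diagonal. -/
def greenKernel (x y : Plane) : ℝ≥0∞ := if x = y then ∞ else ENNReal.ofReal (green x y)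

theorem greenKernel_of_ne {x y : Plane} (h : x ≠ y) :
    greenKernel x y = ENNReal.ofReal (green x y) := if_neg h

theorem greenKernel_comm (x y : Plane) : greenKernel x y = greenKernel y x := by
  simp only [greenKernel, green_comm x y, eq_comm]

theorem measurable_greenKernel : Measurable fun p : Plane × Plane => greenKernel p.1 p.2 :=
  Measurable.ite (measurableSet_eq_fun measurable_fst measurable_snd) measurable_const
    measurable_green.ennreal_ofReal

@[fun_prop]
theorem measurable_greenKernel_right (x : Plane) : Measurable fun y => greenKernel x y :=
  measurable_greenKernel.comp measurable_prodMk_left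

theorem enorm_inv_eq_ofReal {x y : Plane} (h : x ≠ y) :
    ‖x - y‖ₑ⁻¹ = ENNReal.ofReal (1 / ‖x - y‖) := by
  have hn : 0 < ‖x - y‖ := norm_pos_iff.2 (sub_ne_zero.2 h)
  rw [← ofReal_norm, one_div, ENNReal.ofReal_inv_of_pos hn]

theorem greenKernel_le {x y : Plane} (hx : x ∈ upperHalf) (hy : y ∈ upperHalf) :
    greenKernel x y ≤ ENNReal.ofReal (x 1 / Real.pi) * ‖x - y‖ₑ⁻¹ := by
  have hx' : 0 < x 1 := hx
  rcases eq_or_ne x y with rfl | hxy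
  · simp only [sub_self, enorm_zero, ENNReal.inv_zero]
    rw [ENNReal.mul_top]
    · exact le_top
    · simpa using div_pos hx' Real.pi_pos
  rw [greenKernel_of_ne hxy, enorm_inv_eq_ofReal hxy, ← ENNReal.ofReal_mul (by positivity)]
  refine ENNReal.ofReal_le_ofReal ((green_le_div hx hy).trans (le_of_eq ?_))
  rw [div_mul_div_comm, mul_one]

theorem greenKernel_le_sq {x y : Plane} (hx : x ∈ upperHalf) (hy : y ∈ upperHalf) {ρ : ℝ}
    (hρ : 0 < ρ) (hxy : ρ ≤ ‖x - y‖) :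
    greenKernel x y ≤ ENNReal.ofReal (x 1 / (Real.pi * ρ ^ 2)) * ENNReal.ofReal (y 1) := by
  have hx' : 0 < x 1 := hx
  have hy' : 0 < y 1 := hy
  have hne : x ≠ y := by rintro rfl; simp at hxy; linarith
  rw [greenKernel_of_ne hne, ← ENNReal.ofReal_mul (by positivity)]
  refine ENNReal.ofReal_le_ofReal ((green_le_div_sq hx hy).trans ?_)
  rw [div_mul_eq_mul_div]
  gcongr

end

section

/-! ### Potential, energy and impulse of a density -/

/-- The Green potential of a density on the half-plane. -/
def pot (θ : Plane → ℝ≥0∞) (x : Plane) : ℝ≥0∞ := ∫⁻ y in upperHalf, greenKernel x y * θ y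

/-- The interaction energy of two densities on the half-plane. -/
def interaction (θ φ : Plane → ℝ≥0∞) : ℝ≥0∞ := ∫⁻ x in upperHalf, pot θ x * φ x

/-- The impulse of a density on the half-plane. -/
def imp (θ : Plane → ℝ≥0∞) : ℝ≥0∞ := ∫⁻ x in upperHalf, ENNReal.ofReal (x 1) * θ x

/-- Measurable densities `0 ≤ θ ≤ 1` of impulse at most one. -/
structure Admissible (θ : Plane → ℝ≥0∞) : Prop where
  meas : Measurable θ
  le_one : ∀ x, θ x ≤ 1
  imp_le : imp θ ≤ 1

/-- Twice the maximal energy among admissible densities. -/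
def interactionMax : ℝ≥0∞ := ⨆ (θ : Plane → ℝ≥0∞) (_ : Admissible θ), interaction θ θ

variable {θ φ η : Plane → ℝ≥0∞}

theorem Admissible.interaction_le (h : Admissible θ) : interaction θ θ ≤ interactionMax :=
  le_iSup₂ (f := fun (θ : Plane → ℝ≥0∞) (_ : Admissible θ) => interaction θ θ) θ h

theorem measurable_pot (hθ : Measurable θ) : Measurable (pot θ) := by
  unfold pot
  exact Measurable.lintegral_prod_right'
    (f := fun p : Plane × Plane => greenKernel p.1 p.2 * θ p.2)
    (measurable_greenKernel.mul (hθ.comp measurable_snd))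

theorem pot_add (hθ : Measurable θ) (x : Plane) : pot (θ + φ) x = pot θ x + pot φ x := by
  unfold pot
  rw [← lintegral_add_left (by fun_prop)]
  simp only [Pi.add_apply, mul_add]

theorem pot_mono (h : ∀ x, θ x ≤ φ x) (x : Plane) : pot θ x ≤ pot φ x :=
  lintegral_mono fun y => mul_le_mul_right (h y) _

theorem pot_congr (h : θ =ᵐ[volume.restrict upperHalf] φ) (x : Plane) : pot θ x = pot φ x :=
  lintegral_congr_ae (h.mono fun y hy => by simp only [hy])

theorem interaction_congr (h : θ =ᵐ[volume.restrict upperHalf] φ) : interaction θ θ = interaction φ φ :=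
  lintegral_congr_ae (h.mono fun y hy => by simp only [hy, pot_congr h])

theorem imp_congr (h : θ =ᵐ[volume.restrict upperHalf] φ) : imp θ = imp φ :=
  lintegral_congr_ae (h.mono fun y hy => by simp only [hy])

theorem imp_mono (h : ∀ x, θ x ≤ φ x) : imp θ ≤ imp φ :=
  lintegral_mono fun y => mul_le_mul_right (h y) _

theorem imp_add (hθ : Measurable θ) : imp (θ + φ) = imp θ + imp φ := by
  unfold imp
  rw [← lintegral_add_left (by fun_prop)]
  simp only [Pi.add_apply, mul_add]

theorem imp_const_mul (hθ : Measurable θ) (c : ℝ≥0∞) : imp (fun y => c * θ y) = c * imp θ := by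
  unfold imp
  rw [← lintegral_const_mul _ (by fun_prop)]
  simp only [mul_left_comm]

theorem interaction_mono (h : ∀ x, θ x ≤ φ x) : interaction θ θ ≤ interaction φ φ :=
  lintegral_mono fun x => mul_le_mul' (pot_mono h x) (h x)

theorem interaction_comm (hθ : Measurable θ) (hφ : Measurable φ) : interaction θ φ = interaction φ θ := by
  have hg := measurable_greenKernel
  unfold interaction pot
  have h1 : ∀ x, (∫⁻ y in upperHalf, greenKernel x y * θ y) * φ x =
      ∫⁻ y in upperHalf, greenKernel x y * θ y * φ x := fun x =>
    (lintegral_mul_const _ (by fun_prop)).symm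
  have h2 : ∀ x, (∫⁻ y in upperHalf, greenKernel x y * φ y) * θ x =
      ∫⁻ y in upperHalf, greenKernel x y * φ y * θ x := fun x =>
    (lintegral_mul_const _ (by fun_prop)).symm
  simp_rw [h1, h2]
  rw [lintegral_lintegral_swap]
  · refine lintegral_congr fun x => lintegral_congr fun y => ?_
    rw [greenKernel_comm]; ring
  · exact ((hg.mul (hθ.comp measurable_snd)).mul (hφ.comp measurable_fst)).aemeasurable

theorem interaction_add_right (hθ : Measurable θ) (hφ : Measurable φ) :
    interaction θ (φ + η) = interaction θ φ + interaction θ η := by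
  unfold interaction
  have hm : Measurable fun x => pot θ x * φ x := (measurable_pot hθ).mul hφ
  rw [← lintegral_add_left hm]
  simp only [Pi.add_apply, mul_add]

theorem interaction_add_left (hθ : Measurable θ) (hφ : Measurable φ) (hη : Measurable η) :
    interaction (θ + φ) η = interaction θ η + interaction φ η := by
  rw [interaction_comm (hθ.add hφ) hη, interaction_add_right hη hθ, interaction_comm hη hθ, interaction_comm hη hφ]

theorem interaction_const_mul_right (hθ : Measurable θ) (hφ : Measurable φ) (c : ℝ≥0∞) :
    interaction θ (fun y => c * φ y) = c * interaction θ φ := by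
  unfold interaction
  have hm : Measurable fun x => pot θ x * φ x := (measurable_pot hθ).mul hφ
  rw [← lintegral_const_mul _ hm]
  simp only [mul_left_comm]

theorem pot_indicator_add_compl (hθ : Measurable θ) {s : Set Plane} (hs : MeasurableSet s)
    (x : Plane) : pot (s.indicator θ) x + pot (sᶜ.indicator θ) x = pot θ x := by
  rw [← pot_add (hθ.indicator hs), indicator_self_add_compl]

theorem pot_indicator_eq_setLIntegral {s : Set Plane} (hs : MeasurableSet s) (x : Plane) :
    pot (s.indicator θ) x = ∫⁻ y in s ∩ upperHalf, greenKernel x y * θ y := by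
  unfold pot
  rw [← Measure.restrict_restrict hs, ← lintegral_indicator hs]
  refine lintegral_congr fun y => ?_
  by_cases h : y ∈ s <;> simp [h]

/-- Outside the disc the kernel is at most a constant times `y₂`, and integrating `y₂ θ` gives the
impulse. -/
theorem pot_far_le (hθ : Measurable θ) {x : Plane} (hx : x ∈ upperHalf) {ρ : ℝ} (hρ : 0 < ρ) :
    pot ((Metric.ball x ρ)ᶜ.indicator θ) x ≤
      ENNReal.ofReal (x 1 / (Real.pi * ρ ^ 2)) * imp θ := by
  have hms : MeasurableSet (Metric.ball x ρ)ᶜ := Metric.isOpen_ball.measurableSet.compl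
  rw [pot_indicator_eq_setLIntegral hms, imp, ← lintegral_const_mul _ (by fun_prop)]
  refine le_trans ?_ (lintegral_mono_set (s := (Metric.ball x ρ)ᶜ ∩ upperHalf) inter_subset_right)
  refine setLIntegral_mono' (hms.inter measurableSet_upperHalf) fun y hy => ?_
  rw [← mul_assoc]
  gcongr
  refine greenKernel_le_sq hx hy.2 hρ ?_
  simpa [dist_eq_norm, norm_sub_rev] using hy.1

theorem pot_near_le (h1 : ∀ x, θ x ≤ 1) {x : Plane} (hx : x ∈ upperHalf) {δ : ℝ}
    (hδ : 0 ≤ δ) : pot ((Metric.ball x δ).indicator θ) x ≤ ENNReal.ofReal (2 * δ * x 1) := by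
  have hx' : 0 < x 1 := hx
  have hms : MeasurableSet (Metric.ball x δ) := Metric.isOpen_ball.measurableSet
  rw [pot_indicator_eq_setLIntegral hms]
  calc ∫⁻ y in Metric.ball x δ ∩ upperHalf, greenKernel x y * θ y
      ≤ ∫⁻ y in Metric.ball x δ ∩ upperHalf, ENNReal.ofReal (x 1 / Real.pi) * ‖x - y‖ₑ⁻¹ := by
        refine setLIntegral_mono' (hms.inter measurableSet_upperHalf) fun y hy => ?_
        calc greenKernel x y * θ y ≤ greenKernel x y * 1 := by gcongr; exact h1 y
          _ ≤ _ := by rw [mul_one]; exact greenKernel_le hx hy.2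
    _ ≤ ∫⁻ y in Metric.ball x δ, ENNReal.ofReal (x 1 / Real.pi) * ‖x - y‖ₑ⁻¹ :=
        lintegral_mono_set inter_subset_left
    _ = ENNReal.ofReal (2 * δ * x 1) := by
        rw [lintegral_const_mul _ (by fun_prop), lintegral_ball_inv_norm x hδ,
          ← ENNReal.ofReal_mul (by positivity)]
        congr 1
        field_simp

theorem pot_le_of_imp (hθ : Measurable θ) (h1 : ∀ x, θ x ≤ 1) {x : Plane} (hx : x ∈ upperHalf)
    {δ : ℝ} (hδ : 0 < δ) :
    pot θ x ≤ ENNReal.ofReal (2 * δ * x 1) + ENNReal.ofReal (x 1 / (Real.pi * δ ^ 2)) * imp θ := by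
  rw [← pot_indicator_add_compl hθ (Metric.isOpen_ball (x := x) (ε := δ)).measurableSet x]
  exact add_le_add (pot_near_le h1 hx hδ.le) (pot_far_le hθ hx hδ)

/-- Near and far fields are split at distance `1`, giving the constant `2 + 1 / π ≤ 3`. -/
theorem Admissible.pot_le (h : Admissible θ) {x : Plane} (hx : x ∈ upperHalf) :
    pot θ x ≤ ENNReal.ofReal (3 * x 1) := by
  have hx' : 0 < x 1 := hx
  refine (pot_le_of_imp h.meas h.le_one hx one_pos).trans ?_
  calc _ ≤ ENNReal.ofReal (2 * 1 * x 1) + ENNReal.ofReal (x 1 / (Real.pi * 1 ^ 2)) * 1 := by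
        gcongr; exact h.imp_le
    _ ≤ _ := by
        rw [mul_one (ENNReal.ofReal _), ← ENNReal.ofReal_add (by positivity) (by positivity)]
        refine ENNReal.ofReal_le_ofReal ?_
        have : x 1 / (Real.pi * 1 ^ 2) ≤ x 1 := by
          refine div_le_self hx'.le ?_
          linarith [Real.pi_gt_three]
        linarith

theorem Admissible.pot_ne_top (h : Admissible θ) {x : Plane} (hx : x ∈ upperHalf) :
    pot θ x ≠ ∞ := ne_top_of_le_ne_top ENNReal.ofReal_ne_top (h.pot_le hx)

/-- A potential bound proportional to `x₂` integrates against `θ` to a multiple of the impulse. For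
this reason all decay estimates for potentials have the form `ε x₂`. -/
theorem interaction_le_of_pot_le (hθ : Measurable θ) {s : Set Plane} {c : ℝ≥0∞}
    (h : ∀ x ∈ upperHalf, x ∈ s → pot φ x ≤ c * ENNReal.ofReal (x 1)) :
    interaction φ (s.indicator θ) ≤ c * imp θ := by
  unfold interaction imp
  rw [← lintegral_const_mul _ (by fun_prop)]
  refine setLIntegral_mono' measurableSet_upperHalf fun x hx => ?_
  by_cases hxs : x ∈ s
  · rw [indicator_of_mem hxs, ← mul_assoc]
    gcongr
    exact h x hx hxs
  · simp [hxs]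

theorem Admissible.interaction_le_three (h : Admissible θ) : interaction θ θ ≤ 3 := by
  have := interaction_le_of_pot_le (φ := θ) (s := univ) (c := 3) h.meas fun x hx _ => by
    refine (h.pot_le hx).trans_eq ?_
    rw [ENNReal.ofReal_mul (by norm_num)]; simp
  rw [indicator_univ] at this
  refine this.trans ?_
  calc 3 * imp θ ≤ 3 * 1 := by gcongr; exact h.imp_le
    _ = 3 := mul_one _

theorem interactionMax_ne_top : interactionMax ≠ ∞ :=
  ne_top_of_le_ne_top (by norm_num) (iSup₂_le fun _ h => h.interaction_le_three)

theorem Admissible.interaction_ne_top (h : Admissible θ) : interaction θ θ ≠ ∞ :=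
  ne_top_of_le_ne_top interactionMax_ne_top h.interaction_le

end

section

/-! ### Reflections in vertical lines -/

/-- The reflection in the vertical line `x₁ = t`. -/
def mirror (t : ℝ) (x : Plane) : Plane := !₂[2 * t - x 0, x 1]

@[simp] theorem mirror_apply_zero (t : ℝ) (x : Plane) : mirror t x 0 = 2 * t - x 0 := rfl

@[simp] theorem mirror_apply_one (t : ℝ) (x : Plane) : mirror t x 1 = x 1 := rfl

theorem plane_ext {x y : Plane} (h0 : x 0 = y 0) (h1 : x 1 = y 1) : x = y := by
  ext i; fin_cases i <;> assumption

@[simp] theorem mirror_mirror (t : ℝ) (x : Plane) : mirror t (mirror t x) = x :=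
  plane_ext (by simp) (by simp)

@[fun_prop]
theorem measurable_mirror (t : ℝ) : Measurable (mirror t) := by unfold mirror; fun_prop

theorem norm_mirror_sub_mirror (t : ℝ) (x y : Plane) : ‖mirror t x - mirror t y‖ = ‖x - y‖ := by
  rw [← sq_eq_sq₀ (norm_nonneg _) (norm_nonneg _), norm_sub_sq_eq, norm_sub_sq_eq]
  simp only [mirror_apply_zero, mirror_apply_one]; ring

/-- The reflection `(x₁, x₂) ↦ (-x₁, x₂)` as a linear isometry. -/
def flip : Plane ≃ₗᵢ[ℝ] Plane :=
  LinearIsometryEquiv.piLpCongrRight 2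
    ![LinearIsometryEquiv.neg ℝ, LinearIsometryEquiv.refl ℝ ℝ]

theorem measurePreserving_mirror (t : ℝ) : MeasurePreserving (mirror t) := by
  have h : mirror t = fun x => flip x + !₂[2 * t, 0] := by
    funext x
    refine plane_ext ?_ ?_ <;> simp [flip, mirror, LinearIsometryEquiv.piLpCongrRight]
    ring
  rw [h]
  exact (measurePreserving_add_right volume _).comp flip.measurePreserving

theorem mirror_mem_upperHalf {t : ℝ} {x : Plane} : mirror t x ∈ upperHalf ↔ x ∈ upperHalf :=
  Iff.rfl

theorem greenKernel_mirror_mirror (t : ℝ) (x y : Plane) :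
    greenKernel (mirror t x) (mirror t y) = greenKernel x y := by
  have h : mirror t x = mirror t y ↔ x = y :=
    ⟨fun h => by simpa using congrArg (mirror t) h, congrArg _⟩
  simp only [greenKernel, green, norm_mirror_sub_mirror, h, mirror_apply_one]

theorem greenKernel_mirror_left (t : ℝ) (x y : Plane) :
    greenKernel (mirror t x) y = greenKernel x (mirror t y) := by
  rw [← greenKernel_mirror_mirror t x, mirror_mirror]

/-- The part of the upper half-plane to the right of the line `x₁ = t`. -/
def rightOf (t : ℝ) : Set Plane := upperHalf ∩ {x | t < x 0}

theorem measurableSet_right (t : ℝ) : MeasurableSet {x : Plane | t < x 0} :=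
  measurableSet_lt measurable_const (measurable_coord 0)

theorem measurableSet_rightOf (t : ℝ) : MeasurableSet (rightOf t) :=
  measurableSet_upperHalf.inter (measurableSet_right t)

/-- Reflecting one of two points on the same side of a vertical line increases their distance and
keeps both heights. The value `∞` on the diagonal keeps the inequality strict when `x = y`. -/
theorem greenKernel_mirror_lt {t : ℝ} {x y : Plane} (hx : x ∈ rightOf t) (hy : y ∈ rightOf t) :
    greenKernel x (mirror t y) < greenKernel x y := by
  have hx0 : t < x 0 := hx.2
  have hy0 : t < y 0 := hy.2
  have hx1 : 0 < x 1 := hx.1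
  have hy1 : 0 < y 1 := hy.1
  have hne : x ≠ mirror t y := fun h => by
    have := congrArg (fun z : Plane => z 0) h
    simp only [mirror_apply_zero] at this
    linarith
  rw [greenKernel_of_ne hne]
  rcases eq_or_ne x y with rfl | hxy
  · simp [greenKernel]
  rw [greenKernel_of_ne hxy, ENNReal.ofReal_lt_ofReal_iff (green_pos hx.1 hy.1 hxy)]
  unfold green
  have hn : 0 < ‖x - y‖ := norm_pos_iff.2 (sub_ne_zero.2 hxy)
  have hlt : ‖x - y‖ ^ 2 < ‖x - mirror t y‖ ^ 2 := by
    rw [norm_sub_sq_eq, norm_sub_sq_eq]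
    simp only [mirror_apply_zero, mirror_apply_one]
    nlinarith [mul_pos (sub_pos.2 hx0) (sub_pos.2 hy0)]
  rw [mirror_apply_one]
  gcongr

theorem volume_vertical_line (t : ℝ) : volume {x : Plane | x 0 = t} = 0 := by
  have h := (PiLp.volume_preserving_ofLp (ι := Fin 2)).measure_preimage
    (s := {f : Fin 2 → ℝ | f 0 = t})
    (measurableSet_eq_fun (measurable_pi_apply 0) measurable_const).nullMeasurableSet
  exact h.trans (Measure.pi_hyperplane _ _ _)

/-- The half-plane is folded along the null line `x₁ = t`, so that mirror pairs of points can be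
compared under one integral. -/
theorem lintegral_upperHalf_eq (t : ℝ) {f : Plane → ℝ≥0∞} (hf : Measurable f) :
    ∫⁻ x in upperHalf, f x = ∫⁻ x in rightOf t, (f x + f (mirror t x)) := by
  rw [lintegral_add_left hf, ← lintegral_inter_add_sdiff f upperHalf (measurableSet_right t)]
  congr 1
  have hpre : rightOf t = mirror t ⁻¹' (upperHalf ∩ {x | x 0 < t}) := by
    ext x
    simp only [rightOf, mem_inter_iff, mem_ofPred_eq, mem_preimage, mirror_mem_upperHalf,
      mirror_apply_zero]
    constructor <;> rintro ⟨h1, h2⟩ <;> exact ⟨h1, by linarith⟩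
  rw [hpre, (measurePreserving_mirror t).setLIntegral_comp_preimage
    (measurableSet_upperHalf.inter (measurableSet_lt (measurable_coord 0) measurable_const)) hf]
  refine setLIntegral_congr ?_
  have h := measure_eq_zero_iff_ae_notMem.1 (volume_vertical_line t)
  filter_upwards [h] with x hx
  have hx : x 0 ≠ t := hx
  refine propext (and_congr_right fun _ => ?_)
  exact ⟨fun h => lt_of_le_of_ne (not_lt.1 h) hx, fun h h' => lt_asymm (show x 0 < t from h) h'⟩

theorem imp_eq_rightOf (t : ℝ) {θ : Plane → ℝ≥0∞} (hθ : Measurable θ) :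
    imp θ = ∫⁻ x in rightOf t, ENNReal.ofReal (x 1) * (θ x + θ (mirror t x)) := by
  rw [imp, lintegral_upperHalf_eq t (by fun_prop)]
  simp only [mirror_apply_one, mul_add]

theorem pot_eq_rightOf (t : ℝ) {θ : Plane → ℝ≥0∞} (hθ : Measurable θ) (x : Plane) :
    pot θ x = ∫⁻ y in rightOf t,
      (greenKernel x y * θ y + greenKernel x (mirror t y) * θ (mirror t y)) := by
  rw [pot, lintegral_upperHalf_eq t (by fun_prop)]

/-- Each pair of mirror pairs contributes four products, but reflection invariance leaves only two
kernel values: one for points on the same side and one for points on opposite sides. -/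
theorem interaction_eq_rightOf (t : ℝ) {θ : Plane → ℝ≥0∞} (hθ : Measurable θ) :
    interaction θ θ = ∫⁻ x in rightOf t, ∫⁻ y in rightOf t,
      (greenKernel x y * (θ x * θ y + θ (mirror t x) * θ (mirror t y)) +
        greenKernel x (mirror t y) * (θ x * θ (mirror t y) + θ (mirror t x) * θ y)) := by
  have hp := measurable_pot hθ
  have hk : ∀ z, Measurable fun y => greenKernel z (mirror t y) := fun z =>
    (measurable_greenKernel_right z).comp (measurable_mirror t)
  rw [interaction, lintegral_upperHalf_eq t (by fun_prop)]
  refine lintegral_congr fun x => ?_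
  rw [pot_eq_rightOf t hθ, pot_eq_rightOf t hθ, ← lintegral_mul_const _ (by fun_prop),
    ← lintegral_mul_const _ (by fun_prop), ← lintegral_add_left (by fun_prop)]
  refine lintegral_congr fun y => ?_
  rw [greenKernel_mirror_mirror, greenKernel_mirror_left]
  ring

/-! ### Polarization -/

/-- The polarization (two-point rearrangement) of `θ` towards the right of the line `x₁ = t`. -/
def polarize (t : ℝ) (θ : Plane → ℝ≥0∞) (x : Plane) : ℝ≥0∞ :=
  if t < x 0 then max (θ x) (θ (mirror t x)) else min (θ x) (θ (mirror t x))

variable {θ : Plane → ℝ≥0∞} {t : ℝ}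

theorem measurable_polarize (hθ : Measurable θ) : Measurable (polarize t θ) :=
  Measurable.ite (measurableSet_right t) (by fun_prop) (by fun_prop)

theorem polarize_of_mem {x : Plane} (hx : x ∈ rightOf t) :
    polarize t θ x = max (θ x) (θ (mirror t x)) := if_pos hx.2

theorem polarize_mirror_of_mem {x : Plane} (hx : x ∈ rightOf t) :
    polarize t θ (mirror t x) = min (θ x) (θ (mirror t x)) := by
  have hx0 : t < x 0 := hx.2
  rw [polarize, if_neg, mirror_mirror, min_comm]
  simp only [mirror_apply_zero]; linarith

theorem imp_polarize (hθ : Measurable θ) : imp (polarize t θ) = imp θ := by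
  rw [imp_eq_rightOf t hθ, imp_eq_rightOf t (measurable_polarize hθ)]
  refine setLIntegral_congr_fun (measurableSet_rightOf t) fun x hx => ?_
  simp only [polarize_of_mem hx, polarize_mirror_of_mem hx, max_add_min]

theorem polarize_le (h1 : ∀ x, θ x ≤ 1) (x : Plane) : polarize t θ x ≤ 1 := by
  unfold polarize
  split_ifs
  · exact max_le (h1 _) (h1 _)
  · exact (min_le_left _ _).trans (h1 _)

theorem Admissible.polarize (h : Admissible θ) : Admissible (polarize t θ) :=
  ⟨measurable_polarize h.meas, polarize_le h.le_one, (imp_polarize h.meas).trans_le h.imp_le⟩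

/-- Sorting both pairs the same way puts the larger products on the larger kernel value `g`. Nothing
changes when the pairs are already sorted alike; otherwise the gain is `g - h` times the product of
the two gaps. Keeping the exact gain, not just an inequality, gives the equality case. -/
theorem max_min_identity {a b c d g h : ℝ≥0∞} (hgh : h ≤ g) (ha : a ≠ ∞) (hb : b ≠ ∞) (hc : c ≠ ∞)
    (hd : d ≠ ∞) :
    g * (max a b * max c d + min a b * min c d) + h * (max a b * min c d + min a b * max c d) =
      g * (a * c + b * d) + h * (a * d + b * c) +
        (g - h) * ((a - b) * (d - c) + (b - a) * (c - d)) := by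
  obtain ⟨k, hk, rfl⟩ : ∃ k, g - h = k ∧ g = h + k :=
    ⟨g - h, rfl, (add_tsub_cancel_of_le hgh).symm⟩
  rw [hk]
  rcases le_total a b with hab | hab <;> rcases le_total c d with hcd | hcd <;>
  obtain ⟨u, rfl⟩ := exists_add_of_le hab <;> obtain ⟨v, rfl⟩ := exists_add_of_le hcd <;>
  simp only [max_eq_left hab, max_eq_right hab, min_eq_left hab, min_eq_right hab,
    max_eq_left hcd, max_eq_right hcd, min_eq_left hcd, min_eq_right hcd,
    tsub_eq_zero_of_le hab, tsub_eq_zero_of_le hcd, ENNReal.add_sub_cancel_left, ha, hb, hc, hd,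
    ne_eq, not_false_eq_true] <;> ring

/-- The nonnegative defect by which polarization increases the integrand of the energy. -/
def defect (t : ℝ) (θ : Plane → ℝ≥0∞) (x y : Plane) : ℝ≥0∞ :=
  (greenKernel x y - greenKernel x (mirror t y)) *
    ((θ x - θ (mirror t x)) * (θ (mirror t y) - θ y) +
      (θ (mirror t x) - θ x) * (θ y - θ (mirror t y)))

theorem measurable_defect (hθ : Measurable θ) :
    Measurable fun p : Plane × Plane => defect t θ p.1 p.2 := by
  have h2 : Measurable fun p : Plane × Plane => greenKernel p.1 (mirror t p.2) :=
    measurable_greenKernel.comp (measurable_fst.prodMk ((measurable_mirror t).comp measurable_snd))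
  have h1 := measurable_greenKernel
  unfold defect
  fun_prop

theorem measurable_defect_right (hθ : Measurable θ) (x : Plane) : Measurable (defect t θ x) :=
  (measurable_defect hθ).comp measurable_prodMk_left

theorem interaction_polarize (hθ : Measurable θ) (h1 : ∀ x, θ x ≤ 1) :
    interaction (polarize t θ) (polarize t θ) = interaction θ θ +
      ∫⁻ x in rightOf t, ∫⁻ y in rightOf t, defect t θ x y := by
  have hD := measurable_defect (t := t) hθ
  have hf : ∀ x, θ x ≠ ∞ := fun x => ne_top_of_le_ne_top ENNReal.one_ne_top (h1 x)
  rw [interaction_eq_rightOf t hθ, interaction_eq_rightOf t (measurable_polarize hθ),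
    ← lintegral_add_right _ hD.lintegral_prod_right']
  refine setLIntegral_congr_fun (measurableSet_rightOf t) fun x hx => ?_
  simp only
  rw [← lintegral_add_right _ (measurable_defect_right hθ x)]
  refine setLIntegral_congr_fun (measurableSet_rightOf t) fun y hy => ?_
  simp only [polarize_of_mem hx, polarize_of_mem hy, polarize_mirror_of_mem hx,
    polarize_mirror_of_mem hy]
  exact max_min_identity (greenKernel_mirror_lt hx hy).le (hf _) (hf _) (hf _) (hf _)

theorem interaction_le_polarize (hθ : Measurable θ) (h1 : ∀ x, θ x ≤ 1) :
    interaction θ θ ≤ interaction (polarize t θ) (polarize t θ) := by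
  rw [interaction_polarize hθ h1]; exact le_self_add

/-- If polarization does not increase the energy, then `θ` is ordered with its mirror image. -/
theorem mirror_dichotomy (hθ : Measurable θ) (h1 : ∀ x, θ x ≤ 1) (hfin : interaction θ θ ≠ ∞)
    (hle : interaction (polarize t θ) (polarize t θ) ≤ interaction θ θ) :
    (∀ᵐ x ∂volume.restrict (rightOf t), θ (mirror t x) ≤ θ x) ∨
      ∀ᵐ x ∂volume.restrict (rightOf t), θ x ≤ θ (mirror t x) := by
  have hD := measurable_defect (t := t) hθ
  rw [interaction_polarize hθ h1] at hle
  have h0 : ∫⁻ x in rightOf t, ∫⁻ y in rightOf t, defect t θ x y = 0 := by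
    have := ENNReal.le_sub_of_add_le_left hfin hle
    simpa using this
  rw [lintegral_eq_zero_iff hD.lintegral_prod_right'] at h0
  -- If both orderings fail, some `x` has the larger value on the right and some `y` the larger
  -- value on the left, both generic for the vanishing of the defect. The defect at `(x, y)` is then
  -- a product of positive factors.
  by_contra! hcon
  obtain ⟨hc1, hc2⟩ := hcon
  have h0' : ∀ᵐ x ∂volume.restrict (rightOf t),
      x ∈ rightOf t ∧ ∫⁻ y in rightOf t, defect t θ x y = 0 :=
    (ae_restrict_mem (measurableSet_rightOf t)).and h0
  obtain ⟨x, hx1, hx, hx2⟩ := (hc2.and_eventually h0').exists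
  rw [lintegral_eq_zero_iff (measurable_defect_right hθ x)] at hx2
  have hx2' : ∀ᵐ y ∂volume.restrict (rightOf t), y ∈ rightOf t ∧ defect t θ x y = 0 :=
    (ae_restrict_mem (measurableSet_rightOf t)).and hx2
  obtain ⟨y, hy1, hy, hy2⟩ := (hc1.and_eventually hx2').exists
  unfold defect at hy2
  have hg := tsub_pos_of_lt (greenKernel_mirror_lt hx hy)
  have hxx := tsub_pos_of_lt hx1
  have hyy := tsub_pos_of_lt hy1
  simp only [mul_eq_zero, add_eq_zero, hg.ne', hxx.ne', hyy.ne', false_or, false_and] at hy2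

/-- On a folded pair the difference of the two potentials factors into the kernel gap times the
density gap. -/
theorem pot_eq_pot_mirror_add (hθ : Measurable θ)
    (hle : ∀ᵐ x ∂volume.restrict (rightOf t), θ (mirror t x) ≤ θ x) {x : Plane}
    (hx : x ∈ rightOf t) :
    pot θ x = pot θ (mirror t x) + ∫⁻ y in rightOf t,
      (greenKernel x y - greenKernel x (mirror t y)) * (θ y - θ (mirror t y)) := by
  have hk : ∀ z, Measurable fun y => greenKernel z (mirror t y) := fun z =>
    (measurable_greenKernel_right z).comp (measurable_mirror t)
  rw [pot_eq_rightOf t hθ x, pot_eq_rightOf t hθ, ← lintegral_add_right _ (by fun_prop)]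
  refine lintegral_congr_ae ?_
  filter_upwards [hle, ae_restrict_mem (measurableSet_rightOf t)] with y hy1 hy
  rw [greenKernel_mirror_mirror, greenKernel_mirror_left]
  obtain ⟨k, hk, hk'⟩ : ∃ k, greenKernel x y - greenKernel x (mirror t y) = k ∧
      greenKernel x y = greenKernel x (mirror t y) + k :=
    ⟨_, rfl, (add_tsub_cancel_of_le (greenKernel_mirror_lt hx hy).le).symm⟩
  obtain ⟨u, hu, hu'⟩ : ∃ u, θ y - θ (mirror t y) = u ∧ θ y = θ (mirror t y) + u :=
    ⟨_, rfl, (add_tsub_cancel_of_le hy1).symm⟩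
  rw [hk, hu, hk', hu']
  ring

/-- The kernel gap is positive everywhere, so the difference of the potentials could vanish only if
the density gap vanished almost everywhere. -/
theorem pot_mirror_lt (hθ : Measurable θ)
    (hle : ∀ᵐ x ∂volume.restrict (rightOf t), θ (mirror t x) ≤ θ x)
    (hne : ¬ ∀ᵐ x ∂volume.restrict (rightOf t), θ x ≤ θ (mirror t x)) {x : Plane}
    (hx : x ∈ rightOf t) (hfin : pot θ (mirror t x) ≠ ∞) : pot θ (mirror t x) < pot θ x := by
  have hk : ∀ z, Measurable fun y => greenKernel z (mirror t y) := fun z =>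
    (measurable_greenKernel_right z).comp (measurable_mirror t)
  rw [pot_eq_pot_mirror_add hθ hle hx]
  refine ENNReal.lt_add_right hfin fun h0 => hne ?_
  rw [lintegral_eq_zero_iff (by fun_prop)] at h0
  filter_upwards [h0, ae_restrict_mem (measurableSet_rightOf t)] with y hy0 hy
  have hg := tsub_pos_of_lt (greenKernel_mirror_lt hx hy)
  exact tsub_eq_zero_iff_le.1 ((mul_eq_zero.1 hy0).resolve_left hg.ne')

end

section

/-! ### The axis of symmetry of a maximizer -/

variable {θ : Plane → ℝ≥0∞} {t : ℝ}

/-- The distribution of the impulse of `θ` along the horizontal axis. -/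
def impDist (θ : Plane → ℝ≥0∞) : Measure ℝ :=
  ((volume.restrict upperHalf).withDensity fun x => ENNReal.ofReal (x 1) * θ x).map fun x => x 0

theorem impDist_apply {s : Set ℝ} (hs : MeasurableSet s) :
    impDist θ s = ∫⁻ x in upperHalf ∩ {x | x 0 ∈ s}, ENNReal.ofReal (x 1) * θ x := by
  have hs' : MeasurableSet {x : Plane | x 0 ∈ s} := measurable_coord 0 hs
  rw [impDist, Measure.map_apply (measurable_coord 0) hs]
  change Measure.withDensity _ _ {x : Plane | x 0 ∈ s} = _
  rw [withDensity_apply _ hs', Measure.restrict_restrict hs', inter_comm]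

theorem impDist_univ : impDist θ univ = imp θ := by
  rw [impDist_apply MeasurableSet.univ, imp]; simp

theorem impDist_Ioi : impDist θ (Ioi t) = ∫⁻ x in rightOf t, ENNReal.ofReal (x 1) * θ x :=
  impDist_apply measurableSet_Ioi

theorem impDist_mirror (hθ : Measurable θ) {s : Set ℝ} (hs : MeasurableSet s) :
    impDist θ ((fun a => 2 * t - a) ⁻¹' s) = impDist (fun x => θ (mirror t x)) s := by
  have key := (measurePreserving_mirror t).setLIntegral_comp_preimage
    (s := upperHalf ∩ {x : Plane | x 0 ∈ s})
    (measurableSet_upperHalf.inter (measurable_coord 0 hs))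
    (f := fun x => ENNReal.ofReal (x 1) * θ (mirror t x)) (by fun_prop)
  simp only [mirror_mirror, mirror_apply_one] at key
  rw [impDist_apply (by measurability), impDist_apply hs]
  exact key

theorem impDist_Iio (hθ : Measurable θ) :
    impDist θ (Iio t) = ∫⁻ x in rightOf t, ENNReal.ofReal (x 1) * θ (mirror t x) := by
  rw [← impDist_Ioi, ← impDist_mirror hθ measurableSet_Ioi]
  congr 1
  ext a
  simp only [mem_Iio, mem_preimage, mem_Ioi]
  constructor <;> intro h <;> linarith

theorem impDist_singleton : impDist θ {t} = 0 := by
  rw [impDist_apply (measurableSet_singleton t)]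
  refine setLIntegral_measure_zero _ _ (measure_mono_null inter_subset_right ?_)
  exact volume_vertical_line t

theorem impDist_Iic : impDist θ (Iic t) = impDist θ (Iio t) := by
  rw [← Iio_union_right, measure_union (by simp) (measurableSet_singleton t), impDist_singleton,
    add_zero]

theorem ae_upperHalf_of_ae_rightOf {p : Plane → Prop}
    (h : ∀ᵐ x ∂volume.restrict (rightOf t), p x ∧ p (mirror t x)) :
    ∀ᵐ x ∂volume.restrict upperHalf, p x := by
  rw [ae_restrict_iff' measurableSet_upperHalf]
  rw [ae_restrict_iff' (measurableSet_rightOf t)] at h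
  have h' := (measurePreserving_mirror t).quasiMeasurePreserving.ae h
  have hl := measure_eq_zero_iff_ae_notMem.1 (volume_vertical_line t)
  filter_upwards [h, h', hl] with x h1 h2 h3 hx
  have h3 : x 0 ≠ t := h3
  rcases lt_or_gt_of_ne h3 with h | h
  · have hm : mirror t x ∈ rightOf t := by
      refine ⟨hx, ?_⟩
      change t < 2 * t - x 0
      linarith
    simpa using (h2 hm).2
  · exact (h1 ⟨hx, h⟩).1

/-- Two ordered densities with equal finite impulse agree, because the weight `x₂` is positive. -/
theorem ae_mirror_eq_of_impDist_eq (hθ : Measurable θ)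
    (hle : ∀ᵐ x ∂volume.restrict (rightOf t), θ (mirror t x) ≤ θ x)
    (heq : impDist θ (Ioi t) ≤ impDist θ (Iio t)) (hfin : impDist θ (Iio t) ≠ ∞) :
    ∀ᵐ x ∂volume.restrict upperHalf, θ (mirror t x) = θ x := by
  rw [impDist_Ioi, impDist_Iio hθ] at heq
  rw [impDist_Iio hθ] at hfin
  have h := ae_eq_of_ae_le_of_lintegral_le (hle.mono fun x hx => mul_le_mul_right hx _) hfin
    (by fun_prop) heq
  refine ae_upperHalf_of_ae_rightOf (t := t) ?_
  filter_upwards [h, ae_restrict_mem (measurableSet_rightOf t)] with x hx hxm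
  have hx1 : 0 < x 1 := hxm.1
  have := (ENNReal.mul_right_inj (by simpa using hx1) ENNReal.ofReal_ne_top).1 hx
  simp [this]

theorem ae_mirror_eq_of_impDist_eq' (hθ : Measurable θ)
    (hle : ∀ᵐ x ∂volume.restrict (rightOf t), θ x ≤ θ (mirror t x))
    (heq : impDist θ (Iio t) ≤ impDist θ (Ioi t)) (hfin : impDist θ (Ioi t) ≠ ∞) :
    ∀ᵐ x ∂volume.restrict upperHalf, θ (mirror t x) = θ x := by
  rw [impDist_Ioi, impDist_Iio hθ] at heq
  rw [impDist_Ioi] at hfin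
  have h := ae_eq_of_ae_le_of_lintegral_le (hle.mono fun x hx => mul_le_mul_right hx _) hfin
    (by fun_prop) heq
  refine ae_upperHalf_of_ae_rightOf (t := t) ?_
  filter_upwards [h, ae_restrict_mem (measurableSet_rightOf t)] with x hx hxm
  have hx1 : 0 < x 1 := hxm.1
  have := (ENNReal.mul_right_inj (by simpa using hx1) ENNReal.ofReal_ne_top).1 hx
  simp [this]

theorem impDist_congr {φ : Plane → ℝ≥0∞} (h : θ =ᵐ[volume.restrict upperHalf] φ) :
    impDist θ = impDist φ := by
  unfold impDist
  congr 1
  exact withDensity_congr_ae (h.mono fun x hx => by simp only [hx])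

theorem impDist_Ioi_of_symmetric (hθ : Measurable θ)
    (h : ∀ᵐ x ∂volume.restrict upperHalf, θ (mirror t x) = θ x) (s : ℝ) :
    impDist θ (Ioi s) = impDist θ (Iio (2 * t - s)) := by
  rw [← impDist_congr (show (fun x => θ (mirror t x)) =ᵐ[volume.restrict upperHalf] θ from h),
    ← impDist_mirror hθ measurableSet_Ioi, impDist_congr h]
  congr 1
  ext a
  simp only [mem_Iio, mem_preimage, mem_Ioi]
  constructor <;> intro h <;> linarith

theorem impDist_Iio_of_symmetric (hθ : Measurable θ)
    (h : ∀ᵐ x ∂volume.restrict upperHalf, θ (mirror t x) = θ x) (s : ℝ) :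
    impDist θ (Iio s) = impDist θ (Ioi (2 * t - s)) := by
  rw [impDist_Ioi_of_symmetric hθ h]; congr 2; ring

/-- A density of finite impulse is symmetric about at most one vertical line. -/
theorem symmetric_unique (hθ : Measurable θ) (himp : imp θ = 1) {a b : ℝ} (hab : a < b)
    (ha : ∀ᵐ x ∂volume.restrict upperHalf, θ (mirror a x) = θ x)
    (hb : ∀ᵐ x ∂volume.restrict upperHalf, θ (mirror b x) = θ x) : False := by
  have : IsProbabilityMeasure (impDist θ) := ⟨impDist_univ.trans himp⟩
  -- The composition of the two reflections is the translation by `2 (b - a)`, so the distribution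
  -- function is periodic. Being also the distribution function of a probability measure, it is
  -- identically one, and symmetry about `a` then puts mass one on both sides of `a`.
  have hstep : ∀ s, impDist θ (Iio (s + 2 * (b - a))) = impDist θ (Iio s) := by
    intro s
    rw [impDist_Iio_of_symmetric hθ ha s, impDist_Ioi_of_symmetric hθ hb]
    congr 2; ring
  have hk : ∀ (k : ℕ) (s : ℝ), impDist θ (Iio (s + k * (2 * (b - a)))) = impDist θ (Iio s) := by
    intro k
    induction k with
    | zero => simp
    | succ k ih =>
      intro s
      rw [← ih s, ← hstep (s + k * (2 * (b - a)))]; congr 2; push_cast; ring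
  have hlim : ∀ s, impDist θ (Iio s) = 1 := by
    intro s
    have h1 : Filter.Tendsto (fun k : ℕ => s + k * (2 * (b - a))) Filter.atTop Filter.atTop :=
      Filter.tendsto_atTop_add_const_left _ _
        (tendsto_natCast_atTop_atTop.atTop_mul_const (by linarith))
    have h2 := (tendsto_measure_Iic_atTop (impDist θ)).comp h1
    have h3 : ((fun x => impDist θ (Iic x)) ∘ fun k : ℕ => s + k * (2 * (b - a))) =
        fun _ => impDist θ (Iio s) := by
      funext k
      simp only [Function.comp_apply, impDist_Iic, hk]
    rw [h3, measure_univ] at h2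
    exact tendsto_nhds_unique tendsto_const_nhds h2
  have h1 := hlim a
  have h2 := impDist_Iio_of_symmetric hθ ha a
  have h3 : impDist θ (Iio a) + impDist θ (Ioi a) ≤ 1 := by
    rw [← impDist_Iic, ← measure_union (Iic_disjoint_Ioi le_rfl) measurableSet_Ioi]
    exact prob_le_one
  rw [show 2 * a - a = a by ring, h1] at h2
  rw [h1, ← h2] at h3
  norm_num at h3

/-- Vertical lines carry no impulse, so the distribution function is continuous and takes the value
`1 / 2`. -/
theorem exists_impDist_median (himp : imp θ = 1) : ∃ τ, impDist θ (Iio τ) = 1 / 2 := by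
  have : IsProbabilityMeasure (impDist θ) := ⟨impDist_univ.trans himp⟩
  have hc : Continuous (ProbabilityTheory.cdf (impDist θ)) := by
    rw [continuous_iff_continuousAt]
    intro x
    have h1 : (ProbabilityTheory.cdf (impDist θ)).measure {x} = 0 := by
      rw [ProbabilityTheory.measure_cdf]; exact impDist_singleton
    rw [StieltjesFunction.measure_singleton, ENNReal.ofReal_eq_zero] at h1
    have hmono := ProbabilityTheory.monotone_cdf (impDist θ)
    refine hmono.continuousAt_iff_leftLim_eq_rightLim.2 ?_
    rw [StieltjesFunction.rightLim_eq]
    exact le_antisymm (hmono.leftLim_le le_rfl) (by linarith)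
  have h0 := ProbabilityTheory.tendsto_cdf_atBot (impDist θ)
  have h1 := ProbabilityTheory.tendsto_cdf_atTop (impDist θ)
  obtain ⟨τ, hτ⟩ := mem_range_of_exists_le_of_exists_ge hc
    ((h0.eventually_le_const (u := 1 / 2) (by norm_num)).exists)
    ((h1.eventually_const_le (u := 1 / 2) (by norm_num)).exists)
  refine ⟨τ, ?_⟩
  rw [← impDist_Iic, ← ProbabilityTheory.ofReal_cdf, hτ, ENNReal.ofReal_div_of_pos (by norm_num)]
  simp

/-- Every maximizer is symmetric about a vertical line `x₁ = τ`, and is strictly ordered with its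
mirror images in the lines to the left of it. -/
theorem exists_symmetry_axis (h : Admissible θ) (himp : imp θ = 1)
    (hmax : interaction θ θ = interactionMax) :
    ∃ τ, (∀ᵐ x ∂volume.restrict upperHalf, θ (mirror τ x) = θ x) ∧
      ∀ t < τ, (∀ᵐ x ∂volume.restrict (rightOf t), θ (mirror t x) ≤ θ x) ∧
        ¬ ∀ᵐ x ∂volume.restrict (rightOf t), θ x ≤ θ (mirror t x) := by
  have : IsProbabilityMeasure (impDist θ) := ⟨impDist_univ.trans himp⟩
  have hdich : ∀ t, (∀ᵐ x ∂volume.restrict (rightOf t), θ (mirror t x) ≤ θ x) ∨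
      ∀ᵐ x ∂volume.restrict (rightOf t), θ x ≤ θ (mirror t x) := fun t =>
    mirror_dichotomy h.meas h.le_one h.interaction_ne_top (hmax ▸ h.polarize.interaction_le)
  have hsum : ∀ t, impDist θ (Iio t) + impDist θ (Ioi t) = 1 := by
    intro t
    rw [← impDist_Iic, ← measure_union (Iic_disjoint_Ioi le_rfl) measurableSet_Ioi,
      Iic_union_Ioi, measure_univ]
  have hne : ∀ s : Set ℝ, impDist θ s ≠ ∞ := fun s => measure_ne_top _ _
  have hhalf : (1 : ℝ≥0∞) / 2 + 1 / 2 = 1 := ENNReal.add_halves 1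
  have hhalf' : (1 : ℝ≥0∞) / 2 ≠ ∞ := by simp
  obtain ⟨τ, hτ⟩ := exists_impDist_median himp
  have hτ' : impDist θ (Ioi τ) = 1 / 2 := by
    have := hsum τ
    rw [hτ] at this
    exact (ENNReal.add_right_inj hhalf').1 (this.trans hhalf.symm)
  -- At the median the two sides carry equal impulse, so either alternative of the dichotomy forces
  -- equality.
  have hsym : ∀ᵐ x ∂volume.restrict upperHalf, θ (mirror τ x) = θ x := by
    rcases hdich τ with h' | h'
    · exact ae_mirror_eq_of_impDist_eq h.meas h' (by rw [hτ, hτ']) (hne _)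
    · exact ae_mirror_eq_of_impDist_eq' h.meas h' (by rw [hτ, hτ']) (hne _)
  refine ⟨τ, hsym, fun t ht => ?_⟩
  have hnot : ¬ ∀ᵐ x ∂volume.restrict (rightOf t), θ x ≤ θ (mirror t x) := by
    -- The opposite order at `t < τ` would give the right side at most the impulse of the left,
    -- which the median forbids unless the two agree. Then `θ` would be symmetric about both `t` and
    -- `τ`.
    intro hle
    have h1 : impDist θ (Iio t) ≤ 1 / 2 := hτ ▸ measure_mono (Iio_subset_Iio ht.le)
    have h2 : 1 / 2 ≤ impDist θ (Ioi t) := hτ' ▸ measure_mono (Ioi_subset_Ioi ht.le)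
    exact symmetric_unique h.meas himp ht
      (ae_mirror_eq_of_impDist_eq' h.meas hle (h1.trans h2) (hne _)) hsym
  exact ⟨(hdich t).resolve_right hnot, hnot⟩

end

section

/-! ### Decay of the potential of a symmetrically decreasing density -/

variable {θ : Plane → ℝ≥0∞} {t : ℝ}

theorem pot_comp_mirror (hθ : Measurable θ) (x : Plane) :
    pot (fun y => θ (mirror t y)) x = pot θ (mirror t x) := by
  have key := (measurePreserving_mirror t).setLIntegral_comp_preimage
    measurableSet_upperHalf (f := fun y => greenKernel (mirror t x) y * θ y) (by fun_prop)
  simp only [greenKernel_mirror_mirror] at key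
  exact key

theorem imp_comp_mirror (hθ : Measurable θ) : imp (fun y => θ (mirror t y)) = imp θ :=
  (measurePreserving_mirror t).setLIntegral_comp_preimage
    measurableSet_upperHalf (f := fun y => ENNReal.ofReal (y 1) * θ y) (by fun_prop)

theorem interaction_comp_mirror (hθ : Measurable θ) :
    interaction (fun y => θ (mirror t y)) (fun y => θ (mirror t y)) = interaction θ θ := by
  have hp := measurable_pot hθ
  have key := (measurePreserving_mirror t).setLIntegral_comp_preimage
    measurableSet_upperHalf (f := fun y => pot θ y * θ y) (by fun_prop)
  simp only [← pot_comp_mirror hθ] at key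
  exact key

theorem Admissible.comp_mirror (h : Admissible θ) : Admissible fun y => θ (mirror t y) :=
  ⟨h.meas.comp (measurable_mirror t), fun _ => h.le_one _, (imp_comp_mirror h.meas).trans_le h.imp_le⟩

/-- `θ` dominates its mirror images in the lines to the left of the axis `x₁ = 0`. -/
def LeftOrdered (θ : Plane → ℝ≥0∞) : Prop :=
  ∀ t < 0, ∀ᵐ x ∂volume.restrict (rightOf t), θ (mirror t x) ≤ θ x

theorem LeftOrdered.impDist_mirror_le (h : LeftOrdered θ) (hθ : Measurable θ) (ht : t < 0)
    {s : Set ℝ} (hs : MeasurableSet s) (hst : s ⊆ Ioi t) :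
    impDist θ ((fun a => 2 * t - a) ⁻¹' s) ≤ impDist θ s := by
  rw [impDist_mirror hθ hs, impDist_apply hs, impDist_apply hs]
  refine lintegral_mono_ae ?_
  have hsub : upperHalf ∩ {x | x 0 ∈ s} ⊆ rightOf t := fun x hx => ⟨hx.1, hst hx.2⟩
  filter_upwards [ae_restrict_of_ae_restrict_of_subset hsub (h t ht)] with x hx
  gcongr

/-- Neighbouring strips of width `d` are mirror images in their common edge, so their impulses
decrease to the left. The first `n + 1` strips are disjoint and share a total of at most one. -/
theorem LeftOrdered.impDist_strip_le (h : LeftOrdered θ) (ha : Admissible θ) {d : ℝ} (hd : 0 < d)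
    (n : ℕ) : impDist θ (Ioo (-((n + 1) * d)) (-(n * d))) ≤ ENNReal.ofReal (1 / (n + 1)) := by
  set S : ℕ → Set ℝ := fun k => Ioo (-((k + 1) * d)) (-(k * d)) with hS
  have hstep : ∀ k, impDist θ (S (k + 1)) ≤ impDist θ (S k) := by
    intro k
    have ht : -((k + 1) * d) < 0 := by
      have : 0 < ((k : ℝ) + 1) * d := by positivity
      linarith
    refine le_of_eq_of_le ?_
      (h.impDist_mirror_le ha.meas ht measurableSet_Ioo (fun a ha => ha.1 : S k ⊆ _))
    congr 1
    ext a
    simp only [hS, mem_Ioo, mem_preimage]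
    push_cast
    constructor <;> rintro ⟨h1, h2⟩ <;> constructor <;> linarith
  have hanti : Antitone fun k => impDist θ (S k) := antitone_nat_of_succ_le hstep
  have hdisj : Pairwise (Function.onFun Disjoint S) := by
    have key : ∀ i j : ℕ, i < j → Disjoint (S i) (S j) := by
      intro i j hij
      rw [Set.disjoint_left]
      rintro a ⟨h1, -⟩ ⟨-, h2⟩
      have : ((i : ℝ) + 1) * d ≤ j * d := by
        gcongr
        exact_mod_cast hij
      linarith
    intro i j hij
    rcases lt_or_gt_of_ne hij with h | h
    · exact key i j h
    · exact (key j i h).symm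
  have hsum : ∑ k ∈ Finset.range (n + 1), impDist θ (S k) ≤ 1 := by
    rw [← measure_biUnion_finset (fun i _ j _ hij => hdisj hij) fun _ _ => measurableSet_Ioo]
    exact (measure_mono (subset_univ _)).trans (impDist_univ.trans_le ha.imp_le)
  have hle : (n + 1 : ℝ≥0∞) * impDist θ (S n) ≤ 1 := by
    refine le_trans ?_ hsum
    calc (n + 1 : ℝ≥0∞) * impDist θ (S n) = ∑ k ∈ Finset.range (n + 1), impDist θ (S n) := by
          simp
      _ ≤ _ := Finset.sum_le_sum fun k hk =>
          hanti (Nat.lt_succ_iff.1 (Finset.mem_range.1 hk))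
  rw [ENNReal.ofReal_div_of_pos (by positivity), ENNReal.ofReal_one,
    ENNReal.le_div_iff_mul_le (Or.inl (by simp; positivity)) (Or.inl ENNReal.ofReal_ne_top), mul_comm]
  refine le_of_eq_of_le ?_ hle
  congr 1
  rw [ENNReal.ofReal_add (by positivity) (by positivity)]; simp

theorem imp_indicator_ball_le (x : Plane) (ρ : ℝ) :
    imp ((Metric.ball x ρ).indicator θ) ≤ impDist θ (Ioo (x 0 - ρ) (x 0 + ρ)) := by
  have hs : MeasurableSet {y : Plane | y 0 ∈ Ioo (x 0 - ρ) (x 0 + ρ)} :=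
    measurable_coord 0 measurableSet_Ioo
  rw [impDist_apply measurableSet_Ioo, inter_comm, ← Measure.restrict_restrict hs,
    ← lintegral_indicator hs]
  refine lintegral_mono fun y => ?_
  by_cases h : y ∈ Metric.ball x ρ
  · rw [indicator_of_mem h, indicator_of_mem]
    have h1 := abs_coord_le (y - x) 0
    rw [Metric.mem_ball, dist_eq_norm] at h
    have h2 := abs_lt.1 (h1.trans_lt h)
    simp only [PiLp.sub_apply] at h2
    exact ⟨by linarith [h2.1], by linarith [h2.2]⟩
  · simp [h]

theorem LeftOrdered.imp_ball_le (h : LeftOrdered θ) (ha : Admissible θ) {ρ : ℝ} (hρ : 0 < ρ)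
    (n : ℕ) {x : Plane} (hx : x 0 ≤ -(2 * ρ * (n + 1))) :
    imp ((Metric.ball x ρ).indicator θ) ≤ ENNReal.ofReal (1 / (n + 1)) := by
  have hn : (0 : ℝ) < n + 1 := by positivity
  -- This width puts the left edge of strip number `n` at `x 0 - ρ`; the hypothesis on `x 0` makes
  -- the strip at least `2 ρ` wide, so it contains the projection of the disc.
  set d := (ρ - x 0) / (n + 1) with hd
  have hd' : (n + 1) * d = ρ - x 0 := by rw [hd]; field_simp
  have hd2 : 2 * ρ ≤ d := by
    rw [hd, le_div_iff₀ hn]; linarith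
  refine (imp_indicator_ball_le x ρ).trans ((measure_mono ?_).trans
    (h.impDist_strip_le ha (by linarith : 0 < d) n))
  refine Ioo_subset_Ioo ?_ ?_ <;> linarith

/-- At height above `ρ` every point of the disc has `y₂ ≥ x₂ - ρ`, so the impulse controls the mass
there. A smaller disc of radius `δ` absorbs the singularity. -/
theorem pot_near_le_of_high (hθ : Measurable θ) (h1 : ∀ x, θ x ≤ 1) {x : Plane}
    {δ ρ : ℝ} (hδ : 0 < δ) (hρ : 0 < ρ) (hx : ρ < x 1) :
    pot ((Metric.ball x ρ).indicator θ) x ≤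
      ENNReal.ofReal (2 * δ * x 1) + ENNReal.ofReal (x 1 / (Real.pi * δ * (x 1 - ρ))) * imp θ := by
  have hxU : x ∈ upperHalf := hρ.trans hx
  have hms : MeasurableSet (Metric.ball x δ) := Metric.isOpen_ball.measurableSet
  have hms' : MeasurableSet (Metric.ball x ρ) := Metric.isOpen_ball.measurableSet
  have hx1 : 0 < x 1 - ρ := sub_pos.2 hx
  rw [← pot_indicator_add_compl (hθ.indicator hms') hms]
  refine add_le_add (pot_near_le (fun y => ?_) hxU hδ.le) ?_
  · exact (indicator_le_self _ _ y).trans (h1 y)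
  · rw [pot, imp, ← lintegral_const_mul _ (by fun_prop)]
    refine setLIntegral_mono' measurableSet_upperHalf fun y hy => ?_
    by_cases hyδ : y ∈ Metric.ball x δ
    · simp [hyδ]
    by_cases hyρ : y ∈ Metric.ball x ρ
    swap
    · rw [indicator_of_mem (show y ∈ (Metric.ball x δ)ᶜ from hyδ), indicator_of_notMem hyρ]
      simp
    rw [indicator_of_mem (show y ∈ (Metric.ball x δ)ᶜ from hyδ), indicator_of_mem hyρ, ← mul_assoc]
    gcongr
    rw [Metric.mem_ball, dist_comm, dist_eq_norm] at hyδ hyρ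
    rw [not_lt] at hyδ
    have hy1 : x 1 - ρ ≤ y 1 := by
      have := coord_le_add_norm y x
      rw [norm_sub_rev] at this
      linarith
    have hne : x ≠ y := by rintro rfl; simp at hyδ; linarith
    have hx0 : 0 < x 1 := hxU
    rw [greenKernel_of_ne hne, ← ENNReal.ofReal_mul (by positivity)]
    refine ENNReal.ofReal_le_ofReal ((green_le_div hxU hy).trans ?_)
    calc x 1 / (Real.pi * ‖x - y‖) ≤ x 1 / (Real.pi * δ) := by gcongr
      _ = x 1 / (Real.pi * δ * (x 1 - ρ)) * (x 1 - ρ) := by field_simp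
      _ ≤ _ := by gcongr

/-- The potential is split over a disc of radius `δ`, the rest of the disc of radius `ρ`, and the
exterior. Only the middle piece uses the position of `x`: it is small at great height because little
mass fits the impulse, and far to the left because the strips carry little impulse. The radius `R`
does not depend on `θ`. -/
theorem exists_pot_le_of_leftOrdered {ε : ℝ} (hε : 0 < ε) :
    ∃ R > 0, ∀ θ : Plane → ℝ≥0∞, Admissible θ → LeftOrdered θ → ∀ x ∈ upperHalf,
      (R ≤ x 1 ∨ x 0 ≤ -R) → pot θ x ≤ ENNReal.ofReal (ε * x 1) := by
  have hpi := Real.pi_gt_three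
  -- Each piece gets a third of `ε`: the innermost disc costs `2 δ = ε / 3`, and `ρ` satisfies `ρ ≥
  -- 1` and `ε ρ ≥ 1`, whence `1 / (π ρ²) ≤ ε / 3`.
  set δ := ε / 6 with hδ
  have hδ0 : 0 < δ := by positivity
  set ρ := 1 + 1 / ε with hρ
  have hρ0 : 0 < ρ := by positivity
  have hfar : 1 / (Real.pi * ρ ^ 2) ≤ ε / 3 := by
    rw [div_le_div_iff₀ (by positivity) (by norm_num)]
    have h1 : 1 ≤ ε * ρ := by rw [hρ]; field_simp; linarith
    have h2 : 1 ≤ ρ := by rw [hρ]; linarith [show 0 < 1 / ε by positivity]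
    have h3 : 1 ≤ ε * ρ ^ 2 := by nlinarith
    nlinarith
  obtain ⟨n, hn⟩ := exists_nat_gt (1 / (δ ^ 2 * ε))
  have hnear : 1 / (Real.pi * δ ^ 2) * (1 / (n + 1)) ≤ ε / 3 := by
    rw [div_mul_div_comm, div_le_div_iff₀ (by positivity) (by norm_num)]
    rw [div_lt_iff₀ (by positivity)] at hn
    nlinarith [show 0 < δ ^ 2 * ε by positivity]
  -- The sum dominates both the height `ρ + 1 / (δ ε)` needed in the first case and the distance `2
  -- ρ (n + 1)` needed in the second.
  refine ⟨ρ + 1 / (δ * ε) + 2 * ρ * (n + 1), by positivity, fun θ ha hl x hx hR => ?_⟩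
  have hx0 : 0 < x 1 := hx
  have hp1 : 0 < 1 / (δ * ε) := by positivity
  have hp2 : 0 < 2 * ρ * (n + 1) := by positivity
  rw [← pot_indicator_add_compl ha.meas (Metric.isOpen_ball (x := x) (ε := ρ)).measurableSet x]
  have hfar' : pot ((Metric.ball x ρ)ᶜ.indicator θ) x ≤ ENNReal.ofReal (ε / 3 * x 1) := by
    refine (pot_far_le ha.meas hx hρ0).trans ?_
    calc _ ≤ ENNReal.ofReal (x 1 / (Real.pi * ρ ^ 2)) * 1 := by gcongr; exact ha.imp_le
      _ ≤ _ := by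
        rw [mul_one, div_eq_mul_one_div, mul_comm]
        gcongr
  have hnear' : pot ((Metric.ball x ρ).indicator θ) x ≤
      ENNReal.ofReal (2 * δ * x 1) + ENNReal.ofReal (ε / 3 * x 1) := by
    rcases hR with hR | hR
    · refine (pot_near_le_of_high ha.meas ha.le_one hδ0 hρ0 (by linarith)).trans ?_
      gcongr
      calc _ ≤ ENNReal.ofReal (x 1 / (Real.pi * δ * (x 1 - ρ))) * 1 := by
            gcongr; exact ha.imp_le
        _ ≤ _ := by
          rw [mul_one]
          refine ENNReal.ofReal_le_ofReal ?_
          have h1 : 1 / (δ * ε) ≤ x 1 - ρ := by linarith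
          have h2 : 0 < x 1 - ρ := by linarith
          rw [div_le_iff₀ (by positivity)] at h1
          rw [div_le_iff₀ (by positivity)]
          have h3 : 3 ≤ ε * (Real.pi * δ * (x 1 - ρ)) := by nlinarith
          nlinarith
    · refine (pot_le_of_imp (ha.meas.indicator Metric.isOpen_ball.measurableSet)
        (fun y => (indicator_le_self _ _ y).trans (ha.le_one y)) hx hδ0).trans ?_
      gcongr
      calc _ ≤ ENNReal.ofReal (x 1 / (Real.pi * δ ^ 2)) * ENNReal.ofReal (1 / (n + 1)) := by
            gcongr; exact hl.imp_ball_le ha hρ0 n (by linarith)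
        _ ≤ _ := by
          rw [← ENNReal.ofReal_mul (by positivity)]
          refine ENNReal.ofReal_le_ofReal ?_
          rw [div_eq_mul_one_div, mul_assoc, mul_comm]
          gcongr
  refine (add_le_add hnear' hfar').trans_eq ?_
  rw [← ENNReal.ofReal_add (by positivity) (by positivity),
    ← ENNReal.ofReal_add (by positivity) (by positivity)]
  congr 1
  rw [hδ]; ring

/-- The right side follows by applying the left estimate to the mirror image. The radius doubles
because `‖x‖ ≤ |x₁| + |x₂|`. -/
theorem exists_pot_le {ε : ℝ} (hε : 0 < ε) :
    ∃ R > 0, ∀ θ : Plane → ℝ≥0∞, Admissible θ → LeftOrdered θ →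
      LeftOrdered (fun x => θ (mirror 0 x)) → ∀ x ∈ upperHalf, R ≤ ‖x‖ →
      pot θ x ≤ ENNReal.ofReal (ε * x 1) := by
  obtain ⟨R, hR, h⟩ := exists_pot_le_of_leftOrdered hε
  refine ⟨R + R, by positivity, fun θ ha h1 h2 x hx hxR => ?_⟩
  have hx1 : 0 < x 1 := hx
  have hn := norm_le_abs_add_abs x
  rw [abs_of_pos hx1] at hn
  by_cases hc : R ≤ x 1
  · exact h θ ha h1 x hx (Or.inl hc)
  have hx0 : R ≤ |x 0| := by linarith
  rcases le_abs'.1 hx0 with hc' | hc'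
  · exact h θ ha h1 x hx (Or.inr hc')
  · have := h _ ha.comp_mirror h2 (mirror 0 x) hx
      (Or.inr (by simp only [mirror_apply_zero]; linarith))
    rwa [pot_comp_mirror ha.meas, mirror_mirror] at this

end

section

/-! ### Weak compactness -/

open Filter Topology

/-- Sequential Banach–Alaoglu for a separable space, carried over by the Riesz isomorphism. -/
theorem exists_weakly_convergent_subseq {H : Type*} [NormedAddCommGroup H] [InnerProductSpace ℝ H]
    [CompleteSpace H] [TopologicalSpace.SeparableSpace H] (f : ℕ → H) {C : ℝ}
    (hf : ∀ n, ‖f n‖ ≤ C) :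
    ∃ (a : H) (k : ℕ → ℕ), StrictMono k ∧
      ∀ g, Tendsto (fun n => inner ℝ (f (k n)) g) atTop (𝓝 (inner ℝ a g)) := by
  have hmem : ∀ n, (InnerProductSpace.toDual ℝ H (f n)).toWeakDual ∈
      WeakDual.toStrongDual ⁻¹' Metric.closedBall (0 : StrongDual ℝ H) C := fun n => by
    simp only [mem_preimage, mem_closedBall_zero_iff]
    exact ((InnerProductSpace.toDual ℝ H).norm_map (f n)).trans_le (hf n)
  obtain ⟨a, -, k, hk, hlim⟩ := WeakDual.isSeqCompact_closedBall ℝ H 0 C hmem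
  refine ⟨(InnerProductSpace.toDual ℝ H).symm (WeakDual.toStrongDual a), k, hk, fun g => ?_⟩
  have hcont : Continuous fun b : WeakDual ℝ H => b g := WeakDual.eval_continuous g
  rw [InnerProductSpace.toDual_symm_apply]
  exact (hcont.tendsto a).comp hlim

/-- A square-integrable positive weight on the plane. -/
def weight (x : Plane) : ℝ := ((1 + ‖x‖) ^ 2)⁻¹

theorem weight_pos (x : Plane) : 0 < weight x := by unfold weight; positivity

theorem measurable_weight : Measurable weight := by unfold weight; fun_prop

theorem memLp_weight : MemLp weight 2 (volume.restrict upperHalf) := by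
  refine MemLp.restrict _ ((memLp_two_iff_integrable_sq measurable_weight.aestronglyMeasurable).2 ?_)
  refine (integrable_one_add_norm (E := Plane) (r := 4) (by simp; norm_num)).congr ?_
  refine Eventually.of_forall fun x => ?_
  have h : 0 < 1 + ‖x‖ := by positivity
  simp only [weight]
  rw [Real.rpow_neg h.le, show (4 : ℝ) = ((4 : ℕ) : ℝ) by norm_num, Real.rpow_natCast, inv_pow,
    ← pow_mul]

variable {θ : Plane → ℝ≥0∞}

theorem toReal_le_one (h1 : ∀ x, θ x ≤ 1) (x : Plane) : (θ x).toReal ≤ 1 := by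
  simpa using ENNReal.toReal_mono ENNReal.one_ne_top (h1 x)

theorem integral_indicator_mul {μ : Measure Plane} {s : Set Plane} (hs : MeasurableSet s)
    (f g : Plane → ℝ) : ∫ x, s.indicator f x * g x ∂μ = ∫ x in s, f x * g x ∂μ := by
  rw [← integral_indicator hs]
  refine integral_congr_ae (Eventually.of_forall fun x => ?_)
  by_cases hx : x ∈ s <;> simp [hx]

/-- Integration of `h θ` as a real integral, for a density `θ ≤ 1`. -/
theorem setLIntegral_ofReal_mul (hθ : Measurable θ) (h1 : ∀ x, θ x ≤ 1) {s : Set Plane}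
    (hs : MeasurableSet s) {h : Plane → ℝ} (hh : IntegrableOn h s) (h0 : ∀ x ∈ s, 0 ≤ h x) :
    ∫⁻ x in s, ENNReal.ofReal (h x) * θ x = ENNReal.ofReal (∫ x in s, h x * (θ x).toReal) := by
  rw [ofReal_integral_eq_lintegral_ofReal]
  · refine setLIntegral_congr_fun hs fun x hx => ?_
    rw [ENNReal.ofReal_mul (h0 x hx),
      ENNReal.ofReal_toReal (ne_top_of_le_ne_top ENNReal.one_ne_top (h1 x))]
  · refine hh.mono' (hh.aestronglyMeasurable.mul hθ.ennreal_toReal.aestronglyMeasurable) ?_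
    refine (ae_restrict_mem hs).mono fun x hx => ?_
    rw [norm_mul, Real.norm_of_nonneg (h0 x hx), Real.norm_of_nonneg ENNReal.toReal_nonneg]
    exact mul_le_of_le_one_right (h0 x hx) (toReal_le_one h1 x)
  · refine (ae_restrict_mem hs).mono fun x hx => ?_
    exact mul_nonneg (h0 x hx) ENNReal.toReal_nonneg

/-- Weak convergence, tested against square-integrable functions of bounded support. -/
def WeakLimit (θ : ℕ → Plane → ℝ≥0∞) (θ' : Plane → ℝ≥0∞) : Prop :=
  ∀ (h : Plane → ℝ) (R : ℝ), MemLp h 2 (volume.restrict upperHalf) → (∀ x, R ≤ ‖x‖ → h x = 0) →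
    Tendsto (fun n => ∫ x in upperHalf, h x * (θ n x).toReal) atTop
      (𝓝 (∫ x in upperHalf, h x * (θ' x).toReal))

theorem memLp_bounded {h : Plane → ℝ} (hh : AEStronglyMeasurable h (volume.restrict upperHalf))
    {C R : ℝ} (hC : ∀ x ∈ upperHalf, |h x| ≤ C) (hR : ∀ x, R ≤ ‖x‖ → h x = 0) {p : ℝ≥0∞} :
    MemLp h p (volume.restrict upperHalf) := by
  refine MemLp.mono (g := (Metric.ball (0 : Plane) R).indicator fun _ => C)
    ((memLp_indicator_const p Metric.isOpen_ball.measurableSet C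
      (Or.inr measure_ball_lt_top.ne)).restrict _) hh ?_
  refine (ae_restrict_mem measurableSet_upperHalf).mono fun x hx => ?_
  by_cases hx' : x ∈ Metric.ball (0 : Plane) R
  · rw [indicator_of_mem hx']
    exact (hC x hx).trans (le_abs_self C)
  · rw [hR x (by simpa using hx')]; simp

/-- Densities of infinite mass need not lie in `L²`, but after multiplication by the
square-integrable weight they are bounded there. The bounds `0 ≤ θ ≤ 1` pass to the limit by testing
on measurable sets. The bound on the impulse passes by testing the height cut off to balls and then
letting the balls grow; only the inequality survives. -/
theorem exists_weakLimit (θ : ℕ → Plane → ℝ≥0∞) (hθ : ∀ n, Admissible (θ n)) :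
    ∃ (θ' : Plane → ℝ≥0∞) (k : ℕ → ℕ), StrictMono k ∧ Admissible θ' ∧
      WeakLimit (fun n => θ (k n)) θ' := by
  set μ : Measure Plane := volume.restrict upperHalf with hμ
  have : Fact ((2 : ℝ≥0∞) ≠ ∞) := ⟨by norm_num⟩
  have hwpos := weight_pos
  have hwm := measurable_weight
  have htm : ∀ n, Measurable fun x => (θ n x).toReal := fun n => (hθ n).meas.ennreal_toReal
  have hF : ∀ n, MemLp (fun x => (θ n x).toReal * weight x) 2 μ := fun n => by
    refine memLp_weight.mono ((htm n).mul hwm).aestronglyMeasurable (Eventually.of_forall fun x => ?_)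
    rw [norm_mul, Real.norm_of_nonneg ENNReal.toReal_nonneg]
    exact mul_le_of_le_one_left (norm_nonneg _) (toReal_le_one (hθ n).le_one x)
  obtain ⟨a, k, hk, hlim⟩ := exists_weakly_convergent_subseq (fun n => (hF n).toLp)
    (C := ‖memLp_weight.toLp‖) (fun n => by
      refine Lp.norm_le_norm_of_ae_le ?_
      filter_upwards [(hF n).coeFn_toLp, memLp_weight.coeFn_toLp] with x h1 h2
      rw [h1, h2, norm_mul, Real.norm_of_nonneg ENNReal.toReal_nonneg]
      exact mul_le_of_le_one_left (norm_nonneg _) (toReal_le_one (hθ n).le_one x))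
  have ham : MemLp a 2 μ := Lp.memLp a
  have hlim' : ∀ g : Plane → ℝ, MemLp g 2 μ →
      Tendsto (fun n => ∫ x, g x * ((θ (k n) x).toReal * weight x) ∂μ) atTop
        (𝓝 (∫ x, g x * a x ∂μ)) := by
    intro g hg
    have := hlim hg.toLp
    simp only [L2.inner_def] at this
    refine (this.congr fun n => integral_congr_ae ?_).trans_eq (congrArg _ (integral_congr_ae ?_))
    · filter_upwards [(hF (k n)).coeFn_toLp, hg.coeFn_toLp] with x h1 h2
      rw [h1, h2]; simp
    · filter_upwards [hg.coeFn_toLp] with x h2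
      rw [h2]; simp
  have hint1 : Integrable (fun x => weight x * a x) μ := memLp_weight.integrable_mul ham
  have hint2 : Integrable (fun x => weight x * weight x) μ :=
    memLp_weight.integrable_mul memLp_weight
  have hset : ∀ s, MeasurableSet s → Tendsto (fun n => ∫ x in s, weight x *
      ((θ (k n) x).toReal * weight x) ∂μ) atTop (𝓝 (∫ x in s, weight x * a x ∂μ)) := by
    intro s hs
    have := hlim' (s.indicator weight) (memLp_weight.indicator hs)
    simpa only [integral_indicator_mul hs] using this
  have hnn : 0 ≤ᵐ[μ] fun x => weight x * a x := by
    refine ae_nonneg_of_forall_setIntegral_nonneg hint1 fun s hs _ => ?_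
    refine ge_of_tendsto' (hset s hs) fun n => integral_nonneg fun x => ?_
    have := (hwpos x).le
    positivity
  have hle : (fun x => weight x * a x) ≤ᵐ[μ] fun x => weight x * weight x := by
    refine ae_le_of_forall_setIntegral_le hint1 hint2 fun s hs _ => ?_
    refine le_of_tendsto' (hset s hs) fun n => ?_
    refine integral_mono_of_nonneg (Eventually.of_forall fun x => ?_) hint2.integrableOn
      (Eventually.of_forall fun x => ?_)
    · have := (hwpos x).le
      positivity
    · have h1 := toReal_le_one (hθ (k n)).le_one x
      have h2 := hwpos x
      simp only
      gcongr
      exact mul_le_of_le_one_left h2.le h1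
  set b : Plane → ℝ := ham.aestronglyMeasurable.mk a with hb
  have hbm : Measurable b := ham.aestronglyMeasurable.stronglyMeasurable_mk.measurable
  have hab : a =ᵐ[μ] b := ham.aestronglyMeasurable.ae_eq_mk
  -- The truncations at `0` and `1` change the quotient only on a null set, but make the bounds hold
  -- at every point.
  set θ' : Plane → ℝ≥0∞ := fun x => min (ENNReal.ofReal (b x / weight x)) 1 with hθ'
  have hθ'm : Measurable θ' := (hbm.div hwm).ennreal_ofReal.min measurable_const
  have hθ'1 : ∀ x, θ' x ≤ 1 := fun x => min_le_right _ _
  have hval : ∀ᵐ x ∂μ, (θ' x).toReal * weight x = a x := by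
    filter_upwards [hnn, hle, hab] with x h1 h2 h3
    have hw := hwpos x
    have h1' : 0 ≤ a x := nonneg_of_mul_nonneg_right (by simpa using h1) hw
    have h2' : a x ≤ weight x := le_of_mul_le_mul_left h2 hw
    simp only [hθ']
    rw [← h3, min_eq_left, ENNReal.toReal_ofReal (by positivity), div_mul_cancel₀ _ hw.ne']
    exact ENNReal.ofReal_le_one.2 ((div_le_one hw).2 h2')
  have hweak : WeakLimit (fun n => θ (k n)) θ' := by
    intro h R hh hR
    -- Dividing by the weight is harmless on the bounded support of `h`, where its inverse is at
    -- most `(1 + R)²`.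
    have hg : MemLp (fun x => h x / weight x) 2 μ := by
      refine hh.of_le_mul (c := (1 + R) ^ 2)
        ((hh.aestronglyMeasurable.mul hwm.inv.aestronglyMeasurable).congr
          (Eventually.of_forall fun x => (div_eq_mul_inv (h x) (weight x)).symm)) (Eventually.of_forall fun x => ?_)
      rcases le_or_gt R ‖x‖ with hx | hx
      · simp [hR x hx]
      · rw [norm_div, div_eq_mul_inv, mul_comm, Real.norm_of_nonneg (hwpos x).le, weight, inv_inv]
        gcongr
    refine ((hlim' _ hg).congr fun n => integral_congr_ae ?_).trans_eq
      (congrArg _ (integral_congr_ae ?_))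
    · refine Eventually.of_forall fun x => ?_
      have := (hwpos x).ne'
      simp only
      field_simp
    · filter_upwards [hval] with x hx
      have := (hwpos x).ne'
      rw [← hx]
      field_simp
  refine ⟨θ', k, hk, ⟨hθ'm, hθ'1, ?_⟩, hweak⟩
  have hball : ∀ R : ℕ, ∫⁻ x in upperHalf ∩ Metric.ball 0 (R : ℝ), ENNReal.ofReal (x 1) * θ' x ≤ 1 := by
    intro R
    have hms : MeasurableSet (Metric.ball (0 : Plane) (R : ℝ)) := Metric.isOpen_ball.measurableSet
    have hh : MemLp ((Metric.ball (0 : Plane) (R : ℝ)).indicator fun x => x 1) 2 μ := by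
      refine memLp_bounded (C := R) (R := R)
        ((measurable_coord 1).indicator hms).aestronglyMeasurable (fun x _ => ?_) fun x hx => ?_
      · by_cases hx : x ∈ Metric.ball (0 : Plane) (R : ℝ)
        · rw [indicator_of_mem hx]
          exact (abs_coord_le x 1).trans (by simpa using (mem_ball_zero_iff.1 hx).le)
        · simp [hx]
      · exact indicator_of_notMem (by simpa using hx) _
    have hio : IntegrableOn (fun x : Plane => x 1) (upperHalf ∩ Metric.ball 0 (R : ℝ)) := by
      have h1 : MemLp ((Metric.ball (0 : Plane) (R : ℝ)).indicator fun x => x 1) 1 μ := by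
        refine memLp_bounded (C := R) (R := R)
          ((measurable_coord 1).indicator hms).aestronglyMeasurable (fun x _ => ?_) fun x hx => ?_
        · by_cases hx : x ∈ Metric.ball (0 : Plane) (R : ℝ)
          · rw [indicator_of_mem hx]
            exact (abs_coord_le x 1).trans (by simpa using (mem_ball_zero_iff.1 hx).le)
          · simp [hx]
        · exact indicator_of_notMem (by simpa using hx) _
      rw [memLp_one_iff_integrable, integrable_indicator_iff hms, IntegrableOn, hμ,
        Measure.restrict_restrict hms, inter_comm] at h1
      exact h1
    have hconv : ∀ φ : Plane → ℝ≥0∞, Measurable φ → (∀ x, φ x ≤ 1) →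
        ∫⁻ x in upperHalf ∩ Metric.ball 0 (R : ℝ), ENNReal.ofReal (x 1) * φ x =
        ENNReal.ofReal (∫ x in upperHalf, (Metric.ball (0 : Plane) (R : ℝ)).indicator
          (fun x => x 1) x * (φ x).toReal) := by
      intro φ hφ hφ1
      rw [setLIntegral_ofReal_mul hφ hφ1 (measurableSet_upperHalf.inter hms) hio
        fun x hx => le_of_lt hx.1]
      rw [integral_indicator_mul hms, Measure.restrict_restrict hms, inter_comm]
    rw [hconv θ' hθ'm hθ'1]
    refine le_of_tendsto' ((ENNReal.continuous_ofReal.tendsto _).comp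
      (hweak _ R hh fun x hx => indicator_of_notMem (by simpa using hx) _)) fun n => ?_
    rw [Function.comp_apply, ← hconv _ (hθ (k n)).meas (hθ (k n)).le_one]
    exact (lintegral_mono_set inter_subset_left).trans (hθ (k n)).imp_le
  have hU : upperHalf = ⋃ R : ℕ, upperHalf ∩ Metric.ball (0 : Plane) (R : ℝ) := by
    rw [← inter_iUnion, Metric.iUnion_ball_nat, inter_univ]
  rw [imp, hU, setLIntegral_iUnion_of_directed _ (Monotone.directed_le fun m n hmn => by
    gcongr)]
  exact iSup_le hball

end

section

/-! ### Continuity of the energy of bounded truncations -/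

open Filter Topology

variable {θ : Plane → ℝ≥0∞}

theorem memLp_green {x : Plane} (hx : x ∈ upperHalf) (R : ℝ) :
    MemLp (green x) 2 (volume.restrict (Metric.ball 0 R ∩ upperHalf)) := by
  have hx1 : 0 < x 1 := hx
  have hgm : Measurable (green x) := measurable_green.comp measurable_prodMk_left
  have hms : MeasurableSet (Metric.ball (0 : Plane) R ∩ upperHalf) :=
    Metric.isOpen_ball.measurableSet.inter measurableSet_upperHalf
  rw [memLp_two_iff_integrable_sq hgm.aestronglyMeasurable]
  refine ⟨(hgm.pow_const 2).aestronglyMeasurable, ?_⟩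
  rw [hasFiniteIntegral_iff_ofReal (Eventually.of_forall fun y => sq_nonneg _)]
  have hsub : Metric.ball (0 : Plane) R ∩ upperHalf ⊆ Metric.ball x (|R| + ‖x‖) := by
    rintro y ⟨hy, -⟩
    rw [mem_ball_zero_iff] at hy
    rw [Metric.mem_ball, dist_eq_norm]
    linarith [norm_sub_le y x, le_abs_self R]
  calc ∫⁻ y in Metric.ball (0 : Plane) R ∩ upperHalf, ENNReal.ofReal (green x y ^ 2)
      ≤ ∫⁻ y in Metric.ball (0 : Plane) R ∩ upperHalf,
          ENNReal.ofReal (√(x 1 * R)) * ‖x - y‖ₑ⁻¹ := by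
        refine setLIntegral_mono_ae' hms ?_
        filter_upwards [Measure.ae_ne volume x] with y hyx hy
        rw [enorm_inv_eq_ofReal (Ne.symm hyx), ← ENNReal.ofReal_mul (Real.sqrt_nonneg _)]
        refine ENNReal.ofReal_le_ofReal ((green_sq_le hx hy.2).trans ?_)
        rw [div_eq_mul_one_div]
        gcongr
        exact (le_abs_self _).trans ((abs_coord_le y 1).trans (mem_ball_zero_iff.1 hy.1).le)
    _ ≤ ∫⁻ y in Metric.ball x (|R| + ‖x‖), ENNReal.ofReal (√(x 1 * R)) * ‖x - y‖ₑ⁻¹ :=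
        lintegral_mono_set hsub
    _ < ∞ := by
        rw [lintegral_const_mul _ (by fun_prop), lintegral_ball_inv_norm x (by positivity)]
        exact ENNReal.mul_lt_top ENNReal.ofReal_lt_top ENNReal.ofReal_lt_top

theorem pot_indicator_ball (hθ : Measurable θ) (h1 : ∀ x, θ x ≤ 1) {x : Plane}
    (hx : x ∈ upperHalf) (R : ℝ) : pot ((Metric.ball 0 R).indicator θ) x =
      ENNReal.ofReal (∫ y in upperHalf, (Metric.ball 0 R).indicator (green x) y * (θ y).toReal) := by
  have hms : MeasurableSet (Metric.ball (0 : Plane) R) := Metric.isOpen_ball.measurableSet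
  have hfin : IsFiniteMeasure (volume.restrict (Metric.ball (0 : Plane) R ∩ upperHalf)) :=
    ⟨by
      rw [Measure.restrict_apply_univ]
      exact (measure_mono inter_subset_left).trans_lt measure_ball_lt_top⟩
  rw [pot_indicator_eq_setLIntegral hms, integral_indicator_mul hms,
    Measure.restrict_restrict hms, ← setLIntegral_ofReal_mul hθ h1
      (hms.inter measurableSet_upperHalf) ((memLp_green hx R).integrable one_le_two)
      fun y hy => green_nonneg hx hy.2]
  refine lintegral_congr_ae (ae_restrict_of_ae ?_)
  filter_upwards [Measure.ae_ne volume x] with y hy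
  rw [greenKernel_of_ne (Ne.symm hy)]

/-- For fixed `x` the truncated kernel is itself a square-integrable test function of bounded
support. -/
theorem WeakLimit.tendsto_pot {θ : ℕ → Plane → ℝ≥0∞} {θ' : Plane → ℝ≥0∞} (h : WeakLimit θ θ')
    (hθ : ∀ n, Admissible (θ n)) (hθ' : Admissible θ') {x : Plane} (hx : x ∈ upperHalf) (R : ℝ) :
    Tendsto (fun n => pot ((Metric.ball 0 R).indicator (θ n)) x) atTop
      (𝓝 (pot ((Metric.ball 0 R).indicator θ') x)) := by
  have hms : MeasurableSet (Metric.ball (0 : Plane) R) := Metric.isOpen_ball.measurableSet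
  simp only [fun n => pot_indicator_ball (hθ n).meas (hθ n).le_one hx R,
    pot_indicator_ball hθ'.meas hθ'.le_one hx R]
  refine (ENNReal.continuous_ofReal.tendsto _).comp (h _ R ?_ fun y hy => ?_)
  · rw [memLp_indicator_iff_restrict hms, Measure.restrict_restrict hms]
    exact memLp_green hx R
  · exact indicator_of_notMem (by simpa using hy) _

theorem Admissible.mono {φ : Plane → ℝ≥0∞} (h : Admissible φ) (hθ : Measurable θ)
    (hle : ∀ x, θ x ≤ φ x) : Admissible θ :=
  ⟨hθ, fun x => (hle x).trans (h.le_one x), (imp_mono hle).trans h.imp_le⟩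

theorem Admissible.indicator (h : Admissible θ) {s : Set Plane} (hs : MeasurableSet s) :
    Admissible (s.indicator θ) :=
  h.mono (h.meas.indicator hs) fun x => indicator_le_self _ _ x

/-- The potential of the truncation of `θ` to a ball, cut off outside the ball. -/
def cutPot (R : ℝ) (θ : Plane → ℝ≥0∞) : Plane → ℝ :=
  (Metric.ball 0 R).indicator fun x => (pot ((Metric.ball 0 R).indicator θ) x).toReal

theorem measurable_cutPot (hθ : Measurable θ) (R : ℝ) : Measurable (cutPot R θ) :=
  (measurable_pot (hθ.indicator Metric.isOpen_ball.measurableSet)).ennreal_toReal.indicator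
    Metric.isOpen_ball.measurableSet

theorem cutPot_nonneg (R : ℝ) (x : Plane) : 0 ≤ cutPot R θ x :=
  indicator_nonneg (fun _ _ => ENNReal.toReal_nonneg) x

theorem cutPot_of_le {R : ℝ} {x : Plane} (hx : R ≤ ‖x‖) : cutPot R θ x = 0 :=
  indicator_of_notMem (by simpa using hx) _

theorem Admissible.cutPot_le (h : Admissible θ) {R : ℝ} {x : Plane} (hx : x ∈ upperHalf) :
    cutPot R θ x ≤ 3 * |R| := by
  have hx1 : 0 < x 1 := hx
  by_cases hR : x ∈ Metric.ball 0 R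
  · rw [cutPot, indicator_of_mem hR]
    refine (ENNReal.toReal_mono ENNReal.ofReal_ne_top
      ((h.indicator Metric.isOpen_ball.measurableSet).pot_le hx)).trans ?_
    rw [ENNReal.toReal_ofReal (by positivity)]
    have h1 := (le_abs_self _).trans (abs_coord_le x 1)
    have h2 := mem_ball_zero_iff.1 hR
    have h3 := le_abs_self R
    linarith
  · rw [cutPot, indicator_of_notMem hR]
    positivity

theorem Admissible.memLp_cutPot (h : Admissible θ) (R : ℝ) (p : ℝ≥0∞) :
    MemLp (cutPot R θ) p (volume.restrict upperHalf) :=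
  memLp_bounded (C := 3 * |R|) (R := R) (measurable_cutPot h.meas R).aestronglyMeasurable
    (fun x hx => by rw [abs_of_nonneg (cutPot_nonneg R x)]; exact h.cutPot_le hx)
    fun _ => cutPot_of_le

theorem Admissible.interaction_ball (h : Admissible θ) (R : ℝ) :
    interaction ((Metric.ball 0 R).indicator θ) ((Metric.ball 0 R).indicator θ) =
      ENNReal.ofReal (∫ x in upperHalf, cutPot R θ x * (θ x).toReal) := by
  have hms : MeasurableSet (Metric.ball (0 : Plane) R) := Metric.isOpen_ball.measurableSet
  rw [← setLIntegral_ofReal_mul h.meas h.le_one measurableSet_upperHalf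
    (memLp_one_iff_integrable.1 (h.memLp_cutPot R 1)) fun x _ => cutPot_nonneg R x]
  refine setLIntegral_congr_fun measurableSet_upperHalf fun x hx => ?_
  by_cases hR : x ∈ Metric.ball 0 R
  · simp only [cutPot, indicator_of_mem hR]
    rw [ENNReal.ofReal_toReal ((h.indicator hms).pot_ne_top hx)]
  · simp [cutPot, hR]

/-- Potentials of truncations converge pointwise and are bounded on the ball, so replacing the
potential of `θ n` by that of the limit costs nothing in the limit, by dominated convergence. What
remains is a fixed test function against a weakly convergent sequence. The constant `6 |R|` bounds
the difference of two potentials, each at most `3 |R|`. -/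
theorem WeakLimit.tendsto_interaction {θ : ℕ → Plane → ℝ≥0∞} {θ' : Plane → ℝ≥0∞}
    (h : WeakLimit θ θ') (hθ : ∀ n, Admissible (θ n)) (hθ' : Admissible θ') (R : ℝ) :
    Tendsto (fun n => interaction ((Metric.ball 0 R).indicator (θ n))
      ((Metric.ball 0 R).indicator (θ n))) atTop
      (𝓝 (interaction ((Metric.ball 0 R).indicator θ') ((Metric.ball 0 R).indicator θ'))) := by
  have hms : MeasurableSet (Metric.ball (0 : Plane) R) := Metric.isOpen_ball.measurableSet
  simp only [fun n => (hθ n).interaction_ball R, hθ'.interaction_ball R]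
  refine (ENNReal.continuous_ofReal.tendsto _).comp ?_
  have h1 := h _ R (hθ'.memLp_cutPot R 2) fun _ => cutPot_of_le
  have hm : ∀ n, Measurable fun x => (θ n x).toReal := fun n => (hθ n).meas.ennreal_toReal
  have hbound : Integrable ((Metric.ball 0 R).indicator fun _ => 6 * |R|)
      (volume.restrict upperHalf) :=
    ((integrable_indicator_iff hms).2 (integrableOn_const measure_ball_lt_top.ne)).restrict
  have hint : ∀ φ n, Admissible φ → Integrable (fun x => cutPot R φ x * (θ n x).toReal)
      (volume.restrict upperHalf) := fun φ n hφ =>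
    (memLp_one_iff_integrable.1 (hφ.memLp_cutPot R 1)).mono
      ((measurable_cutPot hφ.meas R).mul (hm n)).aestronglyMeasurable
      (Eventually.of_forall fun x => by
        rw [norm_mul, Real.norm_of_nonneg (ENNReal.toReal_nonneg (a := θ n x))]
        exact mul_le_of_le_one_right (norm_nonneg _) (toReal_le_one (hθ n).le_one x))
  have h2 : Tendsto (fun n => ∫ x in upperHalf,
      (cutPot R (θ n) x - cutPot R θ' x) * (θ n x).toReal) atTop
      (𝓝 (∫ x in upperHalf, (0 : ℝ))) := by
    have hdom : ∀ n, ∀ x ∈ upperHalf, |cutPot R (θ n) x - cutPot R θ' x| ≤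
        (Metric.ball 0 R).indicator (fun _ => 6 * |R|) x := by
      intro n x hx
      by_cases hR : x ∈ Metric.ball 0 R
      · rw [indicator_of_mem hR]
        have a1 := (hθ n).cutPot_le (R := R) hx
        have a2 := hθ'.cutPot_le (R := R) hx
        have a3 := cutPot_nonneg (θ := θ n) R x
        have a4 := cutPot_nonneg (θ := θ') R x
        rw [abs_le]
        constructor <;> linarith
      · simp [cutPot, hR]
    have hmul : ∀ n x, ‖(cutPot R (θ n) x - cutPot R θ' x) * (θ n x).toReal‖ ≤
        |cutPot R (θ n) x - cutPot R θ' x| := fun n x => by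
      rw [norm_mul, Real.norm_of_nonneg (ENNReal.toReal_nonneg (a := θ n x))]
      exact mul_le_of_le_one_right (norm_nonneg _) (toReal_le_one (hθ n).le_one x)
    refine tendsto_integral_of_dominated_convergence _ (fun n => ?_) hbound (fun n => ?_) ?_
    · exact (((measurable_cutPot (hθ n).meas R).sub (measurable_cutPot hθ'.meas R)).mul
        (hm n)).aestronglyMeasurable
    · filter_upwards [ae_restrict_mem measurableSet_upperHalf] with x hx
      exact (hmul n x).trans (hdom n x hx)
    · filter_upwards [ae_restrict_mem measurableSet_upperHalf] with x hx
      refine squeeze_zero_norm (hmul · x) ?_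
      have hc : Tendsto (fun n => cutPot R (θ n) x) atTop (𝓝 (cutPot R θ' x)) := by
        by_cases hR : x ∈ Metric.ball 0 R
        · simp only [cutPot, indicator_of_mem hR]
          exact (ENNReal.tendsto_toReal ((hθ'.indicator hms).pot_ne_top hx)).comp
            (h.tendsto_pot hθ hθ' hx R)
        · simp [cutPot, hR]
      simpa using (hc.sub_const (cutPot R θ' x)).abs
  rw [integral_zero] at h2
  have h3 := h2.add h1
  rw [zero_add] at h3
  refine h3.congr fun n => ?_
  rw [← integral_add]
  · exact integral_congr_ae (Eventually.of_forall fun x => by simp only; ring)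
  · refine ((hint _ n (hθ n)).sub (hint _ n hθ')).congr (Eventually.of_forall fun x => ?_)
    simp only [Pi.sub_apply]; ring
  · exact hint _ n hθ'

end

section

/-! ### Existence of a maximizer among all admissible densities -/

open Filter Topology

variable {θ : Plane → ℝ≥0∞}

theorem greenKernel_pos {x y : Plane} (hx : x ∈ upperHalf) (hy : y ∈ upperHalf) :
    0 < greenKernel x y := by
  rcases eq_or_ne x y with rfl | h
  · simp [greenKernel]
  · rw [greenKernel_of_ne h]; exact ENNReal.ofReal_pos.2 (green_pos hx hy h)

theorem interaction_pos (hθ : Measurable θ) (h0 : ¬ θ =ᵐ[volume.restrict upperHalf] 0) :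
    0 < interaction θ θ := by
  rw [pos_iff_ne_zero]
  intro h
  have hm : Measurable fun x => pot θ x * θ x := (measurable_pot hθ).mul hθ
  rw [interaction, lintegral_eq_zero_iff hm] at h
  have h' : ∀ᵐ x ∂volume.restrict upperHalf, x ∈ upperHalf ∧ pot θ x * θ x = 0 :=
    (ae_restrict_mem measurableSet_upperHalf).and h
  have hf : ∃ᵐ x ∂volume.restrict upperHalf, θ x ≠ 0 := fun hc => h0 (hc.mono fun x hx => not_not.1 hx)
  obtain ⟨x, hx1, hx, hx2⟩ := (hf.and_eventually h').exists
  have hp := (mul_eq_zero.1 hx2).resolve_right hx1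
  rw [pot, lintegral_eq_zero_iff (by fun_prop)] at hp
  refine h0 ?_
  filter_upwards [hp, ae_restrict_mem measurableSet_upperHalf] with y hy hyU
  exact (mul_eq_zero.1 hy).resolve_left (greenKernel_pos hx hyU).ne'

/-- A disc of radius `1 / 4` about `(0, 1)` is admissible: its impulse is at most `(5 / 4) (π / 16)
< 1`. -/
theorem interactionMax_pos : 0 < interactionMax := by
  set e : Plane := !₂[0, 1] with he
  have hms : MeasurableSet (Metric.ball e (1 / 4)) := Metric.isOpen_ball.measurableSet
  have hy : ∀ y ∈ Metric.ball e (1 / 4), 3 / 4 < y 1 ∧ y 1 < 5 / 4 := by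
    intro y hy
    rw [Metric.mem_ball, dist_eq_norm] at hy
    have h1 := abs_lt.1 ((abs_coord_le (y - e) 1).trans_lt hy)
    simp only [he, PiLp.sub_apply, Matrix.cons_val_one, Matrix.cons_val_fin_one] at h1
    constructor <;> linarith [h1.1, h1.2]
  have hsub : Metric.ball e (1 / 4) ⊆ upperHalf := fun y h => by
    have := (hy y h).1
    change 0 < y 1
    linarith
  have hv : volume (Metric.ball e (1 / 4)) = ENNReal.ofReal (Real.pi / 16) := by
    rw [EuclideanSpace.volume_ball_fin_two, ← ENNReal.ofReal_pow (by norm_num),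
      ← ENNReal.ofReal_mul (by norm_num)]
    congr 1; ring
  set θ : Plane → ℝ≥0∞ := (Metric.ball e (1 / 4)).indicator 1 with hθ
  have ha : Admissible θ := by
    refine ⟨measurable_one.indicator hms, fun x => indicator_le_self _ _ x, ?_⟩
    have h1 : imp θ ≤ ∫⁻ y in Metric.ball e (1 / 4), ENNReal.ofReal (5 / 4) := by
      rw [imp, ← lintegral_indicator hms]
      refine (setLIntegral_le_lintegral _ _).trans (lintegral_mono fun y => ?_)
      by_cases h : y ∈ Metric.ball e (1 / 4)
      · simp only [hθ, indicator_of_mem h, Pi.one_apply, mul_one]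
        exact ENNReal.ofReal_le_ofReal (hy y h).2.le
      · rw [hθ, indicator_of_notMem h, indicator_of_notMem h, mul_zero]
    refine h1.trans ?_
    rw [lintegral_const, Measure.restrict_apply_univ, hv, ← ENNReal.ofReal_mul (by norm_num)]
    exact ENNReal.ofReal_le_one.2 (by linarith [Real.pi_le_four])
  refine (interaction_pos ha.meas fun h => ?_).trans_le ha.interaction_le
  have h' := ae_restrict_of_ae_restrict_of_subset hsub h
  have h0 : volume (Metric.ball e (1 / 4)) = 0 := by
    have : ∀ᵐ y ∂volume.restrict (Metric.ball e (1 / 4)), False := by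
      filter_upwards [h', ae_restrict_mem hms] with y h1 h2
      rw [hθ, indicator_of_mem h2] at h1
      exact one_ne_zero h1
    simpa using this
  rw [hv, ENNReal.ofReal_eq_zero] at h0
  linarith [Real.pi_pos]

/-- A penalization favouring densities concentrated near the axis `x₁ = 0`. -/
def penalty (θ : Plane → ℝ≥0∞) : ℝ≥0∞ :=
  ∫⁻ x in upperHalf, ENNReal.ofReal (x 0 ^ 2 * x 1) * θ x

/-- The penalized energy. -/
def penalizedEnergy (δ : ℝ) (θ : Plane → ℝ≥0∞) : ℝ :=
  (interaction θ θ).toReal - δ * (penalty θ).toReal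

/-- Maximizers of the penalized energy among the densities supported in a ball. -/
structure IsPenalizedMaximizer (R δ : ℝ) (θ : Plane → ℝ≥0∞) : Prop where
  admissible : Admissible θ
  support : ∀ x, R ≤ ‖x‖ → θ x = 0
  max : ∀ φ : Plane → ℝ≥0∞, Admissible φ → (∀ x, R ≤ ‖x‖ → φ x = 0) →
    penalizedEnergy δ φ ≤ penalizedEnergy δ θ

theorem indicator_ball_eq_self {R : ℝ} (h : ∀ x, R ≤ ‖x‖ → θ x = 0) :
    (Metric.ball 0 R).indicator θ = θ := by
  refine indicator_eq_self.2 fun x hx => ?_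
  by_contra hR
  exact hx (h x (by simpa using hR))

theorem penalty_indicator_ball (hθ : Measurable θ) (h1 : ∀ x, θ x ≤ 1) (R : ℝ) :
    penalty ((Metric.ball 0 R).indicator θ) = ENNReal.ofReal (∫ x in upperHalf,
      (Metric.ball (0 : Plane) R).indicator (fun x => x 0 ^ 2 * x 1) x * (θ x).toReal) ∧
    MemLp ((Metric.ball (0 : Plane) R).indicator fun x => x 0 ^ 2 * x 1) 2
      (volume.restrict upperHalf) := by
  have hms : MeasurableSet (Metric.ball (0 : Plane) R) := Metric.isOpen_ball.measurableSet
  have hL : ∀ p, MemLp ((Metric.ball (0 : Plane) R).indicator fun x => x 0 ^ 2 * x 1) p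
      (volume.restrict upperHalf) := fun p => by
    refine memLp_bounded (C := |R| ^ 2 * |R|) (R := R)
      (((by fun_prop : Measurable fun x : Plane => x 0 ^ 2 * x 1)).indicator hms).aestronglyMeasurable
      (fun x _ => ?_) fun x hx => indicator_of_notMem (by simpa using hx) _
    by_cases hx : x ∈ Metric.ball (0 : Plane) R
    · rw [indicator_of_mem hx, abs_mul, abs_pow]
      have h2 := (mem_ball_zero_iff.1 hx).le.trans (le_abs_self R)
      have h3 := (abs_coord_le x 0).trans h2
      have h4 := (abs_coord_le x 1).trans h2
      gcongr
    · rw [indicator_of_notMem hx, abs_zero]; positivity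
  refine ⟨?_, hL 2⟩
  rw [← setLIntegral_ofReal_mul hθ h1 measurableSet_upperHalf (memLp_one_iff_integrable.1 (hL 1))]
  · refine lintegral_congr fun x => ?_
    by_cases hx : x ∈ Metric.ball (0 : Plane) R <;> simp [hx]
  · intro x hx
    have hx1 : 0 < x 1 := hx
    exact indicator_apply_nonneg fun _ => by positivity

theorem penalty_ne_top (hθ : Measurable θ) (h1 : ∀ x, θ x ≤ 1) {R : ℝ}
    (hR : ∀ x, R ≤ ‖x‖ → θ x = 0) : penalty θ ≠ ∞ := by
  rw [← indicator_ball_eq_self hR, (penalty_indicator_ball hθ h1 R).1]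
  exact ENNReal.ofReal_ne_top

/-- The direct method: on a ball both the energy and the penalty are weakly continuous. -/
theorem exists_isPenalizedMaximizer (R : ℝ) {δ : ℝ} (hδ : 0 ≤ δ) :
    ∃ θ, IsPenalizedMaximizer R δ θ := by
  have hms : MeasurableSet (Metric.ball (0 : Plane) R) := Metric.isOpen_ball.measurableSet
  set S : Set ℝ := {e | ∃ θ, Admissible θ ∧
    e = penalizedEnergy δ ((Metric.ball (0 : Plane) R).indicator θ)} with hS
  have hadm0 : Admissible (0 : Plane → ℝ≥0∞) := ⟨measurable_zero, fun _ => zero_le, by simp [imp]⟩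
  have hbdd : BddAbove S := by
    refine ⟨3, ?_⟩
    rintro e ⟨θ, hθ, rfl⟩
    have h1 := ENNReal.toReal_mono (by norm_num) (hθ.indicator hms).interaction_le_three
    have h2 : 0 ≤ δ * (penalty ((Metric.ball (0 : Plane) R).indicator θ)).toReal := by positivity
    simp only [penalizedEnergy]
    norm_num at h1
    linarith
  obtain ⟨u, -, hu, huS⟩ := exists_seq_tendsto_sSup (S := S) ⟨_, 0, hadm0, rfl⟩ hbdd
  choose θ hθ hθu using huS
  obtain ⟨θ', k, hk, hθ', hlim⟩ := exists_weakLimit θ hθ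
  have hpen : Tendsto (fun n => (penalty ((Metric.ball (0 : Plane) R).indicator (θ (k n)))).toReal) atTop
      (𝓝 (penalty ((Metric.ball (0 : Plane) R).indicator θ')).toReal) := by
    refine (ENNReal.tendsto_toReal (penalty_ne_top (hθ'.indicator hms).meas
      (hθ'.indicator hms).le_one (R := R) fun x hx => indicator_of_notMem (by simpa using hx) _)).comp ?_
    simp only [fun n => (penalty_indicator_ball (hθ (k n)).meas (hθ (k n)).le_one R).1,
      (penalty_indicator_ball hθ'.meas hθ'.le_one R).1]
    exact (ENNReal.continuous_ofReal.tendsto _).comp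
      (hlim _ R (penalty_indicator_ball hθ'.meas hθ'.le_one R).2
        fun x hx => indicator_of_notMem (by simpa using hx) _)
  have hint := (ENNReal.tendsto_toReal (hθ'.indicator hms).interaction_ne_top).comp
    (hlim.tendsto_interaction (fun n => hθ (k n)) hθ' R)
  have hE := hint.sub (hpen.const_mul δ)
  have hsup := tendsto_nhds_unique (hE.congr fun n => (hθu (k n)).symm)
    (hu.comp hk.tendsto_atTop)
  refine ⟨(Metric.ball (0 : Plane) R).indicator θ', hθ'.indicator hms,
    fun x hx => indicator_of_notMem (by simpa using hx) _, fun φ hφ hφR => ?_⟩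
  refine le_of_le_of_eq (le_csSup hbdd ⟨φ, hφ, ?_⟩) hsup.symm
  rw [indicator_ball_eq_self hφR]

theorem penalty_eq_rightOf (t : ℝ) (hθ : Measurable θ) :
    penalty θ = ∫⁻ x in rightOf t, (ENNReal.ofReal (x 0 ^ 2 * x 1) * θ x +
      ENNReal.ofReal ((2 * t - x 0) ^ 2 * x 1) * θ (mirror t x)) := by
  rw [penalty, lintegral_upperHalf_eq t (by fun_prop)]
  simp only [mirror_apply_one, mirror_apply_zero]

theorem penalty_weight_lt {t : ℝ} (ht : t < 0) {x : Plane} (hx : x ∈ rightOf t) :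
    ENNReal.ofReal (x 0 ^ 2 * x 1) < ENNReal.ofReal ((2 * t - x 0) ^ 2 * x 1) := by
  have hx0 : t < x 0 := hx.2
  have hx1 : 0 < x 1 := hx.1
  have h : x 0 ^ 2 < (2 * t - x 0) ^ 2 := by nlinarith
  rw [ENNReal.ofReal_lt_ofReal_iff (mul_pos (lt_of_le_of_lt (sq_nonneg _) h) hx1)]
  gcongr

/-- For `t < 0` the right-hand member of a mirror pair is the one nearer the axis `x₁ = 0`. Moving
the larger value there saves the weight gap times the density gap. -/
theorem penalty_eq_polarize_add {t : ℝ} (ht : t < 0) (hθ : Measurable θ) :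
    penalty θ = penalty (polarize t θ) + ∫⁻ x in rightOf t,
      (ENNReal.ofReal ((2 * t - x 0) ^ 2 * x 1) - ENNReal.ofReal (x 0 ^ 2 * x 1)) *
        (θ (mirror t x) - θ x) := by
  have hm := measurable_mirror t
  rw [penalty_eq_rightOf t hθ, penalty_eq_rightOf t (measurable_polarize hθ),
    ← lintegral_add_right _ (by fun_prop)]
  refine setLIntegral_congr_fun (measurableSet_rightOf t) fun x hx => ?_
  simp only [polarize_of_mem hx, polarize_mirror_of_mem hx]
  obtain ⟨k, hk, hk'⟩ : ∃ k, ENNReal.ofReal ((2 * t - x 0) ^ 2 * x 1) -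
      ENNReal.ofReal (x 0 ^ 2 * x 1) = k ∧
      ENNReal.ofReal ((2 * t - x 0) ^ 2 * x 1) = ENNReal.ofReal (x 0 ^ 2 * x 1) + k :=
    ⟨_, rfl, (add_tsub_cancel_of_le (penalty_weight_lt ht hx).le).symm⟩
  rw [hk, hk']
  rcases le_total (θ x) (θ (mirror t x)) with h | h
  · obtain ⟨u, hu, hu'⟩ : ∃ u, θ (mirror t x) - θ x = u ∧ θ (mirror t x) = θ x + u :=
      ⟨_, rfl, (add_tsub_cancel_of_le h).symm⟩
    rw [max_eq_right h, min_eq_left h, hu, hu']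
    ring
  · rw [max_eq_left h, min_eq_right h, tsub_eq_zero_of_le h]
    ring

/-- Polarization does not lower the energy and keeps the support in the ball, so by maximality it
cannot lower the penalty. The saved amount is therefore zero, and the weight gap is positive. -/
theorem IsPenalizedMaximizer.leftOrdered {R δ : ℝ} (hδ : 0 < δ) (h : IsPenalizedMaximizer R δ θ) :
    LeftOrdered θ := by
  intro t ht
  have ha := h.admissible
  have hm := measurable_mirror t
  have hθ := ha.meas
  have hsupp : ∀ x, R ≤ ‖x‖ → polarize t θ x = 0 := by
    intro x hx
    unfold polarize
    split_ifs with hxt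
    -- For `t < 0` the mirror image of a point to the right of the line is farther from the origin,
    -- so it too lies outside the support.
    · have hn : ‖x‖ ≤ ‖mirror t x‖ := by
        have h1 := norm_sub_sq_eq x 0
        have h2 := norm_sub_sq_eq (mirror t x) 0
        simp only [sub_zero, PiLp.zero_apply, mirror_apply_zero, mirror_apply_one] at h1 h2
        refine abs_le_of_sq_le_sq' ?_ (norm_nonneg _) |>.2
        nlinarith
      rw [h.support x hx, h.support _ (hx.trans hn), max_self]
    · rw [h.support x hx]; simp
  have hmax := h.max _ ha.polarize hsupp
  have hint := ENNReal.toReal_mono ha.polarize.interaction_ne_top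
    (interaction_le_polarize (t := t) ha.meas ha.le_one)
  have hp1 := penalty_ne_top ha.meas ha.le_one h.support
  have hp2 := penalty_ne_top ha.polarize.meas ha.polarize.le_one hsupp
  simp only [penalizedEnergy] at hmax
  have hpen : (penalty θ).toReal ≤ (penalty (polarize t θ)).toReal := by
    by_contra! hc
    nlinarith
  rw [ENNReal.toReal_le_toReal hp1 hp2, penalty_eq_polarize_add ht ha.meas] at hpen
  have h0 := ENNReal.le_sub_of_add_le_left hp2 hpen
  rw [tsub_self, nonpos_iff_eq_zero, lintegral_eq_zero_iff (by fun_prop)] at h0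
  filter_upwards [h0, ae_restrict_mem (measurableSet_rightOf t)] with x hx hxm
  exact tsub_eq_zero_iff_le.1 ((mul_eq_zero.1 hx).resolve_left
    (tsub_pos_of_lt (penalty_weight_lt ht hxm)).ne')

theorem penalty_comp_mirror (hθ : Measurable θ) :
    penalty (fun x => θ (mirror 0 x)) = penalty θ := by
  have := (measurePreserving_mirror 0).setLIntegral_comp_preimage measurableSet_upperHalf
    (f := fun x => ENNReal.ofReal (x 0 ^ 2 * x 1) * θ x) (by fun_prop)
  simp only [mirror_apply_zero, mirror_apply_one, mul_zero, zero_sub, neg_sq] at this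
  exact this

theorem norm_mirror_zero (x : Plane) : ‖mirror 0 x‖ = ‖x‖ := by
  have h0 : mirror 0 0 = 0 := plane_ext (by simp) (by simp)
  simpa [h0] using norm_mirror_sub_mirror 0 x 0

theorem IsPenalizedMaximizer.comp_mirror {R δ : ℝ} (h : IsPenalizedMaximizer R δ θ) :
    IsPenalizedMaximizer R δ fun x => θ (mirror 0 x) := by
  have ha := h.admissible
  refine ⟨ha.comp_mirror, fun x hx => h.support _ (by rwa [norm_mirror_zero]), fun φ hφ hR => ?_⟩
  refine (h.max φ hφ hR).trans_eq ?_
  simp only [penalizedEnergy, penalty_comp_mirror ha.meas, interaction_comp_mirror ha.meas]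

theorem tendsto_interaction_ball (ha : Admissible θ) :
    Tendsto (fun n : ℕ => interaction ((Metric.ball 0 (n : ℝ)).indicator θ)
      ((Metric.ball 0 (n : ℝ)).indicator θ)) atTop (𝓝 (interaction θ θ)) := by
  have hms : ∀ n : ℕ, MeasurableSet (Metric.ball (0 : Plane) (n : ℝ)) :=
    fun n => Metric.isOpen_ball.measurableSet
  have hm : ∀ n : ℕ, Measurable ((Metric.ball (0 : Plane) (n : ℝ)).indicator θ) :=
    fun n => ha.meas.indicator (hms n)
  have hmono : ∀ x, Monotone fun n : ℕ => (Metric.ball (0 : Plane) (n : ℝ)).indicator θ x := by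
    intro x m n hmn
    exact indicator_le_indicator_of_subset (Metric.ball_subset_ball (by exact_mod_cast hmn))
      (fun _ => zero_le) x
  have hev : ∀ x, ∀ᶠ n : ℕ in atTop, (Metric.ball (0 : Plane) (n : ℝ)).indicator θ x = θ x := by
    intro x
    obtain ⟨N, hN⟩ := exists_nat_gt ‖x‖
    filter_upwards [eventually_ge_atTop N] with n hn
    refine indicator_of_mem ?_ _
    rw [mem_ball_zero_iff]
    exact hN.trans_le (by exact_mod_cast hn)
  have hpot : ∀ x, Tendsto (fun n : ℕ => pot ((Metric.ball (0 : Plane) (n : ℝ)).indicator θ) x) atTop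
      (𝓝 (pot θ x)) := by
    intro x
    refine lintegral_tendsto_of_tendsto_of_monotone (fun n => by have := hm n; fun_prop)
      (Eventually.of_forall fun y m n hmn => ?_) (Eventually.of_forall fun y => ?_)
    · exact mul_le_mul_right (hmono y hmn) _
    · exact tendsto_const_nhds.congr' ((hev y).mono fun n hn => by simp only [hn])
  refine lintegral_tendsto_of_tendsto_of_monotone
    (fun n => ((measurable_pot (hm n)).mul (hm n)).aemeasurable)
    (Eventually.of_forall fun x m n hmn => ?_) (Eventually.of_forall fun x => ?_)
  · exact mul_le_mul' (pot_mono (fun y => hmono y hmn) x) (hmono x hmn)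
  · have h1 := ENNReal.Tendsto.mul_const (hpot x)
      (Or.inr (ne_top_of_le_ne_top ENNReal.one_ne_top (ha.le_one x)))
    exact h1.congr' ((hev x).mono fun n hn => by simp only [hn])

/-- A competitor beating `c` may be truncated to a ball, where its penalty `p` is finite. With `δ =
(i - c) / (p + 1)` the penalty costs it less than its margin over `c`, and the penalized maximizer
inherits the strict inequality. Mirror invariance of the penalized problem gives the order on both
sides. -/
theorem exists_ordered_of_lt {c : ℝ≥0∞} (hc : c < interactionMax) :
    ∃ θ, Admissible θ ∧ LeftOrdered θ ∧ LeftOrdered (fun x => θ (mirror 0 x)) ∧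
      c < interaction θ θ := by
  simp only [interactionMax, lt_iSup_iff] at hc
  obtain ⟨φ, hφ, hcφ⟩ := hc
  obtain ⟨n, hn⟩ := ((tendsto_interaction_ball hφ).eventually_const_lt hcφ).exists
  set D := Metric.ball (0 : Plane) (n : ℝ)
  have hD : Admissible (D.indicator φ) := hφ.indicator Metric.isOpen_ball.measurableSet
  have hsupp : ∀ x, (n : ℝ) ≤ ‖x‖ → D.indicator φ x = 0 :=
    fun x hx => indicator_of_notMem (by simpa [D] using hx) _
  have hgap := (ENNReal.toReal_lt_toReal (ne_top_of_lt hn) hD.interaction_ne_top).2 hn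
  set i := (interaction (D.indicator φ) (D.indicator φ)).toReal
  set p := (penalty (D.indicator φ)).toReal with hp
  have hp0 : 0 ≤ p := ENNReal.toReal_nonneg
  set δ := (i - c.toReal) / (p + 1) with hδ
  have hδ0 : 0 < δ := div_pos (sub_pos.2 hgap) (by positivity)
  obtain ⟨θ, hθ⟩ := exists_isPenalizedMaximizer n hδ0.le
  refine ⟨θ, hθ.admissible, hθ.leftOrdered hδ0, hθ.comp_mirror.leftOrdered hδ0, ?_⟩
  have hmax := hθ.max _ hD hsupp
  simp only [penalizedEnergy] at hmax
  have hδp : δ * (p + 1) = i - c.toReal := by rw [hδ]; field_simp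
  have hpos : 0 ≤ δ * (penalty θ).toReal := by positivity
  rw [← ENNReal.toReal_lt_toReal (ne_top_of_lt hn) hθ.admissible.interaction_ne_top]
  linarith

/-- In the splitting into inside and outside parts, every term containing the outside part is
dominated by the interaction of `θ` with that part, which is at most `ε` times an impulse of at most
one. -/
theorem interaction_le_ball_add (ha : Admissible θ) {R : ℝ} {ε : ℝ≥0∞}
    (h : ∀ x ∈ upperHalf, R ≤ ‖x‖ → pot θ x ≤ ε * ENNReal.ofReal (x 1)) :
    interaction θ θ ≤ interaction ((Metric.ball 0 R).indicator θ)
      ((Metric.ball 0 R).indicator θ) + 2 * ε := by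
  have hms : MeasurableSet (Metric.ball (0 : Plane) R) := Metric.isOpen_ball.measurableSet
  set α := (Metric.ball (0 : Plane) R).indicator θ with hα
  set β := (Metric.ball (0 : Plane) R)ᶜ.indicator θ with hβ
  have hαm : Measurable α := ha.meas.indicator hms
  have hβm : Measurable β := ha.meas.indicator hms.compl
  have hsum : α + β = θ := indicator_self_add_compl _ _
  have h1 : interaction θ β ≤ ε := by
    refine (interaction_le_of_pot_le ha.meas (c := ε) fun x hx hxs => ?_).trans ?_
    · exact h x hx (by simpa using hxs)
    · exact mul_le_of_le_one_right' ha.imp_le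
  have h2 : interaction β α ≤ ε := by
    refine le_trans ?_ h1
    rw [interaction_comm hβm hαm, ← hsum, interaction_add_left hαm hβm hβm]
    exact le_self_add
  calc interaction θ θ = interaction θ (α + β) := by rw [hsum]
    _ = interaction θ α + interaction θ β := interaction_add_right ha.meas hαm
    _ = interaction (α + β) α + interaction θ β := by rw [hsum]
    _ = interaction α α + interaction β α + interaction θ β := by
        rw [interaction_add_left hαm hβm hαm]
    _ ≤ interaction α α + ε + ε := by gcongr
    _ = _ := by ring

/-- Ordered near-maximizers have tails that are small uniformly in `n`, so their energy is carried
by one fixed ball, where it passes to the weak limit. The tail `2 (ε / 2)` is exactly the allowed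
error. -/
theorem exists_maximizer : ∃ θ, Admissible θ ∧ interaction θ θ = interactionMax := by
  obtain ⟨c, -, hc, hclim⟩ := exists_seq_strictMono_tendsto' interactionMax_pos
  choose θ hθ hl hr hlt using fun n => exists_ordered_of_lt (hc n).2
  obtain ⟨θ', k, hk, hθ', hlim⟩ := exists_weakLimit θ hθ
  refine ⟨θ', hθ', le_antisymm hθ'.interaction_le ?_⟩
  refine ENNReal.le_of_forall_pos_le_add fun ε hε _ => ?_
  obtain ⟨R, -, hR⟩ := exists_pot_le (ε := ε / 2) (by positivity)
  have hle : ∀ n, c (k n) ≤ interaction ((Metric.ball 0 R).indicator (θ (k n)))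
      ((Metric.ball 0 R).indicator (θ (k n))) + 2 * ENNReal.ofReal (ε / 2) := by
    intro n
    refine (hlt (k n)).le.trans (interaction_le_ball_add (hθ _) fun x hx hxR => ?_)
    rw [← ENNReal.ofReal_mul (by positivity)]
    exact hR _ (hθ _) (hl _) (hr _) x hx hxR
  have hlim2 := (hlim.tendsto_interaction (fun n => hθ (k n)) hθ' R).add_const
    (2 * ENNReal.ofReal (ε / 2))
  refine (le_of_tendsto_of_tendsto' (hclim.comp hk.tendsto_atTop) hlim2 hle).trans ?_
  refine add_le_add (interaction_mono fun x => indicator_le_self _ _ x) (le_of_eq ?_)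
  rw [show (2 : ℝ≥0∞) = ENNReal.ofReal 2 by simp, ← ENNReal.ofReal_mul (by norm_num),
    mul_div_cancel₀ _ (by norm_num), ENNReal.ofReal_coe_nnreal]

end

section

/-! ### Scaling -/

open Filter Topology

variable {θ η : Plane → ℝ≥0∞}

theorem setLIntegral_comp_smul {c : ℝ} (hc : 0 < c) {f : Plane → ℝ≥0∞} (hf : Measurable f) :
    ∫⁻ x in upperHalf, f (c • x) = ENNReal.ofReal ((c ^ 2)⁻¹) * ∫⁻ x in upperHalf, f x := by
  have hm : Measurable fun x : Plane => c • x := measurable_const_smul c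
  rw [← lintegral_indicator measurableSet_upperHalf, ← lintegral_indicator measurableSet_upperHalf]
  have h1 : ∀ x, upperHalf.indicator (fun x => f (c • x)) x = upperHalf.indicator f (c • x) := by
    intro x
    have h : c • x ∈ upperHalf ↔ x ∈ upperHalf := by
      change 0 < c * x 1 ↔ 0 < x 1
      exact mul_pos_iff_of_pos_left hc
    by_cases hx : x ∈ upperHalf
    · rw [indicator_of_mem hx, indicator_of_mem (h.2 hx)]
    · rw [indicator_of_notMem hx, indicator_of_notMem (fun h' => hx (h.1 h'))]
  simp_rw [h1]
  rw [← lintegral_map (hf.indicator measurableSet_upperHalf) hm,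
    Measure.map_addHaar_smul volume hc.ne', lintegral_smul_measure]
  simp [abs_of_pos, hc]

theorem greenKernel_smul_smul {c : ℝ} (hc : 0 < c) (x y : Plane) :
    greenKernel (c • x) (c • y) = greenKernel x y := by
  have h1 : c • x = c • y ↔ x = y := smul_right_inj hc.ne'
  have h2 : green (c • x) (c • y) = green x y := by
    simp only [green, ← smul_sub, norm_smul, Real.norm_of_nonneg hc.le, PiLp.smul_apply, smul_eq_mul,
      mul_pow]
    rw [show 4 * (c * x 1) * (c * y 1) = c ^ 2 * (4 * x 1 * y 1) by ring,
      mul_div_mul_left _ _ (by positivity)]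
  simp only [greenKernel, h1, h2]

theorem imp_comp_smul {c : ℝ} (hc : 0 < c) (hθ : Measurable θ) :
    imp (fun x => θ (c • x)) = ENNReal.ofReal ((c ^ 3)⁻¹) * imp θ := by
  have h := setLIntegral_comp_smul hc (f := fun x => ENNReal.ofReal (c⁻¹ * x 1) * θ x) (by fun_prop)
  simp only [PiLp.smul_apply, smul_eq_mul, inv_mul_cancel_left₀ hc.ne'] at h
  rw [imp, h]
  simp only [ENNReal.ofReal_mul (inv_pos.2 hc).le, mul_assoc]
  rw [lintegral_const_mul _ (by fun_prop), ← mul_assoc, ← ENNReal.ofReal_mul (by positivity), imp]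
  congr 2
  rw [← mul_inv]; ring

theorem pot_comp_smul {c : ℝ} (hc : 0 < c) (hθ : Measurable θ) (x : Plane) :
    pot (fun y => θ (c • y)) x = ENNReal.ofReal ((c ^ 2)⁻¹) * pot θ (c • x) := by
  have h := setLIntegral_comp_smul hc (f := fun y => greenKernel (c • x) y * θ y) (by fun_prop)
  simp only [greenKernel_smul_smul hc] at h
  exact h

theorem interaction_comp_smul {c : ℝ} (hc : 0 < c) (hθ : Measurable θ) :
    interaction (fun x => θ (c • x)) (fun x => θ (c • x)) =
      ENNReal.ofReal ((c ^ 4)⁻¹) * interaction θ θ := by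
  have hp := measurable_pot hθ
  have h := setLIntegral_comp_smul hc (f := fun y => pot θ y * θ y) (by fun_prop)
  have hps : Measurable fun x : Plane => pot θ (c • x) * θ (c • x) :=
    (by fun_prop : Measurable fun y => pot θ y * θ y).comp (measurable_const_smul c)
  simp only [interaction, pot_comp_smul hc hθ, mul_assoc]
  rw [lintegral_const_mul _ hps, h, ← mul_assoc, ← ENNReal.ofReal_mul (by positivity)]
  congr 2
  rw [← mul_inv]; ring

/-- The Green function is invariant under dilations, so dilating by `c` multiplies impulse by `c³`
and interaction by `c⁴`. Parametrizing the impulse bound as a cube avoids the power `4 / 3`. -/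
theorem interaction_le_of_imp_le (hθ : Measurable θ) (h1 : ∀ x, θ x ≤ 1) {c : ℝ} (hc : 0 < c)
    (h : imp θ ≤ ENNReal.ofReal (c ^ 3)) :
    interaction θ θ ≤ ENNReal.ofReal (c ^ 4) * interactionMax := by
  have ha : Admissible fun x => θ (c • x) := by
    refine ⟨hθ.comp (measurable_const_smul c), fun x => h1 _, ?_⟩
    rw [imp_comp_smul hc hθ]
    calc _ ≤ ENNReal.ofReal ((c ^ 3)⁻¹) * ENNReal.ofReal (c ^ 3) := by gcongr
      _ = 1 := by
        rw [← ENNReal.ofReal_mul (by positivity), inv_mul_cancel₀ (by positivity),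
          ENNReal.ofReal_one]
  have h2 := ha.interaction_le
  rw [interaction_comp_smul hc hθ] at h2
  calc interaction θ θ
      = ENNReal.ofReal (c ^ 4) * (ENNReal.ofReal ((c ^ 4)⁻¹) * interaction θ θ) := by
        rw [← mul_assoc, ← ENNReal.ofReal_mul (by positivity), mul_inv_cancel₀ (by positivity),
          ENNReal.ofReal_one, one_mul]
    _ ≤ _ := by gcongr

theorem Admissible.imp_ne_top (h : Admissible θ) : imp θ ≠ ∞ :=
  ne_top_of_le_ne_top ENNReal.one_ne_top h.imp_le

/-- Unused impulse could be spent by dilating. For impulse `m < 1` the choice `c = 1 - (1 - m) / 3`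
gives `m ≤ c³` by Bernoulli and `c < 1`, so the energy would be at most `c⁴` times the maximum. -/
theorem imp_eq_one_of_maximizer (h : Admissible θ) (hmax : interaction θ θ = interactionMax) :
    imp θ = 1 := by
  refine le_antisymm h.imp_le (not_lt.1 fun hlt => ?_)
  set m := (imp θ).toReal with hm
  have hm0 : 0 ≤ m := ENNReal.toReal_nonneg
  have hm1 : m < 1 := by
    simpa using (ENNReal.toReal_lt_toReal h.imp_ne_top ENNReal.one_ne_top).2 hlt
  set c := 1 - (1 - m) / 3 with hc
  have hc0 : 0 < c := by rw [hc]; linarith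
  have hc1 : c < 1 := by rw [hc]; linarith
  have hcm : m ≤ c ^ 3 := by
    rw [hc]; nlinarith [sq_nonneg (1 - m)]
  have h1 := interaction_le_of_imp_le h.meas h.le_one hc0 (by
    rw [← ENNReal.ofReal_toReal h.imp_ne_top]; exact ENNReal.ofReal_le_ofReal hcm)
  rw [hmax] at h1
  have h2 : ENNReal.ofReal (c ^ 4) < 1 := by
    rw [ENNReal.ofReal_lt_one]; exact pow_lt_one₀ hc0.le hc1 (by norm_num)
  have h3 := ENNReal.mul_lt_mul_left interactionMax_pos.ne' interactionMax_ne_top h2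
  rw [one_mul] at h3
  exact absurd h1 (not_le.2 h3)

/-! ### First variation -/

/-- The speed `W = (4/3) I`, where `I` is half of `interactionMax`. -/
def speed : ℝ := 2 / 3 * interactionMax.toReal

theorem speed_pos : 0 < speed :=
  mul_pos (by norm_num) (ENNReal.toReal_pos interactionMax_pos.ne' interactionMax_ne_top)

theorem le_of_forall_le_add_mul {a b c : ℝ} (h : ∀ s : ℝ, 0 < s → s ≤ 1 → a ≤ b + s * c) :
    a ≤ b := by
  have hlim : Tendsto (fun s : ℝ => b + s * c) (𝓝[>] 0) (𝓝 (b + 0 * c)) :=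
    ((continuous_const.add (continuous_id.mul continuous_const)).tendsto 0).mono_left
      nhdsWithin_le_nhds
  rw [zero_mul, add_zero] at hlim
  refine ge_of_tendsto hlim ?_
  filter_upwards [Ioc_mem_nhdsGT (zero_lt_one' ℝ)] with s hs using h s hs.1 hs.2

/-- Outward variation `θ + s η`. With `q` a third of the impulse of `η`, the perturbed impulse `1 +
3 s q` is at most `(1 + s q)³`, so scaling bounds the energy by `(1 + s q)⁴` times the maximum.
Comparing first-order terms as `s → 0` gives the multiplier `2 / 3` of `interactionMax`. -/
theorem interaction_le_speed_mul (h : Admissible θ) (hmax : interaction θ θ = interactionMax)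
    (hη : Measurable η) (hle : ∀ x, θ x + η x ≤ 1) (hfin : imp η ≠ ∞) :
    interaction θ η ≤ ENNReal.ofReal speed * imp η := by
  have himp := imp_eq_one_of_maximizer h hmax
  set M := interactionMax.toReal with hM
  set q := (imp η).toReal / 3 with hq
  have hq0 : 0 ≤ q := by positivity
  have hM0 : 0 ≤ M := ENNReal.toReal_nonneg
  have key : ∀ s : ℝ, 0 < s → s ≤ 1 → interactionMax + 2 * (ENNReal.ofReal s * interaction θ η) ≤
      ENNReal.ofReal ((1 + s * q) ^ 4) * interactionMax := by
    intro s hs hs1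
    set ζ : Plane → ℝ≥0∞ := fun x => ENNReal.ofReal s * η x with hζ
    have hζm : Measurable ζ := hη.const_mul _
    have hup := interaction_le_of_imp_le (h.meas.add hζm) (fun x => ?_)
      (c := 1 + s * q) (by positivity) ?_
    · refine le_trans ?_ hup
      rw [interaction_add_left h.meas hζm (h.meas.add hζm), interaction_add_right h.meas h.meas,
        interaction_add_right hζm h.meas, hmax, interaction_comm hζm h.meas,
        interaction_const_mul_right h.meas hη, two_mul, add_assoc]
      gcongr
      exact le_self_add
    · refine le_trans (add_le_add le_rfl ?_) (hle x)
      exact mul_le_of_le_one_left' (ENNReal.ofReal_le_one.2 hs1)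
    · rw [imp_add h.meas, himp, hζ, imp_const_mul hη, ← ENNReal.ofReal_toReal hfin,
        ← ENNReal.ofReal_mul hs.le, ← ENNReal.ofReal_one, ← ENNReal.ofReal_add zero_le_one
          (by positivity)]
      refine ENNReal.ofReal_le_ofReal ?_
      have : (imp η).toReal = 3 * q := by rw [hq]; ring
      rw [this]
      have hsq : 0 ≤ s * q := by positivity
      nlinarith [pow_nonneg hsq 2, pow_nonneg hsq 3]
  have hefin : interaction θ η ≠ ∞ := by
    intro htop
    have h1 := key 1 one_pos le_rfl
    rw [htop] at h1
    simp only [ENNReal.ofReal_one, one_mul] at h1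
    rw [ENNReal.mul_top (by norm_num), add_top, top_le_iff] at h1
    exact ENNReal.mul_ne_top ENNReal.ofReal_ne_top interactionMax_ne_top h1
  set e := (interaction θ η).toReal with he
  have hreal : 2 * e ≤ 4 * q * M := by
    -- The constant collects the binomial terms of order at least two, using `s³, s⁴ ≤ s²`.
    refine le_of_forall_le_add_mul (c := (6 * q ^ 2 + 4 * q ^ 3 + q ^ 4) * M) fun s hs hs1 => ?_
    have h1 := key s hs hs1
    rw [← ENNReal.ofReal_toReal interactionMax_ne_top, ← ENNReal.ofReal_toReal hefin,
      show (2 : ℝ≥0∞) = ENNReal.ofReal 2 by simp, ← ENNReal.ofReal_mul hs.le,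
      ← ENNReal.ofReal_mul (by norm_num), ← ENNReal.ofReal_mul (by positivity),
      ← ENNReal.ofReal_add (by positivity) (by positivity),
      ENNReal.ofReal_le_ofReal_iff (by positivity)] at h1
    have h2 : s * (2 * e) ≤ s * (4 * q * M + s * (6 * q ^ 2 + 4 * q ^ 3 + q ^ 4) * M) := by
      have h3 : s ^ 3 ≤ s ^ 2 := pow_le_pow_of_le_one hs.le hs1 (by norm_num)
      have h4 : s ^ 4 ≤ s ^ 2 := pow_le_pow_of_le_one hs.le hs1 (by norm_num)
      have h5 : 4 * (s ^ 3 * (q ^ 3 * M)) ≤ 4 * (s ^ 2 * (q ^ 3 * M)) := by gcongr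
      have h6 : s ^ 4 * (q ^ 4 * M) ≤ s ^ 2 * (q ^ 4 * M) := by gcongr
      rw [← hM, ← he] at h1
      nlinarith
    have := le_of_mul_le_mul_left h2 hs
    linarith
  rw [← ENNReal.ofReal_toReal hefin, ← ENNReal.ofReal_toReal hfin, ← ENNReal.ofReal_mul speed_pos.le]
  refine ENNReal.ofReal_le_ofReal ?_
  rw [speed, ← hM, ← he]
  have : (imp η).toReal = 3 * q := by rw [hq]; ring
  rw [this]
  linarith

/-- Inward variation `θ - s η`, with `1 - 3 s q ≤ (1 - s q)³`. Together with the outward variation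
it pins down the same multiplier from both sides. -/
theorem speed_mul_le_interaction (h : Admissible θ) (hmax : interaction θ θ = interactionMax)
    (hη : Measurable η) (hle : ∀ x, η x ≤ θ x) :
    ENNReal.ofReal speed * imp η ≤ interaction θ η := by
  have himp := imp_eq_one_of_maximizer h hmax
  have hηa : Admissible η := h.mono hη hle
  set M := interactionMax.toReal with hM
  set q := (imp η).toReal / 3 with hq
  have hq0 : 0 ≤ q := by positivity
  have hp1 : (imp η).toReal ≤ 1 := by
    simpa using ENNReal.toReal_mono ENNReal.one_ne_top hηa.imp_le
  have hM0 : 0 ≤ M := ENNReal.toReal_nonneg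
  have key : ∀ s : ℝ, 0 < s → s ≤ 1 → interactionMax ≤
      ENNReal.ofReal ((1 - s * q) ^ 4) * interactionMax +
        2 * (ENNReal.ofReal s * interaction θ η) := by
    intro s hs hs1
    set ζ : Plane → ℝ≥0∞ := fun x => ENNReal.ofReal s * η x with hζ
    have hζm : Measurable ζ := hη.const_mul _
    have hζle : ∀ x, ζ x ≤ θ x := fun x =>
      (mul_le_of_le_one_left' (ENNReal.ofReal_le_one.2 hs1)).trans (hle x)
    set ξ : Plane → ℝ≥0∞ := fun x => θ x - ζ x with hξ
    have hξm : Measurable ξ := h.meas.sub hζm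
    have hsum : ξ + ζ = θ := funext fun x => tsub_add_cancel_of_le (hζle x)
    have hsq1 : s * q ≤ 1 / 3 := by
      have : q ≤ 1 / 3 := by rw [hq]; linarith
      nlinarith
    have hsq : 0 ≤ s * q := by positivity
    have hup := interaction_le_of_imp_le hξm (fun x => tsub_le_self.trans (h.le_one x))
      (c := 1 - s * q) (by linarith) (by
        have h1 : imp ξ + imp ζ = 1 := by rw [← imp_add hξm, hsum, himp]
        rw [hζ, imp_const_mul hη, ← ENNReal.ofReal_toReal hηa.imp_ne_top,
          ← ENNReal.ofReal_mul hs.le] at h1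
        rw [ENNReal.eq_sub_of_add_eq ENNReal.ofReal_ne_top h1, ← ENNReal.ofReal_one,
          ← ENNReal.ofReal_sub _ (by positivity)]
        refine ENNReal.ofReal_le_ofReal ?_
        have : (imp η).toReal = 3 * q := by rw [hq]; ring
        rw [this]
        nlinarith [pow_nonneg hsq 2])
    calc interactionMax = interaction (ξ + ζ) (ξ + ζ) := by rw [hsum, hmax]
      _ = interaction ξ ξ + interaction ξ ζ + interaction ζ (ξ + ζ) := by
          rw [interaction_add_left hξm hζm (hξm.add hζm), interaction_add_right hξm hξm]
      _ ≤ interaction ξ ξ + interaction (ξ + ζ) ζ + interaction (ξ + ζ) ζ := by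
          rw [interaction_comm hζm (hξm.add hζm), interaction_add_left hξm hζm hζm]
          gcongr
          exact le_self_add
      _ = interaction ξ ξ + 2 * (ENNReal.ofReal s * interaction θ η) := by
          rw [hsum, interaction_const_mul_right h.meas hη]; ring
      _ ≤ _ := by gcongr
  by_cases hefin : interaction θ η = ∞
  · rw [hefin]; exact le_top
  set e := (interaction θ η).toReal with he
  have hreal : 4 * q * M ≤ 2 * e := by
    refine le_of_forall_le_add_mul (c := 6 * q ^ 2 * M) fun s hs hs1 => ?_
    have h1 := key s hs hs1
    rw [← ENNReal.ofReal_toReal interactionMax_ne_top, ← ENNReal.ofReal_toReal hefin,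
      show (2 : ℝ≥0∞) = ENNReal.ofReal 2 by simp, ← ENNReal.ofReal_mul hs.le,
      ← ENNReal.ofReal_mul (show 0 ≤ (1 - s * q) ^ 4 from Even.pow_nonneg (by decide) _),
      ← ENNReal.ofReal_mul zero_le_two,
      ← ENNReal.ofReal_add (by positivity) (by positivity),
      ENNReal.ofReal_le_ofReal_iff (by positivity), ← hM, ← he] at h1
    have hsq1 : s * q ≤ 1 / 3 := by
      have : q ≤ 1 / 3 := by rw [hq]; linarith
      nlinarith
    have hsq : 0 ≤ s * q := by positivity
    have h3 : (1 - s * q) ^ 4 ≤ 1 - 4 * (s * q) + 6 * (s * q) ^ 2 := by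
      nlinarith [pow_nonneg hsq 2, pow_nonneg hsq 3]
    have h4 := mul_le_mul_of_nonneg_right h3 hM0
    have h2 : s * (4 * q * M) ≤ s * (2 * e + s * (6 * q ^ 2 * M)) := by nlinarith
    exact le_of_mul_le_mul_left h2 hs
  rw [← ENNReal.ofReal_toReal hefin, ← ENNReal.ofReal_toReal hηa.imp_ne_top,
    ← ENNReal.ofReal_mul speed_pos.le]
  refine ENNReal.ofReal_le_ofReal ?_
  rw [speed, ← hM, ← he]
  have : (imp η).toReal = 3 * q := by rw [hq]; ring
  rw [this]
  linarith

/-- The room `1 - θ` left on the set where the potential exceeds `W x₂` is an allowed outward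
variation. The integrated inequality opposes the pointwise one, so equality holds almost everywhere
and no room is left. Cutting to balls keeps the impulse of the variation finite. -/
theorem ae_eq_one_of_speed_lt_pot (h : Admissible θ) (hmax : interaction θ θ = interactionMax) :
    ∀ᵐ x ∂volume.restrict upperHalf, ENNReal.ofReal (speed * x 1) < pot θ x → θ x = 1 := by
  have hpm := measurable_pot h.meas
  have hR : ∀ R : ℕ, ∀ᵐ x ∂volume.restrict upperHalf, x ∈ Metric.ball (0 : Plane) (R : ℝ) →
      ENNReal.ofReal (speed * x 1) < pot θ x → θ x = 1 := by
    intro R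
    set B : Set Plane := {x | ENNReal.ofReal (speed * x 1) < pot θ x} ∩ Metric.ball 0 (R : ℝ) with hB
    have hBm : MeasurableSet B :=
      (measurableSet_lt (by fun_prop) hpm).inter Metric.isOpen_ball.measurableSet
    set η : Plane → ℝ≥0∞ := B.indicator fun x => 1 - θ x with hη
    have hηm : Measurable η := (measurable_const.sub h.meas).indicator hBm
    have hfin : imp η ≠ ∞ := by
      have : imp η ≤ ∫⁻ x in Metric.ball (0 : Plane) (R : ℝ), ENNReal.ofReal R := by
        rw [← lintegral_indicator Metric.isOpen_ball.measurableSet]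
        refine (setLIntegral_le_lintegral _ _).trans (lintegral_mono fun x => ?_)
        by_cases hx : x ∈ B
        · rw [hη, indicator_of_mem hx, indicator_of_mem hx.2]
          refine (mul_le_of_le_one_right' tsub_le_self).trans (ENNReal.ofReal_le_ofReal ?_)
          exact (le_abs_self _).trans ((abs_coord_le x 1).trans (mem_ball_zero_iff.1 hx.2).le)
        · rw [hη, indicator_of_notMem hx, mul_zero]; exact zero_le
      refine ne_top_of_le_ne_top ?_ this
      rw [lintegral_const, Measure.restrict_apply_univ]
      exact ENNReal.mul_ne_top ENNReal.ofReal_ne_top measure_ball_lt_top.ne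
    have hle := interaction_le_speed_mul h hmax hηm (fun x => by
      by_cases hx : x ∈ B
      · rw [hη, indicator_of_mem hx, add_tsub_cancel_of_le (h.le_one x)]
      · rw [hη, indicator_of_notMem hx, add_zero]; exact h.le_one x) hfin
    rw [imp, ← lintegral_const_mul _ (by fun_prop), interaction] at hle
    have hfin' : ∫⁻ x in upperHalf, ENNReal.ofReal speed * (ENNReal.ofReal (x 1) * η x) ≠ ∞ := by
      rw [lintegral_const_mul _ (by fun_prop)]
      exact ENNReal.mul_ne_top ENNReal.ofReal_ne_top hfin
    have heq := ae_eq_of_ae_le_of_lintegral_le (Eventually.of_forall fun x => ?_) hfin'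
      (hpm.mul hηm).aemeasurable hle
    · filter_upwards [heq] with x hx hxR hlt
      have hxB : x ∈ B := ⟨hlt, hxR⟩
      simp only [Pi.mul_apply] at hx
      rw [← mul_assoc, ← ENNReal.ofReal_mul speed_pos.le] at hx
      by_contra hne
      have hpos : η x ≠ 0 := by
        rw [hη, indicator_of_mem hxB]
        exact (tsub_pos_of_lt (lt_of_le_of_ne (h.le_one x) hne)).ne'
      have hηfin : η x ≠ ∞ := by
        rw [hη, indicator_of_mem hxB]
        exact ne_top_of_le_ne_top ENNReal.one_ne_top tsub_le_self
      exact absurd ((ENNReal.mul_left_inj hpos hηfin).1 hx) hlt.ne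
    · simp only [Pi.mul_apply]
      by_cases hx : x ∈ B
      · rw [← mul_assoc, ← ENNReal.ofReal_mul speed_pos.le]
        gcongr
        exact hx.1.le
      · rw [hη, indicator_of_notMem hx]; simp
  rw [← ae_all_iff] at hR
  filter_upwards [hR] with x hx
  obtain ⟨R, hR⟩ := exists_nat_gt ‖x‖
  exact hx R (by simpa using hR)

/-- The same argument with the inward variation that removes `θ` where the potential is below `W
x₂`; no cut-off is needed, since the variation is dominated by `θ`. -/
theorem ae_eq_zero_of_pot_lt_speed (h : Admissible θ) (hmax : interaction θ θ = interactionMax) :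
    ∀ᵐ x ∂volume.restrict upperHalf, pot θ x < ENNReal.ofReal (speed * x 1) → θ x = 0 := by
  have hpm := measurable_pot h.meas
  set B : Set Plane := {x | pot θ x < ENNReal.ofReal (speed * x 1)} with hB
  have hBm : MeasurableSet B := measurableSet_lt hpm (by fun_prop)
  set η : Plane → ℝ≥0∞ := B.indicator θ with hη
  have hηm : Measurable η := h.meas.indicator hBm
  have hηle : ∀ x, η x ≤ θ x := fun x => indicator_le_self _ _ x
  have hle := speed_mul_le_interaction h hmax hηm hηle
  have hpt : ∀ x, pot θ x * η x ≤ ENNReal.ofReal speed * (ENNReal.ofReal (x 1) * η x) := by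
    intro x
    by_cases hx : x ∈ B
    · rw [← mul_assoc, ← ENNReal.ofReal_mul speed_pos.le]
      gcongr
      exact le_of_lt hx
    · rw [hη, indicator_of_notMem hx]; simp
  rw [imp, ← lintegral_const_mul _ (by fun_prop), interaction] at hle
  have hfin : ∫⁻ x in upperHalf, pot θ x * η x ≠ ∞ := by
    refine ne_top_of_le_ne_top ?_ (lintegral_mono hpt)
    rw [lintegral_const_mul _ (by fun_prop)]
    exact ENNReal.mul_ne_top ENNReal.ofReal_ne_top (h.mono hηm hηle).imp_ne_top
  have heq := ae_eq_of_ae_le_of_lintegral_le (Eventually.of_forall hpt) hfin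
    (by fun_prop) hle
  filter_upwards [heq] with x hx hlt
  have hxB : x ∈ B := hlt
  rw [← mul_assoc, ← ENNReal.ofReal_mul speed_pos.le] at hx
  by_contra hne
  have hpos : η x ≠ 0 := by rwa [hη, indicator_of_mem hxB]
  have hηfin : η x ≠ ∞ := ne_top_of_le_ne_top ENNReal.one_ne_top ((hηle x).trans (h.le_one x))
  exact absurd ((ENNReal.mul_left_inj hpos hηfin).1 hx) hlt.ne

end

section

/-! ### Structure of the maximizers -/

open Filter Topology

variable {θ : Plane → ℝ≥0∞}

/-- The horizontal translation by `-τ`. -/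
def translate (τ : ℝ) (x : Plane) : Plane := x - !₂[τ, 0]

@[simp] theorem translate_apply_zero (τ : ℝ) (x : Plane) : translate τ x 0 = x 0 - τ := rfl

@[simp] theorem translate_apply_one (τ : ℝ) (x : Plane) : translate τ x 1 = x 1 := by
  simp [translate]

theorem measurePreserving_translate (τ : ℝ) : MeasurePreserving (translate τ) :=
  measurePreserving_sub_right volume _

theorem translate_preimage_upperHalf (τ : ℝ) : translate τ ⁻¹' upperHalf = upperHalf := by
  ext x
  change 0 < translate τ x 1 ↔ 0 < x 1
  rw [translate_apply_one]

theorem translate_preimage_rightOf (τ t : ℝ) : translate τ ⁻¹' rightOf (t - τ) = rightOf t := by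
  ext x
  change (0 < translate τ x 1 ∧ t - τ < translate τ x 0) ↔ (0 < x 1 ∧ t < x 0)
  rw [translate_apply_one, translate_apply_zero, sub_lt_sub_iff_right]

theorem translate_mirror (τ t : ℝ) (x : Plane) :
    translate τ (mirror t x) = mirror (t - τ) (translate τ x) :=
  plane_ext (by simp; ring) (by simp)

theorem greenKernel_translate (τ : ℝ) (x y : Plane) :
    greenKernel (translate τ x) (translate τ y) = greenKernel x y := by
  have h : translate τ x = translate τ y ↔ x = y := sub_left_inj
  have h2 : translate τ x - translate τ y = x - y := sub_sub_sub_cancel_right _ _ _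
  simp only [greenKernel, green, h, h2, translate_apply_one]

theorem pot_comp_translate (hθ : Measurable θ) (τ : ℝ) (x : Plane) :
    pot (fun y => θ (translate τ y)) x = pot θ (translate τ x) := by
  have key := (measurePreserving_translate τ).setLIntegral_comp_preimage
    measurableSet_upperHalf (f := fun y => greenKernel (translate τ x) y * θ y) (by fun_prop)
  simp only [greenKernel_translate, translate_preimage_upperHalf] at key
  exact key

theorem imp_comp_translate (hθ : Measurable θ) (τ : ℝ) :
    imp (fun y => θ (translate τ y)) = imp θ := by
  have key := (measurePreserving_translate τ).setLIntegral_comp_preimage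
    measurableSet_upperHalf (f := fun y => ENNReal.ofReal (y 1) * θ y) (by fun_prop)
  simp only [translate_apply_one, translate_preimage_upperHalf] at key
  exact key

theorem interaction_comp_translate (hθ : Measurable θ) (τ : ℝ) :
    interaction (fun y => θ (translate τ y)) (fun y => θ (translate τ y)) = interaction θ θ := by
  have hp := measurable_pot hθ
  have key := (measurePreserving_translate τ).setLIntegral_comp_preimage
    measurableSet_upperHalf (f := fun y => pot θ y * θ y) (by fun_prop)
  simp only [← pot_comp_translate hθ, translate_preimage_upperHalf] at key
  exact key

theorem ae_comp_translate {s : Set Plane} (hs : MeasurableSet s) {τ : ℝ} {p : Plane → Prop}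
    (h : ∀ᵐ x ∂volume.restrict s, p x) :
    ∀ᵐ x ∂volume.restrict (translate τ ⁻¹' s), p (translate τ x) :=
  ((measurePreserving_translate τ).restrict_preimage hs).quasiMeasurePreserving.ae h

/-- Maximizers whose axis of symmetry is the vertical axis. -/
structure CenteredMaximizer (θ : Plane → ℝ≥0∞) : Prop where
  admissible : Admissible θ
  max : interaction θ θ = interactionMax
  symm : ∀ᵐ x ∂volume.restrict upperHalf, θ (mirror 0 x) = θ x
  ordered : LeftOrdered θ
  strict : ∀ t < 0, ¬ ∀ᵐ x ∂volume.restrict (rightOf t), θ x ≤ θ (mirror t x)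

theorem exists_centeredMaximizer (h : Admissible θ) (hmax : interaction θ θ = interactionMax) :
    ∃ τ, CenteredMaximizer fun x => θ (translate τ x) := by
  obtain ⟨c, hsymm, hord⟩ := exists_symmetry_axis h (imp_eq_one_of_maximizer h hmax) hmax
  have hinv : ∀ x, translate c (translate (-c) x) = x := fun x => plane_ext (by simp) (by simp)
  -- Composition with `x ↦ x + (c, 0)` moves the axis from `x₁ = c` to `x₁ = 0`, hence the shift
  -- `-c`.
  refine ⟨-c, ⟨h.meas.comp (measurePreserving_translate _).measurable, fun _ => h.le_one _,
    (imp_comp_translate h.meas _).trans_le h.imp_le⟩,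
    (interaction_comp_translate h.meas _).trans hmax, ?_, ?_, ?_⟩
  · have h1 := ae_comp_translate (τ := -c) measurableSet_upperHalf hsymm
    rw [translate_preimage_upperHalf] at h1
    filter_upwards [h1] with x hx
    rw [translate_mirror, ← hx]
    simp
  · intro t ht
    have h1 := ae_comp_translate (τ := -c) (measurableSet_rightOf _) (hord (t + c) (by linarith)).1
    rw [show t + c = t - -c by ring, translate_preimage_rightOf] at h1
    filter_upwards [h1] with x hx
    rwa [translate_mirror]
  · intro t ht hcon
    refine (hord (t + c) (by linarith)).2 ?_
    have h1 := ae_comp_translate (τ := c) (measurableSet_rightOf _) hcon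
    rw [show t = t + c - c by ring, translate_preimage_rightOf] at h1
    filter_upwards [h1] with x hx
    have hinv' : translate (-c) (translate c x) = x := plane_ext (by simp) (by simp)
    rwa [translate_mirror, hinv', show t + c - c - -c = t + c by ring] at hx

theorem CenteredMaximizer.ordered_mirror (h : CenteredMaximizer θ) :
    LeftOrdered fun x => θ (mirror 0 x) := by
  intro t ht
  have hs := h.symm
  have h1 := h.ordered t ht
  rw [ae_restrict_iff' measurableSet_upperHalf] at hs
  have hs' := (measurePreserving_mirror t).quasiMeasurePreserving.ae hs
  filter_upwards [h1, ae_restrict_mem (measurableSet_rightOf t), ae_restrict_of_ae hs,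
    ae_restrict_of_ae hs'] with x hx hxm hx1 hx2
  rwa [hx1 hxm.1, hx2 hxm.1]

theorem CenteredMaximizer.pot_mirror (h : CenteredMaximizer θ) (x : Plane) :
    pot θ (mirror 0 x) = pot θ x := by
  rw [← pot_comp_mirror h.admissible.meas]
  exact pot_congr h.symm x

theorem CenteredMaximizer.pot_neg_abs (h : CenteredMaximizer θ) (a s : ℝ) :
    pot θ !₂[a, s] = pot θ !₂[-|a|, s] := by
  rcases abs_cases a with ⟨ha, -⟩ | ⟨ha, -⟩
  · rw [← h.pot_mirror]
    congr 1
    exact plane_ext (by simp [ha]) (by simp)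
  · rw [ha, neg_neg]

theorem CenteredMaximizer.pot_lt (h : CenteredMaximizer θ) {a b s : ℝ} (hs : 0 < s)
    (hab : |b| < |a|) : pot θ !₂[a, s] < pot θ !₂[b, s] := by
  rw [h.pot_neg_abs a, h.pot_neg_abs b]
  have hb := abs_nonneg b
  -- Both points are first moved to the left of the axis; `t` is the midpoint of `-|a|` and `-|b|`,
  -- so the mirror exchanges them.
  set t := -(|a| + |b|) / 2 with ht
  have ht0 : t < 0 := by rw [ht]; linarith
  have hmem : (!₂[-|b|, s] : Plane) ∈ rightOf t := by
    refine ⟨hs, ?_⟩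
    change t < -|b|
    rw [ht]; linarith
  have hmir : mirror t !₂[-|b|, s] = !₂[-|a|, s] :=
    plane_ext (by simp [ht]; ring) (by simp)
  have := pot_mirror_lt h.admissible.meas (h.ordered t ht0) (h.strict t ht0) hmem
    (by rw [hmir]; exact h.admissible.pot_ne_top hs)
  rwa [hmir] at this

/-- The superlevel set `{pot θ > W x₂}`. -/
def core (θ : Plane → ℝ≥0∞) : Set Plane :=
  {x | x ∈ upperHalf ∧ ENNReal.ofReal (speed * x 1) < pot θ x}

theorem measurableSet_core (hθ : Measurable θ) : MeasurableSet (core θ) :=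
  measurableSet_upperHalf.inter (measurableSet_lt (by fun_prop) (measurable_pot hθ))

/-- The height is put first so that sections of the product measure are horizontal lines. -/
theorem measurePreserving_swap_coord :
    MeasurePreserving (fun x : Plane => ((x 1, x 0) : ℝ × ℝ)) :=
  (Measure.measurePreserving_swap (μ := (volume : Measure ℝ)) (ν := (volume : Measure ℝ))).comp
    ((volume_preserving_finTwoArrow ℝ).comp (PiLp.volume_preserving_ofLp (ι := Fin 2)))

/-- On a horizontal line `W x₂` is constant while the potential is strictly decreasing in `|x₁|`, so
the level set has at most two points there. Fubini concludes. -/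
theorem CenteredMaximizer.volume_level (h : CenteredMaximizer θ) :
    volume {x : Plane | x ∈ upperHalf ∧ pot θ x = ENNReal.ofReal (speed * x 1)} = 0 := by
  have hpm := measurable_pot h.admissible.meas
  set T : Set (ℝ × ℝ) := {p | 0 < p.1 ∧ pot θ !₂[p.2, p.1] = ENNReal.ofReal (speed * p.1)} with hT
  have hm : Measurable fun p : ℝ × ℝ => (!₂[p.2, p.1] : Plane) := by fun_prop
  have hTm : MeasurableSet T :=
    (measurableSet_lt measurable_const measurable_fst).inter
      (measurableSet_eq_fun (hpm.comp hm) (by fun_prop))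
  have hpre : {x : Plane | x ∈ upperHalf ∧ pot θ x = ENNReal.ofReal (speed * x 1)} =
      (fun x : Plane => ((x 1, x 0) : ℝ × ℝ)) ⁻¹' T := by
    ext x
    have hx : (!₂[x 0, x 1] : Plane) = x := plane_ext rfl rfl
    change _ ↔ 0 < x 1 ∧ pot θ !₂[x 0, x 1] = ENNReal.ofReal (speed * x 1)
    rw [hx]
    rfl
  rw [hpre, measurePreserving_swap_coord.measure_preimage hTm.nullMeasurableSet,
    Measure.volume_eq_prod, Measure.measure_prod_null hTm]
  refine Eventually.of_forall fun s => ?_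
  refine Set.Finite.measure_zero ?_ _
  have heq : ∀ a ∈ Prod.mk s ⁻¹' T, ∀ b ∈ Prod.mk s ⁻¹' T, |a| = |b| := by
    rintro a ⟨hs, ha⟩ b ⟨-, hb⟩
    by_contra hne
    rcases lt_or_gt_of_ne hne with h' | h'
    · exact (h.pot_lt hs h').ne (hb.trans ha.symm)
    · exact (h.pot_lt hs h').ne (ha.trans hb.symm)
  rcases (Prod.mk s ⁻¹' T).eq_empty_or_nonempty with he | ⟨a, ha⟩
  · rw [he]; exact finite_empty
  · refine (Set.toFinite {a, -a}).subset fun b hb => ?_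
    exact abs_eq_abs.1 (heq b hb a ha)

/-- The two variations decide the value of `θ` off the level set, which is null. The relaxed
maximizer is thus a genuine patch. -/
theorem CenteredMaximizer.ae_eq_core (h : CenteredMaximizer θ) :
    θ =ᵐ[volume.restrict upperHalf] (core θ).indicator 1 := by
  have hl := measure_eq_zero_iff_ae_notMem.1 h.volume_level
  filter_upwards [ae_eq_one_of_speed_lt_pot h.admissible h.max,
    ae_eq_zero_of_pot_lt_speed h.admissible h.max, ae_restrict_of_ae hl,
    ae_restrict_mem measurableSet_upperHalf] with x h1 h2 h3 hx
  rcases lt_trichotomy (ENNReal.ofReal (speed * x 1)) (pot θ x) with hlt | heq | hgt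
  · rw [h1 hlt, indicator_of_mem (show x ∈ core θ from ⟨hx, hlt⟩), Pi.one_apply]
  · exact absurd ⟨hx, heq.symm⟩ h3
  · rw [h2 hgt, indicator_of_notMem fun hc => hc.2.not_gt hgt]

/-- Fatou's lemma, the kernel being continuous off the diagonal. Lower semicontinuity is all that
openness of a strict superlevel set requires. -/
theorem pot_le_liminf (hθ : Measurable θ) {x : Plane} (hx : x ∈ upperHalf) {u : ℕ → Plane}
    (hu : Tendsto u atTop (𝓝 x)) : pot θ x ≤ liminf (fun n => pot θ (u n)) atTop := by
  refine le_trans (lintegral_mono_ae ?_) (lintegral_liminf_le fun n => by fun_prop)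
  filter_upwards [ae_restrict_of_ae (Measure.ae_ne volume x),
    ae_restrict_mem measurableSet_upperHalf] with y hy hyU
  refine le_of_eq (Tendsto.liminf_eq ?_).symm
  have hx1 : 0 < x 1 := hx
  have hy1 : 0 < y 1 := hyU
  have hn : 0 < ‖x - y‖ := norm_pos_iff.2 (sub_ne_zero.2 (Ne.symm hy))
  have hg : Tendsto (fun n => green (u n) y) atTop (𝓝 (green x y)) := by
    have hc : ContinuousAt (fun z => green z y) x := by
      unfold green
      have h0 : ‖x - y‖ ^ 2 ≠ 0 := by positivity
      have h1 : 1 + 4 * x 1 * y 1 / ‖x - y‖ ^ 2 ≠ 0 := by positivity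
      fun_prop (disch := assumption)
    exact hc.tendsto.comp hu
  have hk : Tendsto (fun n => greenKernel (u n) y) atTop (𝓝 (greenKernel x y)) := by
    rw [greenKernel_of_ne (Ne.symm hy)]
    refine ((ENNReal.continuous_ofReal.tendsto _).comp hg).congr' ?_
    filter_upwards [hu.eventually_ne (Ne.symm hy)] with n hn
    exact (greenKernel_of_ne hn).symm
  by_cases h0 : θ y = 0
  · simp [h0]
  · refine ENNReal.Tendsto.mul_const hk (Or.inl ?_)
    exact (greenKernel_pos hx hyU).ne'

theorem isOpen_core (hθ : Measurable θ) : IsOpen (core θ) := by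
  rw [← isClosed_compl_iff]
  refine IsSeqClosed.isClosed fun u x hu hlim hx => ?_
  have hU : ∀ᶠ n in atTop, u n ∈ upperHalf := hlim.eventually (isOpen_upperHalf.mem_nhds hx.1)
  have hle : ∀ᶠ n in atTop, pot θ (u n) ≤ ENNReal.ofReal (speed * u n 1) :=
    hU.mono fun n hn => not_lt.1 fun hlt => hu n ⟨hn, hlt⟩
  have hc : Continuous fun z : Plane => ENNReal.ofReal (speed * z 1) :=
    ENNReal.continuous_ofReal.comp (by fun_prop)
  have h1 : liminf (fun n => pot θ (u n)) atTop ≤ ENNReal.ofReal (speed * x 1) := by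
    rw [← ((hc.tendsto x).comp hlim).liminf_eq]
    exact liminf_le_liminf hle
  exact absurd ((pot_le_liminf hθ hx.1 hlim).trans h1) (not_le.2 hx.2)

/-- The uniform decay with `ε = W` leaves no room for the potential to exceed `W x₂` outside a ball,
whose radius is the same for all maximizers. -/
theorem exists_core_subset_ball :
    ∃ R > 0, ∀ θ : Plane → ℝ≥0∞, CenteredMaximizer θ → core θ ⊆ Metric.ball 0 R := by
  obtain ⟨R, hR, h⟩ := exists_pot_le speed_pos
  refine ⟨R, hR, fun θ hθ x hx => ?_⟩
  rw [mem_ball_zero_iff]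
  by_contra hn
  exact absurd (h θ hθ.admissible hθ.ordered hθ.ordered_mirror x hx.1 (not_lt.1 hn)) (not_le.2 hx.2)

theorem CenteredMaximizer.isSteiner_core (h : CenteredMaximizer θ)
    (hbdd : Bornology.IsBounded (core θ)) : IsSteiner (core θ) := by
  obtain ⟨R, hR⟩ := hbdd.subset_ball 0
  have hbd : ∀ s a : ℝ, !₂[a, s] ∈ core θ → |a| ≤ R := fun s a ha =>
    (abs_coord_le !₂[a, s] 0).trans (mem_ball_zero_iff.1 (hR ha)).le
  have hopen : ∀ s : ℝ, IsOpen {a : ℝ | !₂[a, s] ∈ core θ} := fun s =>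
    (isOpen_core h.admissible.meas).preimage (by fun_prop : Continuous fun a : ℝ => (!₂[a, s] : Plane))
  have hdown : ∀ s a b : ℝ, !₂[a, s] ∈ core θ → |b| ≤ |a| → !₂[b, s] ∈ core θ := by
    rintro s a b ⟨hs, ha⟩ hba
    refine ⟨hs, lt_of_lt_of_le ha ?_⟩
    rcases hba.lt_or_eq with hlt | heq
    · exact (h.pot_lt hs hlt).le
    · rw [h.pot_neg_abs a, h.pot_neg_abs b, heq]
  -- Adjoining `0` gives half-width zero to an empty slice. Openness of the slice makes `|a| < l s`
  -- strict, and monotonicity in `|x₁|` fills in the whole interval.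
  refine ⟨fun s => sSup (insert 0 {a : ℝ | !₂[a, s] ∈ core θ}), fun s _ => ?_, fun s hs a => ?_⟩
  all_goals
    have hB : BddAbove (insert 0 {a : ℝ | !₂[a, s] ∈ core θ}) :=
      BddAbove.insert 0 ⟨R, fun a ha => (le_abs_self a).trans (hbd s a ha)⟩
  · exact le_csSup hB (mem_insert _ _)
  · constructor
    · intro ha
      have ha' : |a| ∈ {a : ℝ | !₂[a, s] ∈ core θ} := hdown s a |a| ha (by simp)
      obtain ⟨ε, hε, hball⟩ := Metric.isOpen_iff.1 (hopen s) |a| ha'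
      have hmem : |a| + ε / 2 ∈ {a : ℝ | !₂[a, s] ∈ core θ} := hball (by
        rw [Metric.mem_ball, Real.dist_eq, add_sub_cancel_left, abs_of_pos (by positivity)]
        linarith)
      have := le_csSup hB (mem_insert_of_mem 0 hmem)
      linarith
    · intro ha
      obtain ⟨b, hb, hab⟩ := exists_lt_of_lt_csSup (insert_nonempty _ _) ha
      rcases hb with rfl | hb
      · exact absurd hab (not_lt.2 (abs_nonneg a))
      · exact hdown s b a hb (hab.le.trans (le_abs_self b))

end

section

/-! ### The Biot–Savart kernel -/

open Filter Topology
open scoped ComplexConjugate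

/-- In complex form the kernel is `i / (2π z̄)`, so inner products of velocities become real parts
of rational expressions to which Cauchy's formula applies on circles. -/
theorem biotSavartKernel_complex (z : ℂ) : biotSavartKernel (complexToPlane z) =
    (1 / (2 * Real.pi)) • complexToPlane (Complex.I * (conj z)⁻¹) := by
  have h : ‖z‖ ^ 2 = Complex.normSq z := Complex.sq_norm z
  refine plane_ext ?_ ?_
  · simp only [biotSavartKernel, PiLp.smul_apply, complexToPlane_apply_zero,
      complexToPlane_apply_one, LinearIsometryEquiv.norm_map, smul_eq_mul, h]
    simp [Complex.inv_re, Complex.inv_im]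
    ring
  · simp only [biotSavartKernel, PiLp.smul_apply, complexToPlane_apply_zero,
      complexToPlane_apply_one, LinearIsometryEquiv.norm_map, smul_eq_mul, h]
    simp [Complex.inv_re, Complex.inv_im]
    ring

theorem inner_biotSavartKernel (z w : ℂ) :
    inner ℝ (biotSavartKernel (complexToPlane z)) (biotSavartKernel (complexToPlane w)) =
      1 / (4 * Real.pi ^ 2) * ((conj z)⁻¹ * w⁻¹).re := by
  rw [biotSavartKernel_complex, biotSavartKernel_complex, real_inner_smul_left,
    real_inner_smul_right, LinearIsometryEquiv.inner_map_map, Complex.inner]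
  have h : (Complex.I * (conj w)⁻¹ * conj (Complex.I * (conj z)⁻¹)).re =
      ((conj z)⁻¹ * w⁻¹).re := by
    rw [← Complex.conj_re]
    congr 1
    simp only [map_mul, map_inv₀, map_neg, Complex.conj_conj, Complex.conj_I]
    linear_combination (-(conj z)⁻¹ * w⁻¹) * Complex.I_mul_I
  rw [h]
  have := Real.pi_pos.ne'
  field_simp
  ring

theorem exists_complexToPlane (x : Plane) : ∃ z, complexToPlane z = x :=
  complexToPlane.surjective x

theorem norm_biotSavartKernel (x : Plane) : ‖biotSavartKernel x‖ = 1 / (2 * Real.pi) * ‖x‖⁻¹ := by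
  obtain ⟨z, rfl⟩ := exists_complexToPlane x
  rw [biotSavartKernel_complex, norm_smul, Real.norm_of_nonneg (by positivity)]
  simp

theorem norm_biotSavartKernel_sub {x y : Plane} (hx : x ≠ 0) (hy : y ≠ 0) :
    ‖biotSavartKernel x - biotSavartKernel y‖ =
      1 / (2 * Real.pi) * (‖x - y‖ * (‖x‖ * ‖y‖)⁻¹) := by
  obtain ⟨z, rfl⟩ := exists_complexToPlane x
  obtain ⟨w, rfl⟩ := exists_complexToPlane y
  have hz : conj z ≠ 0 := fun h => hx (by rw [(map_eq_zero _).1 h, map_zero])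
  have hw : conj w ≠ 0 := fun h => hy (by rw [(map_eq_zero _).1 h, map_zero])
  rw [biotSavartKernel_complex, biotSavartKernel_complex, ← smul_sub, ← map_sub, ← map_sub,
    norm_smul, Real.norm_of_nonneg (by positivity), ← mul_sub]
  simp only [LinearIsometryEquiv.norm_map]
  rw [norm_mul, Complex.norm_I, one_mul, inv_sub_inv hz hw, norm_div, norm_mul, ← map_sub,
    RCLike.norm_conj, RCLike.norm_conj, RCLike.norm_conj, norm_sub_rev,
    div_eq_mul_inv ‖z - w‖]

@[fun_prop]
theorem measurable_biotSavartKernel : Measurable biotSavartKernel := by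
  unfold biotSavartKernel; fun_prop

theorem integrableOn_ball_inv_norm (p : Plane) (R : ℝ) :
    IntegrableOn (fun x : Plane => ‖x - p‖⁻¹) (Metric.ball 0 R) := by
  refine ⟨(by fun_prop : Measurable fun x : Plane => ‖x - p‖⁻¹).aestronglyMeasurable, ?_⟩
  have hsub : Metric.ball (0 : Plane) R ⊆ Metric.ball p (|R| + ‖p‖) := by
    intro y hy
    rw [mem_ball_zero_iff] at hy
    rw [Metric.mem_ball, dist_eq_norm]
    linarith [norm_sub_le y p, le_abs_self R]
  refine lt_of_le_of_lt ?_ (ENNReal.ofReal_lt_top (r := 2 * Real.pi * (|R| + ‖p‖)))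
  rw [← lintegral_ball_inv_norm p (by positivity)]
  refine (lintegral_mono fun x => ?_).trans (lintegral_mono_set hsub)
  rcases eq_or_ne x p with rfl | h
  · simp
  · rw [Real.enorm_of_nonneg (by positivity), enorm_inv_eq_ofReal h.symm, norm_sub_rev, one_div]

theorem inv_mul_le_of_le_add {u v d : ℝ} (hu : 0 < u) (hv : 0 < v) (hd : 0 < d) (h : d ≤ u + v) :
    (u * v)⁻¹ ≤ d⁻¹ * (u⁻¹ + v⁻¹) := by
  have h1 : u⁻¹ + v⁻¹ = (u + v) * (u * v)⁻¹ := by field_simp; ring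
  rw [h1, ← mul_assoc]
  refine le_mul_of_one_le_left (by positivity) ?_
  rw [inv_mul_eq_div, one_le_div hd]
  exact h

/-- Inside a large ball the triangle inequality acts as a partial fraction decomposition, leaving
single poles, which are integrable in the plane. Outside it every factor is at least `(1 + ‖x‖) /
4`, whence the constant `64 = 4³` and cubic decay. -/
theorem integrable_inv_norm_mul {p a b : Plane} (hpa : p ≠ a) (hpb : p ≠ b) (hab : a ≠ b) :
    Integrable fun x : Plane => (‖x - p‖ * ‖x - a‖ * ‖x - b‖)⁻¹ := by
  have h1 : 0 < ‖p - a‖ := norm_pos_iff.2 (sub_ne_zero.2 hpa)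
  have h2 : 0 < ‖p - b‖ := norm_pos_iff.2 (sub_ne_zero.2 hpb)
  have h3 : 0 < ‖a - b‖ := norm_pos_iff.2 (sub_ne_zero.2 hab)
  set R := 2 * (‖p‖ + ‖a‖ + ‖b‖) + 1 with hR
  have hint : Integrable fun x : Plane => ‖p - a‖⁻¹ * (‖p - b‖⁻¹ *
      ((Metric.ball (0 : Plane) R).indicator (fun x => ‖x - p‖⁻¹) x +
        (Metric.ball (0 : Plane) R).indicator (fun x => ‖x - b‖⁻¹) x) + ‖a - b‖⁻¹ *
      ((Metric.ball (0 : Plane) R).indicator (fun x => ‖x - a‖⁻¹) x +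
        (Metric.ball (0 : Plane) R).indicator (fun x => ‖x - b‖⁻¹) x)) +
      64 * (1 + ‖x‖) ^ (-3 : ℝ) := by
    have hb : ∀ q : Plane, Integrable ((Metric.ball (0 : Plane) R).indicator fun x => ‖x - q‖⁻¹) :=
      fun q => (integrable_indicator_iff Metric.isOpen_ball.measurableSet).2
        (integrableOn_ball_inv_norm q R)
    refine Integrable.add (Integrable.const_mul ?_ _) (Integrable.const_mul ?_ _)
    · exact (((hb p).add (hb b)).const_mul _).add (((hb a).add (hb b)).const_mul _)
    · exact integrable_one_add_norm (by simp; norm_num)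
  refine hint.mono' (by fun_prop : Measurable fun x : Plane =>
    (‖x - p‖ * ‖x - a‖ * ‖x - b‖)⁻¹).aestronglyMeasurable ?_
  filter_upwards [Measure.ae_ne volume p, Measure.ae_ne volume a, Measure.ae_ne volume b]
    with x hxp hxa hxb
  have hu : 0 < ‖x - p‖ := norm_pos_iff.2 (sub_ne_zero.2 hxp)
  have hv : 0 < ‖x - a‖ := norm_pos_iff.2 (sub_ne_zero.2 hxa)
  have hw : 0 < ‖x - b‖ := norm_pos_iff.2 (sub_ne_zero.2 hxb)
  rw [Real.norm_of_nonneg (by positivity)]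
  by_cases hx : x ∈ Metric.ball (0 : Plane) R
  · simp only [indicator_of_mem hx]
    have e1 := inv_mul_le_of_le_add hu hv h1 (by
      rw [norm_sub_rev x p]; exact norm_sub_le_norm_sub_add_norm_sub p x a)
    have e2 := inv_mul_le_of_le_add hu hw h2 (by
      rw [norm_sub_rev x p]; exact norm_sub_le_norm_sub_add_norm_sub p x b)
    have e3 := inv_mul_le_of_le_add hv hw h3 (by
      rw [norm_sub_rev x a]; exact norm_sub_le_norm_sub_add_norm_sub a x b)
    have e4 : 0 ≤ 64 * (1 + ‖x‖) ^ (-3 : ℝ) := by positivity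
    calc (‖x - p‖ * ‖x - a‖ * ‖x - b‖)⁻¹ = (‖x - p‖ * ‖x - a‖)⁻¹ * ‖x - b‖⁻¹ := mul_inv _ _
      _ ≤ ‖p - a‖⁻¹ * (‖x - p‖⁻¹ + ‖x - a‖⁻¹) * ‖x - b‖⁻¹ := by gcongr
      _ = ‖p - a‖⁻¹ * ((‖x - p‖ * ‖x - b‖)⁻¹ + (‖x - a‖ * ‖x - b‖)⁻¹) := by
          rw [mul_inv, mul_inv]; ring
      _ ≤ ‖p - a‖⁻¹ * (‖p - b‖⁻¹ * (‖x - p‖⁻¹ + ‖x - b‖⁻¹) +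
            ‖a - b‖⁻¹ * (‖x - a‖⁻¹ + ‖x - b‖⁻¹)) := by gcongr
      _ ≤ _ := by linarith
  · simp only [indicator_of_notMem hx, add_zero, mul_zero, zero_add]
    rw [mem_ball_zero_iff, not_lt] at hx
    have np := norm_nonneg p
    have na := norm_nonneg a
    have nb := norm_nonneg b
    have hX : 0 < 1 + ‖x‖ := by positivity
    have f1 : (1 + ‖x‖) / 4 ≤ ‖x - p‖ := by linarith [norm_sub_norm_le x p]
    have f2 : (1 + ‖x‖) / 4 ≤ ‖x - a‖ := by linarith [norm_sub_norm_le x a]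
    have f3 : (1 + ‖x‖) / 4 ≤ ‖x - b‖ := by linarith [norm_sub_norm_le x b]
    rw [Real.rpow_neg hX.le, show (3 : ℝ) = ((3 : ℕ) : ℝ) by norm_num, Real.rpow_natCast,
      show 64 * ((1 + ‖x‖) ^ 3)⁻¹ = ((1 + ‖x‖) / 4 * ((1 + ‖x‖) / 4) * ((1 + ‖x‖) / 4))⁻¹ by
        field_simp; norm_num]
    gcongr

/-- The angular mean of the interaction of two point vortices. -/
theorem integral_circle_inv {r : ℝ} (hr : 0 < r) {a : ℂ} (ha : ‖a‖ ≠ r) :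
    ∫ t in Ioo (-Real.pi) Real.pi, r • ((conj (r * Complex.exp (t * Complex.I)))⁻¹ *
      (r * Complex.exp (t * Complex.I) - a)⁻¹) = if ‖a‖ < r then (2 * Real.pi / r : ℂ) else 0 := by
  have hcirc : ∮ z in C(0, r), (z - a)⁻¹ = if ‖a‖ < r then 2 * Real.pi * Complex.I else 0 := by
    split_ifs with h
    · exact circleIntegral.integral_sub_inv_of_mem_ball (by simpa using h)
    · have hlt : r < ‖a‖ := lt_of_le_of_ne (not_lt.1 h) (Ne.symm ha)
      have hne : ∀ z ∈ Metric.closedBall (0 : ℂ) r, z - a ≠ 0 := by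
        intro z hz h0
        rw [sub_eq_zero] at h0
        rw [h0, mem_closedBall_zero_iff] at hz
        linarith
      refine Complex.circleIntegral_eq_zero_of_differentiable_on_off_countable hr.le
        Set.countable_empty ?_ ?_
      · exact ContinuousOn.inv₀ (by fun_prop) hne
      · rintro z ⟨hz, -⟩
        exact (DifferentiableAt.inv (by fun_prop) (hne z (Metric.ball_subset_closedBall hz)))
  have hr' : (r : ℂ) ≠ 0 := by exact_mod_cast hr.ne'
  rw [circleIntegral] at hcirc
  have hper : Function.Periodic (fun t : ℝ => deriv (circleMap 0 r) t • (circleMap 0 r t - a)⁻¹)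
      (2 * Real.pi) := by
    intro t
    simp only [deriv_circleMap, periodic_circleMap 0 r t]
  have hshift := hper.intervalIntegral_add_eq 0 (-Real.pi)
  rw [zero_add, hcirc, show -Real.pi + 2 * Real.pi = Real.pi by ring,
    intervalIntegral.integral_of_le (by linarith [Real.pi_pos]), integral_Ioc_eq_integral_Ioo] at hshift
  -- On the circle `z̄ = r e^(-it)`, so the non-holomorphic factor turns into `dz / (i r)` and the
  -- angular integral becomes a contour integral of `(z - a)⁻¹`.
  have hpt : ∀ t : ℝ, r • ((conj (r * Complex.exp (t * Complex.I)))⁻¹ *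
      (r * Complex.exp (t * Complex.I) - a)⁻¹) =
      (r * Complex.I)⁻¹ * (deriv (circleMap 0 r) t • (circleMap 0 r t - a)⁻¹) := by
    intro t
    have hconj : conj (r * Complex.exp (t * Complex.I)) = r * (Complex.exp (t * Complex.I))⁻¹ := by
      rw [map_mul, Complex.conj_ofReal, ← Complex.exp_conj, ← Complex.exp_neg]
      simp
    rw [hconj, deriv_circleMap]
    simp only [circleMap, zero_add, Complex.real_smul, smul_eq_mul]
    have he := Complex.exp_ne_zero (t * Complex.I)
    have hI := Complex.I_ne_zero
    field_simp
  simp_rw [hpt]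
  rw [integral_const_mul, ← hshift]
  have hI := Complex.I_ne_zero
  (split_ifs <;> field_simp); simp

end

section

/-! ### The interaction of point vortices -/

open Filter Topology
open scoped ComplexConjugate

/-- The interaction density of a point vortex at the origin with a vortex pair. -/
def vortexDensity (a b z : ℂ) : ℂ := (conj z)⁻¹ * ((z - a)⁻¹ - (z - b)⁻¹)

theorem measurable_vortexDensity (a b : ℂ) : Measurable (vortexDensity a b) := by
  unfold vortexDensity
  have : Measurable fun z : ℂ => conj z := Complex.continuous_conj.measurable
  fun_prop

/-- The two poles combine to `(a - b) / ((z - a) (z - b))`, which supplies the extra power of decay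
at infinity. -/
theorem integrable_vortexDensity {a b : ℂ} (ha : a ≠ 0) (hb : b ≠ 0) (hab : a ≠ b) :
    Integrable (vortexDensity a b) := by
  have h := (integrable_inv_norm_mul (p := complexToPlane 0) (a := complexToPlane a)
    (b := complexToPlane b) (fun h => ha (complexToPlane.injective h).symm)
    (fun h => hb (complexToPlane.injective h).symm)
    (fun h => hab (complexToPlane.injective h))).const_mul ‖a - b‖
  have h' := (complexToPlane.measurePreserving.integrable_comp
    h.aestronglyMeasurable).2 h
  refine h'.mono' (measurable_vortexDensity a b).aestronglyMeasurable ?_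
  filter_upwards [Measure.ae_ne volume a, Measure.ae_ne volume b] with z hza hzb
  simp only [Function.comp_apply, ← map_sub, LinearIsometryEquiv.norm_map, sub_zero]
  rw [vortexDensity, inv_sub_inv (sub_ne_zero.2 hza) (sub_ne_zero.2 hzb), norm_mul, norm_inv,
    RCLike.norm_conj, norm_div, norm_mul, show z - b - (z - a) = a - b by ring]
  rw [mul_inv, mul_inv, div_eq_mul_inv, mul_inv]
  exact le_of_eq (by ring)

theorem integrableOn_polarCoord_symm {f : ℂ → ℂ} (hf : Integrable f) (hm : Measurable f) :
    IntegrableOn (fun p : ℝ × ℝ => p.1 • f (Complex.polarCoord.symm p))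
      (Ioi 0 ×ˢ Ioo (-Real.pi) Real.pi) := by
  have hc : Measurable fun p : ℝ × ℝ => Complex.polarCoord.symm p := by
    simp only [Complex.polarCoord_symm_apply]; fun_prop
  refine ⟨(measurable_fst.smul (hm.comp hc)).aestronglyMeasurable, ?_⟩
  have h := hf.2
  rw [HasFiniteIntegral, ← Complex.lintegral_comp_polarCoord_symm, polarCoord_target] at h
  refine lt_of_le_of_lt (le_of_eq ?_) h
  refine setLIntegral_congr_fun (measurableSet_Ioi.prod measurableSet_Ioo) ?_
  rintro p ⟨hp, -⟩
  simp only [enorm_smul, smul_eq_mul]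
  rw [Real.enorm_of_nonneg (le_of_lt hp)]

theorem integral_circle_vortexDensity {r : ℝ} (hr : 0 < r) {a b : ℂ} (ha : ‖a‖ ≠ r)
    (hb : ‖b‖ ≠ r) (hab : ‖a‖ ≤ ‖b‖) :
    ∫ t in Ioo (-Real.pi) Real.pi, r • vortexDensity a b (Complex.polarCoord.symm (r, t)) =
      (Ioc ‖a‖ ‖b‖).indicator (fun r : ℝ => ((2 * Real.pi * r⁻¹ : ℝ) : ℂ)) r := by
  have hint : ∀ {c : ℂ}, ‖c‖ ≠ r → IntegrableOn (fun t : ℝ => r • ((conj (r *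
      Complex.exp (t * Complex.I)))⁻¹ * (r * Complex.exp (t * Complex.I) - c)⁻¹))
      (Ioo (-Real.pi) Real.pi) := by
    intro c hc
    have hn : ∀ t : ℝ, ‖(r : ℂ) * Complex.exp (t * Complex.I)‖ = r := fun t => by
      rw [norm_mul, Complex.norm_exp_ofReal_mul_I, mul_one, Complex.norm_real,
        Real.norm_of_nonneg hr.le]
    have hcont : Continuous fun t : ℝ => r • ((conj (r *
        Complex.exp (t * Complex.I)))⁻¹ * (r * Complex.exp (t * Complex.I) - c)⁻¹) := by
      refine Continuous.const_smul (Continuous.mul (Continuous.inv₀ ?_ ?_)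
        (Continuous.inv₀ (by fun_prop) ?_)) r
      · exact Complex.continuous_conj.comp (by fun_prop)
      · intro t h
        have := hn t
        rw [(map_eq_zero _).1 h, norm_zero] at this
        exact hr.ne this
      · intro t h
        have := hn t
        rw [sub_eq_zero.1 h] at this
        exact hc this
    exact (hcont.integrableOn_Icc).mono_set Ioo_subset_Icc_self
  have hpt : ∀ t : ℝ, r • vortexDensity a b (Complex.polarCoord.symm (r, t)) =
      r • ((conj (r * Complex.exp (t * Complex.I)))⁻¹ * (r * Complex.exp (t * Complex.I) - a)⁻¹) -
      r • ((conj (r * Complex.exp (t * Complex.I)))⁻¹ *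
        (r * Complex.exp (t * Complex.I) - b)⁻¹) := by
    intro t
    rw [Complex.polarCoord_symm_apply, Complex.ofReal_cos, Complex.ofReal_sin,
      ← Complex.exp_mul_I, vortexDensity, mul_sub, smul_sub]
  simp_rw [hpt]
  rw [integral_sub (hint ha) (hint hb), integral_circle_inv hr ha, integral_circle_inv hr hb]
  by_cases h1 : ‖a‖ < r
  · by_cases h2 : ‖b‖ < r
    · rw [if_pos h1, if_pos h2, indicator_of_notMem (fun h => not_lt.2 h.2 h2), sub_self]
    · rw [if_pos h1, if_neg h2, indicator_of_mem (show r ∈ Ioc ‖a‖ ‖b‖ from ⟨h1, not_lt.1 h2⟩)]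
      push_cast
      rw [sub_zero, div_eq_mul_inv]
  · rw [if_neg h1, if_neg (fun h => h1 (hab.trans_lt h)), indicator_of_notMem (fun h => h1 h.1),
      sub_self]

/-- Only the circles with `‖a‖ < r ≤ ‖b‖` contribute, since they enclose one pole of the pair but
not the other. Integrating `2π / r` over this range gives the logarithm. -/
theorem integral_vortexDensity {a b : ℂ} (ha : a ≠ 0) (hne : a ≠ b) (hab : ‖a‖ ≤ ‖b‖) :
    ∫ z, vortexDensity a b z = ((2 * Real.pi * Real.log (‖b‖ / ‖a‖) : ℝ) : ℂ) := by
  have ha' : 0 < ‖a‖ := norm_pos_iff.2 ha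
  have hb : b ≠ 0 := norm_pos_iff.1 (ha'.trans_le hab)
  have hint := integrableOn_polarCoord_symm (integrable_vortexDensity ha hb hne)
    (measurable_vortexDensity a b)
  rw [← Complex.integral_comp_polarCoord_symm, polarCoord_target, Measure.volume_eq_prod,
    setIntegral_prod _ hint]
  have h1 : ∀ᵐ r : ℝ ∂(volume.restrict (Ioi 0)),
      ∫ t in Ioo (-Real.pi) Real.pi, r • vortexDensity a b (Complex.polarCoord.symm (r, t)) =
      (Ioc ‖a‖ ‖b‖).indicator (fun r : ℝ => ((2 * Real.pi * r⁻¹ : ℝ) : ℂ)) r := by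
    filter_upwards [ae_restrict_mem measurableSet_Ioi, Measure.ae_ne (volume.restrict _) ‖a‖,
      Measure.ae_ne (volume.restrict _) ‖b‖] with r hr hra hrb
    exact integral_circle_vortexDensity hr hra.symm hrb.symm hab
  rw [integral_congr_ae h1, integral_indicator measurableSet_Ioc,
    Measure.restrict_restrict measurableSet_Ioc,
    inter_eq_left.2 (show Ioc ‖a‖ ‖b‖ ⊆ Ioi (0 : ℝ) from fun r hr => ha'.trans hr.1), integral_complex_ofReal,
    integral_const_mul, ← intervalIntegral.integral_of_le hab,
    integral_inv_of_pos ha' (ha'.trans_le hab)]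

theorem inner_biotSavartKernel_sub (p a b : Plane) (z : ℂ) :
    inner ℝ (biotSavartKernel (p + complexToPlane z - p))
      (biotSavartKernel (p + complexToPlane z - a) - biotSavartKernel (p + complexToPlane z - b)) =
    1 / (4 * Real.pi ^ 2) * (vortexDensity (complexToPlane.symm (a - p))
      (complexToPlane.symm (b - p)) z).re := by
  have h : ∀ c : Plane, p + complexToPlane z - c =
      complexToPlane (z - complexToPlane.symm (c - p)) := fun c => by
    rw [map_sub, LinearIsometryEquiv.apply_symm_apply]; abel
  rw [h p, h a, h b, inner_sub_right, inner_biotSavartKernel, inner_biotSavartKernel, sub_self,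
    map_zero, sub_zero, vortexDensity, mul_sub, Complex.sub_re, mul_sub]

theorem measurePreserving_add_complexToPlane (p : Plane) :
    MeasurePreserving fun z => p + complexToPlane z :=
  (measurePreserving_add_left volume p).comp complexToPlane.measurePreserving

theorem measurableEmbedding_add_complexToPlane (p : Plane) :
    MeasurableEmbedding fun z => p + complexToPlane z :=
  (measurableEmbedding_addLeft p).comp complexToPlane.toHomeomorph.measurableEmbedding

theorem integrable_inner_biotSavartKernel {p a b : Plane} (hpa : p ≠ a) (hpb : p ≠ b)
    (hab : a ≠ b) : Integrable fun x => inner ℝ (biotSavartKernel (x - p))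
      (biotSavartKernel (x - a) - biotSavartKernel (x - b)) := by
  rw [← (measurePreserving_add_complexToPlane p).integrable_comp_emb
    (measurableEmbedding_add_complexToPlane p)]
  simp only [Function.comp_def, inner_biotSavartKernel_sub]
  refine ((integrable_vortexDensity ?_ ?_ ?_).re).const_mul _
  · simpa [sub_eq_zero] using hpa.symm
  · simpa [sub_eq_zero] using hpb.symm
  · simpa using hab

theorem integral_inner_biotSavartKernel {p a b : Plane} (hpa : p ≠ a) (hab : a ≠ b)
    (h : ‖a - p‖ ≤ ‖b - p‖) : ∫ x, inner ℝ (biotSavartKernel (x - p))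
      (biotSavartKernel (x - a) - biotSavartKernel (x - b)) =
      1 / (2 * Real.pi) * Real.log (‖b - p‖ / ‖a - p‖) := by
  rw [← (measurePreserving_add_complexToPlane p).integral_comp
    (measurableEmbedding_add_complexToPlane p)]
  simp only [inner_biotSavartKernel_sub]
  have ha : complexToPlane.symm (a - p) ≠ 0 := by simpa [sub_eq_zero] using hpa.symm
  have hne : complexToPlane.symm (a - p) ≠ complexToPlane.symm (b - p) := by simpa using hab
  have hle : ‖complexToPlane.symm (a - p)‖ ≤ ‖complexToPlane.symm (b - p)‖ := by
    rwa [LinearIsometryEquiv.norm_map, LinearIsometryEquiv.norm_map]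
  have hb : complexToPlane.symm (b - p) ≠ 0 :=
    norm_pos_iff.1 ((norm_pos_iff.2 ha).trans_le hle)
  have hre := integral_re (integrable_vortexDensity ha hb hne)
  simp only [RCLike.re_eq_complex_re] at hre
  rw [integral_const_mul, hre, integral_vortexDensity ha hne hle, Complex.ofReal_re]
  simp only [LinearIsometryEquiv.norm_map]
  have := Real.pi_pos.ne'
  field_simp
  norm_num

/-! ### The reflection and the kernel of odd vorticities -/

theorem reflect_apply_zero (x : Plane) : reflect x 0 = x 0 := by simp [reflect]

theorem reflect_apply_one (x : Plane) : reflect x 1 = -x 1 := by simp [reflect]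

theorem reflect_reflect (x : Plane) : reflect (reflect x) = x :=
  plane_ext (by simp [reflect]) (by simp [reflect])

theorem norm_sub_reflect_sq (x y : Plane) :
    ‖x - reflect y‖ ^ 2 = ‖x - y‖ ^ 2 + 4 * x 1 * y 1 := by
  rw [norm_sub_sq_eq, norm_sub_sq_eq, reflect_apply_zero, reflect_apply_one]; ring

theorem norm_reflect_sub_reflect (x y : Plane) : ‖reflect x - reflect y‖ = ‖x - y‖ := by
  rw [← sq_eq_sq₀ (norm_nonneg _) (norm_nonneg _), norm_sub_sq_eq, norm_sub_sq_eq]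
  simp only [reflect_apply_zero, reflect_apply_one]
  ring

theorem norm_reflect_sub (x y : Plane) : ‖reflect x - y‖ = ‖x - reflect y‖ := by
  rw [← norm_reflect_sub_reflect x, reflect_reflect]

theorem reflect_ne {x y : Plane} (hx : x ∈ upperHalf) (hy : y ∈ upperHalf) : x ≠ reflect y := by
  intro h
  have h1 : x 1 = -y 1 := by rw [h, reflect_apply_one]
  have hx : 0 < x 1 := hx
  have hy : 0 < y 1 := hy
  linarith

theorem green_eq_log {x y : Plane} (hxy : x ≠ y) :
    green x y = 1 / (2 * Real.pi) * Real.log (‖x - reflect y‖ / ‖x - y‖) := by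
  have hn : 0 < ‖x - y‖ := norm_pos_iff.2 (sub_ne_zero.2 hxy)
  have h : 1 + 4 * x 1 * y 1 / ‖x - y‖ ^ 2 = (‖x - reflect y‖ / ‖x - y‖) ^ 2 := by
    rw [div_pow, norm_sub_reflect_sq]; field_simp
  rw [green, h, Real.log_pow]
  have := Real.pi_pos.ne'
  push_cast
  field_simp
  norm_num

theorem norm_sub_le_norm_sub_reflect {x y : Plane} (hx : x ∈ upperHalf) (hy : y ∈ upperHalf) :
    ‖x - y‖ ≤ ‖x - reflect y‖ := by
  have hxy : 0 < x 1 * y 1 := mul_pos hx hy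
  rw [← sq_le_sq₀ (norm_nonneg _) (norm_nonneg _), norm_sub_reflect_sq]
  linarith

/-- The velocity kernel of odd vorticities. -/
def oddKernel (x y : Plane) : Plane := biotSavartKernel (x - y) - biotSavartKernel (x - reflect y)

theorem measurable_reflect : Measurable reflect := by
  have : reflect = fun x => (MeasurableEquiv.toLp 2 (Fin 2 → ℝ)) ![x 0, -x 1] := rfl
  rw [this]
  refine (MeasurableEquiv.measurable _).comp (measurable_pi_iff.2 fun i => ?_)
  fin_cases i <;> simp <;> fun_prop

theorem measurable_oddKernel : Measurable fun p : Plane × Plane => oddKernel p.1 p.2 := by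
  unfold oddKernel
  have := measurable_reflect
  fun_prop

theorem measurable_oddKernel_right (x : Plane) : Measurable (oddKernel x) := by
  unfold oddKernel
  have := measurable_reflect
  fun_prop

/-- A product of two single kernels decays only like `|x|⁻²`, which is not integrable at infinity.
Each single vortex is therefore grouped with a whole pair. -/
theorem inner_oddKernel (x y z : Plane) : inner ℝ (oddKernel x y) (oddKernel x z) =
    inner ℝ (biotSavartKernel (x - y)) (biotSavartKernel (x - z) - biotSavartKernel (x - reflect z))
    + inner ℝ (biotSavartKernel (x - reflect y))
      (biotSavartKernel (x - reflect z) - biotSavartKernel (x - z)) := by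
  rw [oddKernel, inner_sub_left, oddKernel,
    ← neg_sub (biotSavartKernel (x - z)) (biotSavartKernel (x - reflect z)), inner_neg_right]
  ring

/-- By reflection both groups give the same logarithm of `|y - z*| / |y - z|`, with `z*` the
reflected point, and each equals the Green function. -/
theorem integral_inner_oddKernel {y z : Plane} (hy : y ∈ upperHalf) (hz : z ∈ upperHalf)
    (hyz : y ≠ z) : ∫ x, inner ℝ (oddKernel x y) (oddKernel x z) = 2 * green y z := by
  have h1 : reflect y ≠ reflect z := fun h => hyz (by
    rw [← reflect_reflect y, h, reflect_reflect])
  have h2 := reflect_ne hz hy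
  have h3 := reflect_ne hy hz
  have h4 := reflect_ne hz hz
  simp_rw [inner_oddKernel]
  rw [integral_add (integrable_inner_biotSavartKernel hyz h3 h4)
    (integrable_inner_biotSavartKernel h1 h2.symm h4.symm),
    integral_inner_biotSavartKernel hyz h4 (by
      rw [norm_sub_rev, norm_sub_rev _ y]; exact norm_sub_le_norm_sub_reflect hy hz),
    integral_inner_biotSavartKernel h1 h4.symm (by
      rw [norm_reflect_sub_reflect]; exact norm_sub_le_norm_sub_reflect hz hy),
    green_eq_log hyz, norm_reflect_sub_reflect, norm_sub_rev _ y, norm_sub_rev _ y,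
    norm_sub_rev z (reflect y), norm_reflect_sub]
  ring

end

section

/-! ### The kinetic energy of an odd patch -/

open Filter Topology

/-- The reflection in the horizontal axis as a linear isometry. -/
def reflectEquiv : Plane ≃ₗᵢ[ℝ] Plane :=
  complexToPlane.symm.trans (Complex.conjLIE.trans complexToPlane)

theorem reflectEquiv_apply (x : Plane) : reflectEquiv x = reflect x := by
  obtain ⟨z, rfl⟩ := exists_complexToPlane x
  refine plane_ext ?_ ?_
  · simp [reflectEquiv, reflect, complexToPlane_apply_zero]
  · simp [reflectEquiv, reflect, complexToPlane_apply_one]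

theorem measurePreserving_reflect : MeasurePreserving reflect := by
  have h : (reflectEquiv : Plane → Plane) = reflect := funext reflectEquiv_apply
  exact h ▸ reflectEquiv.measurePreserving

theorem measurableEmbedding_reflect : MeasurableEmbedding reflect := by
  have h : (reflectEquiv : Plane → Plane) = reflect := funext reflectEquiv_apply
  exact h ▸ reflectEquiv.toHomeomorph.measurableEmbedding

theorem norm_reflect (x : Plane) : ‖reflect x‖ = ‖x‖ := by
  rw [← reflectEquiv_apply, LinearIsometryEquiv.norm_map]

section

variable {E : Type*} [NormedAddCommGroup E] [NormedSpace ℝ E] {A : Set Plane} {f : Plane → E}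

theorem integral_oddPatch_smul (hA : MeasurableSet A) (h1 : IntegrableOn f A)
    (h2 : IntegrableOn (fun y => f (reflect y)) A) :
    ∫ y, oddPatch A y • f y = ∫ y in A, (f y - f (reflect y)) := by
  have hA' : MeasurableSet (reflect ⁻¹' A) := measurable_reflect hA
  have h3 : IntegrableOn f (reflect ⁻¹' A) := by
    rw [← measurePreserving_reflect.integrableOn_comp_preimage measurableEmbedding_reflect] at h2
    have h4 : (f ∘ reflect) ∘ reflect = f := funext fun x => by simp [reflect_reflect]
    exact h4 ▸ h2
  have hpt : ∀ y, oddPatch A y • f y = A.indicator f y - (reflect ⁻¹' A).indicator f y := by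
    intro y
    rw [oddPatch, sub_smul]
    congr 1
    · by_cases hy : y ∈ A <;> simp [hy]
    · by_cases hy : y ∈ reflect ⁻¹' A
      · rw [indicator_of_mem hy, indicator_of_mem hy, one_smul]
      · rw [indicator_of_notMem hy, indicator_of_notMem hy, zero_smul]
  simp_rw [hpt]
  rw [integral_sub ((integrable_indicator_iff hA).2 h1) ((integrable_indicator_iff hA').2 h3),
    integral_indicator hA, integral_indicator hA', integral_sub h1 h2]
  congr 1
  have h := measurePreserving_reflect.setIntegral_preimage_emb measurableEmbedding_reflect
    (fun y => f (reflect y)) A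
  simp only [reflect_reflect] at h
  exact h

end

theorem norm_oddKernel {x y : Plane} (h1 : x ≠ y) (h2 : x ≠ reflect y) (hy : y ∈ upperHalf) :
    ‖oddKernel x y‖ = y 1 / (Real.pi * (‖x - y‖ * ‖x - reflect y‖)) := by
  have hy : 0 < y 1 := hy
  have hd : ‖x - y - (x - reflect y)‖ = 2 * y 1 := by
    rw [sub_sub_sub_cancel_left, ← sq_eq_sq₀ (norm_nonneg _) (by positivity), norm_sub_sq_eq,
      reflect_apply_zero, reflect_apply_one]
    ring
  have e1 : 0 < ‖x - y‖ := norm_pos_iff.2 (sub_ne_zero.2 h1)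
  have e2 : 0 < ‖x - reflect y‖ := norm_pos_iff.2 (sub_ne_zero.2 h2)
  rw [oddKernel, norm_biotSavartKernel_sub (sub_ne_zero.2 h1) (sub_ne_zero.2 h2), hd]
  field_simp

theorem enorm_biotSavartKernel_le (x y : Plane) (hxy : x ≠ y) :
    ‖biotSavartKernel (x - y)‖ₑ ≤ ‖x - y‖ₑ⁻¹ := by
  rw [enorm_inv_eq_ofReal hxy, ← ofReal_norm, norm_biotSavartKernel, one_div ‖x - y‖]
  refine ENNReal.ofReal_le_ofReal (mul_le_of_le_one_left (by positivity) ?_)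
  rw [div_le_one (by positivity)]
  linarith [Real.pi_gt_three]

section

variable {A : Set Plane} {R : ℝ}

theorem subset_ball_of_norm_le (hAR : A ⊆ Metric.ball 0 R) {x : Plane}
    (hx : ‖x‖ ≤ 2 * R) : A ⊆ Metric.ball x (3 * R) := by
  intro y hy
  have := mem_ball_zero_iff.1 (hAR hy)
  rw [Metric.mem_ball, dist_eq_norm]
  linarith [norm_sub_le y x]

theorem lintegral_oddKernel_le_of_norm_le (hR : 0 ≤ R) (hAR : A ⊆ Metric.ball 0 R) {x : Plane}
    (hx : ‖x‖ ≤ 2 * R) :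
    ∫⁻ y in A, ‖oddKernel x y‖ₑ ≤ ENNReal.ofReal (12 * Real.pi * R) := by
  have h1 : ∀ z : Plane, ‖z‖ ≤ 2 * R →
      ∫⁻ y in A, ‖z - y‖ₑ⁻¹ ≤ ENNReal.ofReal (6 * Real.pi * R) := by
    intro z hz
    refine (lintegral_mono_set (subset_ball_of_norm_le hAR hz)).trans ?_
    rw [lintegral_ball_inv_norm z (by positivity)]
    exact ENNReal.ofReal_le_ofReal (le_of_eq (by ring))
  have hae : ∀ᵐ y ∂volume.restrict A, ‖oddKernel x y‖ₑ ≤ ‖x - y‖ₑ⁻¹ + ‖reflect x - y‖ₑ⁻¹ := by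
    filter_upwards [Measure.ae_ne (volume.restrict A) x,
      Measure.ae_ne (volume.restrict A) (reflect x)] with y hy1 hy2
    have h2 : x ≠ reflect y := fun h => hy2 (by rw [h, reflect_reflect])
    have h3 : ‖x - reflect y‖ₑ = ‖reflect x - y‖ₑ := by
      rw [← ofReal_norm, ← ofReal_norm, norm_reflect_sub]
    rw [oddKernel, ← h3]
    exact (enorm_sub_le).trans (add_le_add (enorm_biotSavartKernel_le x y hy1.symm)
      (enorm_biotSavartKernel_le x _ h2))
  refine (lintegral_mono_ae hae).trans ?_
  rw [lintegral_add_left (by fun_prop)]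
  refine (add_le_add (h1 x hx) (h1 (reflect x) (by rwa [norm_reflect]))).trans ?_
  rw [← ENNReal.ofReal_add (by positivity) (by positivity)]
  exact ENNReal.ofReal_le_ofReal (le_of_eq (by ring))

theorem lintegral_oddKernel_le_of_lt_norm (hR : 0 < R) (hAU : A ⊆ upperHalf) (hA : MeasurableSet A)
    (hAR : A ⊆ Metric.ball 0 R) {x : Plane} (hx : 2 * R < ‖x‖) :
    ∫⁻ y in A, ‖oddKernel x y‖ₑ ≤ ENNReal.ofReal (4 * R / ‖x‖ ^ 2) * volume A := by
  rw [← setLIntegral_const]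
  refine setLIntegral_mono' hA fun y hy => ?_
  have hy0 : 0 < y 1 := hAU hy
  have hyR := mem_ball_zero_iff.1 (hAR hy)
  have hx0 : 0 < ‖x‖ := by linarith
  have e1 : ‖x‖ / 2 ≤ ‖x - y‖ := by linarith [norm_sub_norm_le x y]
  have e2 : ‖x‖ / 2 ≤ ‖x - reflect y‖ := by
    have := norm_sub_norm_le x (reflect y)
    rw [norm_reflect] at this
    linarith
  have n1 : x ≠ y := fun h => by rw [h] at hx; linarith
  have n2 : x ≠ reflect y := fun h => by rw [h, norm_reflect] at hx; linarith
  have hy1 : y 1 ≤ R := (le_abs_self _).trans ((abs_coord_le y 1).trans hyR.le)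
  rw [← ofReal_norm, norm_oddKernel n1 n2 (hAU hy)]
  refine ENNReal.ofReal_le_ofReal ?_
  calc y 1 / (Real.pi * (‖x - y‖ * ‖x - reflect y‖))
      ≤ R / (1 * (‖x‖ / 2 * (‖x‖ / 2))) := by
        gcongr
        linarith [Real.pi_gt_three]
    _ = 4 * R / ‖x‖ ^ 2 := by field_simp; norm_num

/-- For bounded `x` the singularities are integrable; for large `x` the vortex pairs act as dipoles
and decay like `|x|⁻²`. The square is then integrable over the plane, which is what Fubini needs in
the kinetic energy. -/
theorem exists_lintegral_oddKernel_le (hAU : A ⊆ upperHalf) (hA : MeasurableSet A)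
    (hbd : Bornology.IsBounded A) : ∃ D : ℝ, ∀ x, ∫⁻ y in A, ‖oddKernel x y‖ₑ ≤
      ENNReal.ofReal D * ENNReal.ofReal ((1 + ‖x‖) ^ (-2 : ℝ)) := by
  obtain ⟨R, hR1, hAR⟩ := hbd.subset_ball_lt 1 (0 : Plane)
  have hR : 0 < R := by linarith
  have hvol : volume A ≠ ∞ := hbd.measure_lt_top.ne
  set V := (volume A).toReal with hV
  have hV0 : 0 ≤ V := ENNReal.toReal_nonneg
  refine ⟨12 * Real.pi * R * (1 + 2 * R) ^ 2 + 16 * R * V, fun x => ?_⟩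
  have hX : 0 < 1 + ‖x‖ := by positivity
  rw [← ENNReal.ofReal_mul (by positivity), Real.rpow_neg hX.le, Real.rpow_two]
  rcases le_or_gt ‖x‖ (2 * R) with h | h
  · refine (lintegral_oddKernel_le_of_norm_le hR.le hAR h).trans (ENNReal.ofReal_le_ofReal ?_)
    rw [← div_eq_mul_inv, le_div_iff₀ (by positivity)]
    have : 12 * Real.pi * R * (1 + ‖x‖) ^ 2 ≤ 12 * Real.pi * R * (1 + 2 * R) ^ 2 := by gcongr
    have : 0 ≤ 16 * R * V := by positivity
    linarith
  · refine (lintegral_oddKernel_le_of_lt_norm hR hAU hA hAR h).trans ?_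
    rw [← ENNReal.ofReal_toReal hvol, ← ENNReal.ofReal_mul (by positivity)]
    refine ENNReal.ofReal_le_ofReal ?_
    have hx0 : 0 < ‖x‖ := by linarith
    rw [← div_eq_mul_inv, le_div_iff₀ (by positivity), ← hV]
    have h1 : (1 + ‖x‖) ^ 2 ≤ 4 * ‖x‖ ^ 2 := by nlinarith
    calc 4 * R / ‖x‖ ^ 2 * V * (1 + ‖x‖) ^ 2 ≤ 4 * R / ‖x‖ ^ 2 * V * (4 * ‖x‖ ^ 2) := by gcongr
      _ = 16 * R * V := by field_simp; ring
      _ ≤ _ := by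
        have : 0 ≤ 12 * Real.pi * R * (1 + 2 * R) ^ 2 := by positivity
        linarith

theorem lintegral_sq_lintegral_oddKernel_lt_top (hAU : A ⊆ upperHalf) (hA : MeasurableSet A)
    (hbd : Bornology.IsBounded A) : ∫⁻ x, (∫⁻ y in A, ‖oddKernel x y‖ₑ) ^ 2 < ∞ := by
  obtain ⟨D, hD⟩ := exists_lintegral_oddKernel_le hAU hA hbd
  refine lt_of_le_of_lt (lintegral_mono fun x => pow_le_pow_left₀ bot_le (hD x) 2) ?_
  have h : ∀ x : Plane, (ENNReal.ofReal D * ENNReal.ofReal ((1 + ‖x‖) ^ (-2 : ℝ))) ^ 2 =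
      ENNReal.ofReal D ^ 2 * ENNReal.ofReal ((1 + ‖x‖) ^ (-4 : ℝ)) := fun x => by
    rw [mul_pow, ← ENNReal.ofReal_pow (p := (1 + ‖x‖) ^ (-2 : ℝ)) (by positivity),
      ← Real.rpow_natCast ((1 + ‖x‖) ^ (-2 : ℝ)) 2, ← Real.rpow_mul (by positivity)]
    norm_num
  simp_rw [h]
  rw [lintegral_const_mul' _ _ (by simp)]
  exact ENNReal.mul_lt_top (by simp) (finite_integral_one_add_norm (by simp; norm_num))

theorem integrableOn_biotSavartKernel (hbd : Bornology.IsBounded A) (x : Plane) :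
    IntegrableOn (fun y => biotSavartKernel (x - y)) A := by
  obtain ⟨R, hR⟩ := hbd.subset_ball (0 : Plane)
  refine Integrable.mono' (((integrableOn_ball_inv_norm x R).mono_set hR).const_mul
    (1 / (2 * Real.pi))) (by fun_prop : Measurable fun y => biotSavartKernel (x - y)).aestronglyMeasurable
    (Eventually.of_forall fun y => ?_)
  rw [norm_biotSavartKernel, norm_sub_rev]

theorem integrableOn_biotSavartKernel_reflect (hbd : Bornology.IsBounded A) (x : Plane) :
    IntegrableOn (fun y => biotSavartKernel (x - reflect y)) A := by
  obtain ⟨R, hR⟩ := hbd.subset_ball (0 : Plane)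
  have hm := measurable_reflect
  refine Integrable.mono' (((integrableOn_ball_inv_norm (reflect x) R).mono_set hR).const_mul
    (1 / (2 * Real.pi))) (by fun_prop :
      Measurable fun y => biotSavartKernel (x - reflect y)).aestronglyMeasurable
    (Eventually.of_forall fun y => ?_)
  rw [norm_biotSavartKernel, norm_sub_rev y, norm_reflect_sub]

theorem velocity_oddPatch (hA : MeasurableSet A) (hbd : Bornology.IsBounded A) (x : Plane) :
    velocity (oddPatch A) x = ∫ y in A, oddKernel x y :=
  integral_oddPatch_smul hA (integrableOn_biotSavartKernel hbd x)
    (integrableOn_biotSavartKernel_reflect hbd x)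

theorem integrableOn_oddKernel (hbd : Bornology.IsBounded A) (x : Plane) :
    IntegrableOn (oddKernel x) A :=
  (integrableOn_biotSavartKernel hbd x).sub (integrableOn_biotSavartKernel_reflect hbd x)

theorem norm_velocity_sq (hA : MeasurableSet A) (hbd : Bornology.IsBounded A) (x : Plane) :
    ‖velocity (oddPatch A) x‖ ^ 2 = ∫ p, inner ℝ (oddKernel x p.1) (oddKernel x p.2)
      ∂((volume.restrict A).prod (volume.restrict A)) := by
  have hi := integrableOn_oddKernel hbd x
  rw [velocity_oddPatch hA hbd, ← real_inner_self_eq_norm_sq]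
  have h2 : Integrable (fun p : Plane × Plane => inner ℝ (oddKernel x p.1) (oddKernel x p.2))
      ((volume.restrict A).prod (volume.restrict A)) := by
    have hK := measurable_oddKernel_right x
    refine (Integrable.mul_prod (f := fun y => ‖oddKernel x y‖) (g := fun y => ‖oddKernel x y‖)
      hi.norm hi.norm).mono' ?_ (Eventually.of_forall fun p => norm_inner_le_norm _ _)
    exact ((hK.comp measurable_fst).inner (hK.comp measurable_snd)).aestronglyMeasurable
  rw [integral_prod _ h2]
  have h3 : ∀ y, ∫ z in A, inner ℝ (oddKernel x y) (oddKernel x z) =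
      inner ℝ (oddKernel x y) (∫ z in A, oddKernel x z) := fun y => integral_inner hi _
  simp_rw [h3]
  have h4 : ∀ y, inner ℝ (oddKernel x y) (∫ z in A, oddKernel x z) =
      inner ℝ (∫ z in A, oddKernel x z) (oddKernel x y) := fun y => real_inner_comm _ _
  simp_rw [h4]
  exact (integral_inner hi _).symm

theorem integrable_inner_oddKernel (hAU : A ⊆ upperHalf) (hA : MeasurableSet A)
    (hbd : Bornology.IsBounded A) :
    Integrable (fun q : Plane × (Plane × Plane) => inner ℝ (oddKernel q.1 q.2.1)
      (oddKernel q.1 q.2.2)) (volume.prod ((volume.restrict A).prod (volume.restrict A))) := by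
  have h1 : Measurable fun q : Plane × (Plane × Plane) => oddKernel q.1 q.2.1 :=
    measurable_oddKernel.comp (g := fun p : Plane × Plane => oddKernel p.1 p.2)
      (f := fun q : Plane × (Plane × Plane) => (q.1, q.2.1)) (by fun_prop)
  have h2 : Measurable fun q : Plane × (Plane × Plane) => oddKernel q.1 q.2.2 :=
    measurable_oddKernel.comp (g := fun p : Plane × Plane => oddKernel p.1 p.2)
      (f := fun q : Plane × (Plane × Plane) => (q.1, q.2.2)) (by fun_prop)
  have hm : Measurable fun q : Plane × (Plane × Plane) => ‖oddKernel q.1 q.2.1‖ₑ *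
    ‖oddKernel q.1 q.2.2‖ₑ := by fun_prop
  refine ⟨(h1.inner h2).aestronglyMeasurable, ?_⟩
  refine lt_of_le_of_lt (lintegral_mono (g := fun q : Plane × (Plane × Plane) =>
    ‖oddKernel q.1 q.2.1‖ₑ * ‖oddKernel q.1 q.2.2‖ₑ) fun q => ?_) ?_
  · simp only [← ofReal_norm]
    rw [← ENNReal.ofReal_mul (norm_nonneg _)]
    exact ENNReal.ofReal_le_ofReal (norm_inner_le_norm _ _)
  · rw [lintegral_prod _ hm.aemeasurable]
    refine lt_of_le_of_lt (le_of_eq ?_) (lintegral_sq_lintegral_oddKernel_lt_top hAU hA hbd)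
    refine lintegral_congr fun x => ?_
    have hKx := measurable_oddKernel_right x
    have := lintegral_prod_mul (μ := volume.restrict A) (ν := volume.restrict A)
      (f := fun y => ‖oddKernel x y‖ₑ) (g := fun y => ‖oddKernel x y‖ₑ)
      hKx.enorm.aemeasurable hKx.enorm.aemeasurable
    rw [this, sq]

theorem ae_fst_ne_snd (A : Set Plane) :
    ∀ᵐ p ∂((volume.restrict A).prod (volume.restrict A)), p.1 ≠ p.2 := by
  have hm : MeasurableSet {p : Plane × Plane | p.1 = p.2} :=
    measurableSet_eq_fun measurable_fst measurable_snd
  refine measure_eq_zero_iff_ae_notMem.1 ((Measure.measure_prod_null hm).2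
    (Eventually.of_forall fun x => ?_))
  have : Prod.mk x ⁻¹' {p : Plane × Plane | p.1 = p.2} = {x} := by
    ext y; exact eq_comm
  simp only [this, Pi.zero_apply, measure_singleton]

theorem interaction_indicator (hA : MeasurableSet A) (hAU : A ⊆ upperHalf) :
    interaction (A.indicator 1) (A.indicator 1) =
      ∫⁻ p, greenKernel p.1 p.2 ∂((volume.restrict A).prod (volume.restrict A)) := by
  have h : ∀ f : Plane → ℝ≥0∞, ∫⁻ x in upperHalf, f x * A.indicator 1 x = ∫⁻ x in A, f x := by
    intro f
    have : ∀ x, f x * A.indicator 1 x = A.indicator f x := fun x => by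
      by_cases hx : x ∈ A <;> simp [hx]
    simp_rw [this]
    rw [lintegral_indicator hA, Measure.restrict_restrict hA, inter_eq_left.2 hAU]
  rw [lintegral_prod _ measurable_greenKernel.aemeasurable, interaction, h]
  exact lintegral_congr fun x => h _

/-- The square of the velocity is a double integral over the patch. Exchanging it with the integral
over the plane leaves twice the Green function for each pair of distinct points. -/
theorem kineticEnergy_oddPatch (hAU : A ⊆ upperHalf) (hA : MeasurableSet A)
    (hbd : Bornology.IsBounded A) :
    kineticEnergy (oddPatch A) = 2 * interaction (A.indicator 1) (A.indicator 1) := by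
  have hint := integrable_inner_oddKernel hAU hA hbd
  have hsq : ∀ x, ‖velocity (oddPatch A) x‖ₑ ^ 2 =
      ENNReal.ofReal (∫ p, inner ℝ (oddKernel x p.1) (oddKernel x p.2)
      ∂((volume.restrict A).prod (volume.restrict A))) := fun x => by
    rw [← norm_velocity_sq hA hbd, ENNReal.ofReal_pow (norm_nonneg _), ofReal_norm]
  have hint1 := hint.integral_prod_left
  rw [kineticEnergy]
  simp_rw [hsq]
  rw [← ofReal_integral_eq_lintegral_ofReal hint1 (Eventually.of_forall fun x => by
      simp only [Pi.zero_apply]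
      rw [← norm_velocity_sq hA hbd]
      positivity),
    integral_integral_swap hint]
  have hae : ∀ᵐ p ∂((volume.restrict A).prod (volume.restrict A)),
      ∫ x, inner ℝ (oddKernel x p.1) (oddKernel x p.2) = 2 * green p.1 p.2 ∧
      0 ≤ 2 * green p.1 p.2 ∧
      ENNReal.ofReal (2 * green p.1 p.2) = 2 * greenKernel p.1 p.2 := by
    have hmem : ∀ᵐ p ∂((volume.restrict A).prod (volume.restrict A)), p ∈ A ×ˢ A := by
      rw [Measure.prod_restrict]
      exact ae_restrict_mem (hA.prod hA)
    filter_upwards [ae_fst_ne_snd A, hmem] with p hne hp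
    refine ⟨integral_inner_oddKernel (hAU hp.1) (hAU hp.2) hne,
      mul_nonneg (by norm_num) (green_nonneg (hAU hp.1) (hAU hp.2)), ?_⟩
    rw [greenKernel_of_ne hne, ENNReal.ofReal_mul (by norm_num), ENNReal.ofReal_ofNat]
  have hint2 : Integrable (fun p : Plane × Plane => 2 * green p.1 p.2)
      ((volume.restrict A).prod (volume.restrict A)) :=
    hint.integral_prod_right.congr (hae.mono fun p hp => hp.1)
  rw [integral_congr_ae (hae.mono fun p hp => hp.1),
    ofReal_integral_eq_lintegral_ofReal hint2 (hae.mono fun p hp => hp.2.1),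
    lintegral_congr_ae (hae.mono fun p hp => hp.2.2),
    lintegral_const_mul _ measurable_greenKernel, interaction_indicator hA hAU]

end

/-! ### The stream function of an odd patch -/

theorem norm_log_le_inv {t : ℝ} (ht : 0 < t) : ‖Real.log t‖ ≤ t⁻¹ + t := by
  have h1 := Real.log_le_sub_one_of_pos ht
  have h2 := Real.log_le_sub_one_of_pos (inv_pos.2 ht)
  rw [Real.log_inv] at h2
  rw [Real.norm_eq_abs, abs_le]
  have := inv_pos.2 ht
  constructor <;> linarith

theorem integrableOn_log_norm {A : Set Plane} (hbd : Bornology.IsBounded A) (x : Plane) :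
    IntegrableOn (fun y => -(1 / (2 * Real.pi) * Real.log ‖x - y‖)) A := by
  obtain ⟨R, hR⟩ := hbd.subset_ball (0 : Plane)
  refine IntegrableOn.mono_set ?_ hR
  refine ((Integrable.const_mul ?_ (1 / (2 * Real.pi))).neg : Integrable _ _)
  have h1 : IntegrableOn (fun y : Plane => ‖y - x‖ + ‖y - x‖⁻¹) (Metric.ball 0 R) := by
    refine IntegrableOn.add ?_ (integrableOn_ball_inv_norm x R)
    exact ((by fun_prop : Continuous fun y : Plane => ‖y - x‖).continuousOn.integrableOn_compact
      (isCompact_closedBall 0 R)).mono_set Metric.ball_subset_closedBall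
  refine Integrable.mono' h1 (by fun_prop : Measurable fun y : Plane =>
    Real.log ‖x - y‖).aestronglyMeasurable ?_
  filter_upwards [Measure.ae_ne _ x] with y hy
  have := norm_log_le_inv (norm_pos_iff.2 (sub_ne_zero.2 hy.symm))
  rw [norm_sub_rev y]
  linarith

/-- Folding the lower half onto the upper by reflection turns the logarithmic kernel into the
difference of logarithms that defines the Green function. -/
theorem stream_oddPatch {A : Set Plane} (hAU : A ⊆ upperHalf) (hA : MeasurableSet A)
    (hbd : Bornology.IsBounded A) {x : Plane} (hx : x ∈ upperHalf) :
    stream (oddPatch A) x = ∫ y in A, green x y := by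
  have hrefl : IntegrableOn (fun y => -(1 / (2 * Real.pi) * Real.log ‖x - reflect y‖)) A := by
    refine (integrableOn_log_norm hbd (reflect x)).congr_fun (fun y _ => ?_) hA
    simp only [norm_reflect_sub]
  have h := integral_oddPatch_smul hA (integrableOn_log_norm hbd x) hrefl
  simp only [smul_eq_mul] at h
  rw [stream]
  simp_rw [mul_comm _ (oddPatch A _)]
  rw [h]
  refine integral_congr_ae ?_
  filter_upwards [ae_restrict_mem hA, Measure.ae_ne _ x] with y hy hne
  have n1 : ‖x - y‖ ≠ 0 := norm_ne_zero_iff.2 (sub_ne_zero.2 hne.symm)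
  have n2 : ‖x - reflect y‖ ≠ 0 := norm_ne_zero_iff.2 (sub_ne_zero.2 (reflect_ne hx (hAU hy)))
  rw [green_eq_log hne.symm, Real.log_div n2 n1]
  ring

end

section

/-! ### Real-valued vorticities and extended densities -/

open Filter Topology

variable {ω : Plane → ℝ} {θ : Plane → ℝ≥0∞} {A : Set Plane}

theorem toReal_indicator_one (A : Set Plane) (x : Plane) :
    (A.indicator (1 : Plane → ℝ≥0∞) x).toReal = A.indicator (fun _ => (1 : ℝ)) x := by
  by_cases hx : x ∈ A <;> simp [hx]

theorem indicator_one_le_one (A : Set Plane) (x : Plane) : A.indicator (1 : Plane → ℝ≥0∞) x ≤ 1 :=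
  indicator_le_self' (fun _ _ => zero_le) x

theorem measurable_indicator_one (hA : MeasurableSet A) :
    Measurable (A.indicator (1 : Plane → ℝ≥0∞)) := measurable_one.indicator hA

theorem setLIntegral_indicator_one (hA : MeasurableSet A) (hAU : A ⊆ upperHalf) :
    ∫⁻ x in upperHalf, A.indicator (1 : Plane → ℝ≥0∞) x = volume A := by
  rw [lintegral_indicator_one hA, Measure.restrict_apply hA, inter_eq_left.2 hAU]

theorem imp_indicator_one (hA : MeasurableSet A) (hAU : A ⊆ upperHalf) :
    imp (A.indicator 1) = ∫⁻ x in A, ENNReal.ofReal (x 1) := by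
  have h : ∀ x : Plane, ENNReal.ofReal (x 1) * A.indicator 1 x =
      A.indicator (fun x => ENNReal.ofReal (x 1)) x := fun x => by
    by_cases hx : x ∈ A <;> simp [hx]
  rw [imp]
  simp_rw [h]
  rw [lintegral_indicator hA, Measure.restrict_restrict hA, inter_eq_left.2 hAU]

theorem ae_enorm_eq (h1 : ∀ x, θ x ≤ 1)
    (hω : ω =ᵐ[volume.restrict upperHalf] fun x => (θ x).toReal) :
    ∀ᵐ x ∂volume.restrict upperHalf, ‖ω x‖ₑ = θ x := by
  filter_upwards [hω] with x hx
  rw [hx, Real.enorm_of_nonneg ENNReal.toReal_nonneg,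
    ENNReal.ofReal_toReal (ne_top_of_le_ne_top ENNReal.one_ne_top (h1 x))]

theorem impulse_eq_imp (h1 : ∀ x, θ x ≤ 1)
    (hω : ω =ᵐ[volume.restrict upperHalf] fun x => (θ x).toReal) :
    impulse ω = imp θ :=
  lintegral_congr_ae ((ae_enorm_eq h1 hω).mono fun x hx => by simp only [hx])

theorem mass_eq_lintegral (h1 : ∀ x, θ x ≤ 1)
    (hω : ω =ᵐ[volume.restrict upperHalf] fun x => (θ x).toReal) :
    mass ω = ∫⁻ x in upperHalf, θ x :=
  lintegral_congr_ae (ae_enorm_eq h1 hω)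

theorem energy_eq_interaction (hθ : Measurable θ) (h1 : ∀ x, θ x ≤ 1)
    (hω : ω =ᵐ[volume.restrict upperHalf] fun x => (θ x).toReal) :
    energy ω = 1 / 2 * interaction θ θ := by
  have hfin : ∀ x, θ x ≠ ∞ := fun x => ne_top_of_le_ne_top ENNReal.one_ne_top (h1 x)
  rw [energy, interaction]
  congr 1
  refine lintegral_congr_ae ?_
  filter_upwards [hω, ae_restrict_mem measurableSet_upperHalf] with x hx hxU
  rw [pot, ← lintegral_mul_const _ (by fun_prop)]
  refine lintegral_congr_ae ?_
  filter_upwards [hω, ae_restrict_mem measurableSet_upperHalf, Measure.ae_ne _ x] with y hy hyU hne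
  rw [hx, hy, greenKernel_of_ne hne.symm,
    ENNReal.ofReal_mul (mul_nonneg (green_nonneg hxU hyU) ENNReal.toReal_nonneg),
    ENNReal.ofReal_mul (green_nonneg hxU hyU), ENNReal.ofReal_toReal (hfin y),
    ENNReal.ofReal_toReal (hfin x)]

theorem greenPotential_eq_toReal_pot (hθ : Measurable θ) (h1 : ∀ x, θ x ≤ 1)
    (hω : ω =ᵐ[volume.restrict upperHalf] fun x => (θ x).toReal)
    {x : Plane} (hx : x ∈ upperHalf) :
    greenPotential ω x = (pot θ x).toReal := by
  have hfin : ∀ x, θ x ≠ ∞ := fun x => ne_top_of_le_ne_top ENNReal.one_ne_top (h1 x)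
  have hae : ∀ᵐ y ∂volume.restrict upperHalf, green x y * ω y = (greenKernel x y * θ y).toReal ∧
      greenKernel x y * θ y < ∞ := by
    filter_upwards [hω, ae_restrict_mem measurableSet_upperHalf, Measure.ae_ne _ x] with y hy hyU hne
    rw [hy, greenKernel_of_ne hne.symm, ENNReal.toReal_mul,
      ENNReal.toReal_ofReal (green_nonneg hx hyU)]
    exact ⟨rfl, ENNReal.mul_lt_top ENNReal.ofReal_lt_top (hfin y).lt_top⟩
  rw [greenPotential, pot, integral_congr_ae (hae.mono fun y hy => hy.1),
    integral_toReal (by fun_prop) (hae.mono fun y hy => hy.2)]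

theorem setLIntegral_comp_translate (hθ : Measurable θ) (τ : ℝ) :
    ∫⁻ x in upperHalf, θ (translate τ x) = ∫⁻ x in upperHalf, θ x := by
  have key := (measurePreserving_translate τ).setLIntegral_comp_preimage
    measurableSet_upperHalf hθ
  rwa [translate_preimage_upperHalf] at key

theorem shift_ae_eq (hω : ω =ᵐ[volume.restrict upperHalf] fun x => (θ x).toReal) (τ : ℝ) :
    shift τ ω =ᵐ[volume.restrict upperHalf] fun x => (θ (translate τ x)).toReal := by
  have h := ae_comp_translate (τ := τ) measurableSet_upperHalf hω
  rwa [translate_preimage_upperHalf] at h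

theorem core_subset_upperHalf : core θ ⊆ upperHalf := fun _ hx => hx.1

theorem core_eq_of_toReal_pot (h : Admissible θ) {f : Plane → ℝ}
    (hf : ∀ x ∈ upperHalf, f x = (pot θ x).toReal) :
    core θ = {x | x ∈ upperHalf ∧ 0 < f x - speed * x 1} := by
  ext x
  refine and_congr_right fun hx => ?_
  have hx0 : 0 < x 1 := hx
  rw [hf x hx, sub_pos, ENNReal.ofReal_lt_iff_lt_toReal (mul_nonneg speed_pos.le hx0.le)
    (h.pot_ne_top hx)]

theorem CenteredMaximizer.imp_core (h : CenteredMaximizer θ) : imp ((core θ).indicator 1) = 1 := by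
  rw [← imp_congr h.ae_eq_core, imp_eq_one_of_maximizer h.admissible h.max]

theorem CenteredMaximizer.interaction_core (h : CenteredMaximizer θ) :
    interaction ((core θ).indicator 1) ((core θ).indicator 1) = interactionMax := by
  rw [← interaction_congr h.ae_eq_core, h.max]

theorem CenteredMaximizer.lintegral_core (h : CenteredMaximizer θ) :
    ∫⁻ x in core θ, ENNReal.ofReal (x 1) = 1 := by
  rw [← imp_indicator_one (measurableSet_core h.admissible.meas) core_subset_upperHalf, h.imp_core]

theorem CenteredMaximizer.isBounded_core (h : CenteredMaximizer θ) :
    Bornology.IsBounded (core θ) := by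
  obtain ⟨R, -, hR⟩ := exists_core_subset_ball
  exact Metric.isBounded_ball.subset (hR θ h)

theorem CenteredMaximizer.toReal_ae_eq_core (h : CenteredMaximizer θ) :
    (fun x => (θ x).toReal) =ᵐ[volume.restrict upperHalf]
      (core θ).indicator (fun _ => (1 : ℝ)) := by
  filter_upwards [h.ae_eq_core] with x hx
  rw [hx, toReal_indicator_one]

theorem exists_isCenteredMaximizer : ∃ θ, CenteredMaximizer θ := by
  obtain ⟨θ, hθ, hmax⟩ := exists_maximizer
  obtain ⟨τ, h⟩ := exists_centeredMaximizer hθ hmax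
  exact ⟨_, h⟩

/-- Heights in the ball are at most `R`, so unit impulse forces area at least `1 / R`; halving makes
the inequality strict. -/
theorem inv_lt_volume_of_lintegral_eq_one {R : ℝ} (hR : 0 < R) (hA : MeasurableSet A)
    (hAR : A ⊆ Metric.ball 0 R) (h : ∫⁻ x in A, ENNReal.ofReal (x 1) = 1) :
    ENNReal.ofReal (1 / (2 * R)) < volume A := by
  have h1 : 1 ≤ ENNReal.ofReal R * volume A := by
    rw [← h, ← setLIntegral_const]
    refine setLIntegral_mono' hA fun x hx => ENNReal.ofReal_le_ofReal ?_
    exact (le_abs_self _).trans ((abs_coord_le x 1).trans (mem_ball_zero_iff.1 (hAR hx)).le)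
  by_contra hcon
  refine absurd (h1.trans (mul_le_mul_right (not_lt.1 hcon) _)) (not_le.2 ?_)
  rw [← ENNReal.ofReal_mul hR.le, show R * (1 / (2 * R)) = 1 / 2 by field_simp]
  exact ENNReal.ofReal_lt_one.2 (by norm_num)

/-! ### The two classes of vorticities -/

theorem exists_admissible_of_mem_halfClass (h : ω ∈ halfClass) : ∃ θ, Admissible θ ∧
    ω =ᵐ[volume.restrict upperHalf] (fun x => (θ x).toReal) ∧
    energy ω = 1 / 2 * interaction θ θ := by
  obtain ⟨-, himp, A, hA, hAU, hω⟩ := h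
  have hω' : ω =ᵐ[volume.restrict upperHalf]
      fun x => (A.indicator (1 : Plane → ℝ≥0∞) x).toReal := by
    simp only [toReal_indicator_one]; exact hω
  have h1 := indicator_one_le_one A
  refine ⟨A.indicator 1, ⟨measurable_indicator_one hA, h1, ?_⟩, hω',
    energy_eq_interaction (measurable_indicator_one hA) h1 hω'⟩
  rw [← impulse_eq_imp h1 hω', himp]

theorem CenteredMaximizer.indicator_core_mem_halfClass (h : CenteredMaximizer θ) :
    (core θ).indicator (fun _ => (1 : ℝ)) ∈ halfClass := by
  have hm := measurableSet_core h.admissible.meas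
  refine ⟨?_, ?_, core θ, hm, core_subset_upperHalf, ae_eq_refl _⟩
  · refine Integrable.integrableOn ((integrable_indicator_iff hm).2 ?_)
    exact integrableOn_const h.isBounded_core.measure_lt_top.ne
  · rw [impulse_eq_imp h.admissible.le_one h.toReal_ae_eq_core.symm,
      imp_eq_one_of_maximizer h.admissible h.max]

theorem CenteredMaximizer.energy_indicator_core (h : CenteredMaximizer θ) :
    energy ((core θ).indicator (fun _ => (1 : ℝ))) = 1 / 2 * interactionMax := by
  rw [energy_eq_interaction h.admissible.meas h.admissible.le_one h.toReal_ae_eq_core.symm, h.max]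

/-- There is no relaxation gap: patches are admissible densities, and the relaxed maximum is
attained by the indicator of a core. -/
theorem maxEnergy_eq : maxEnergy = 1 / 2 * interactionMax := by
  refine le_antisymm (iSup₂_le fun ω hω => ?_) ?_
  · obtain ⟨θ, hθ, -, he⟩ := exists_admissible_of_mem_halfClass hω
    rw [he]
    exact mul_le_mul_right hθ.interaction_le _
  · obtain ⟨θ, h⟩ := exists_isCenteredMaximizer
    rw [← h.energy_indicator_core]
    exact le_iSup₂ (f := fun (ω : Plane → ℝ) (_ : ω ∈ halfClass) => energy ω) _
      h.indicator_core_mem_halfClass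

theorem speed_eq_maxEnergy : speed = 4 / 3 * maxEnergy.toReal := by
  rw [maxEnergy_eq, speed, ENNReal.toReal_mul]
  norm_num
  ring

theorem exists_centeredMaximizer_of_mem_halfMaximizers (h : ω ∈ halfMaximizers) :
    ∃ θ τ, Admissible θ ∧ ω =ᵐ[volume.restrict upperHalf] (fun x => (θ x).toReal) ∧
      CenteredMaximizer fun x => θ (translate τ x) := by
  obtain ⟨hω, hmax⟩ := h
  obtain ⟨θ, hθ, hae, he⟩ := exists_admissible_of_mem_halfClass hω
  rw [he, maxEnergy_eq] at hmax
  have hmax' := (ENNReal.mul_right_inj (by simp) (by simp)).1 hmax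
  obtain ⟨τ, hτ⟩ := exists_centeredMaximizer hθ hmax'
  exact ⟨θ, τ, hθ, hae, hτ⟩

theorem velocity_congr {ω' : Plane → ℝ} (h : ω =ᵐ[volume] ω') (x : Plane) :
    velocity ω x = velocity ω' x :=
  integral_congr_ae (h.mono fun y hy => by simp only [hy])

theorem kineticEnergy_congr {ω' : Plane → ℝ} (h : ω =ᵐ[volume] ω') :
    kineticEnergy ω = kineticEnergy ω' := by
  simp only [kineticEnergy, velocity_congr h]

theorem stream_congr {ω' : Plane → ℝ} (h : ω =ᵐ[volume] ω') (x : Plane) :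
    stream ω x = stream ω' x :=
  integral_congr_ae (h.mono fun y hy => by simp only [hy])

theorem integrableOn_coord (hbd : Bornology.IsBounded A) : IntegrableOn (fun x : Plane => x 1) A := by
  obtain ⟨R, hR⟩ := hbd.subset_closedBall (0 : Plane)
  exact ((by fun_prop : Continuous fun x : Plane => x 1).continuousOn.integrableOn_compact
    (isCompact_closedBall 0 R)).mono_set hR

theorem ofReal_setIntegral_coord (hA : MeasurableSet A) (hAU : A ⊆ upperHalf)
    (hbd : Bornology.IsBounded A) :
    ENNReal.ofReal (∫ x in A, x 1) = ∫⁻ x in A, ENNReal.ofReal (x 1) :=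
  ofReal_integral_eq_lintegral_ofReal (integrableOn_coord hbd)
    ((ae_restrict_mem hA).mono fun _ hx => le_of_lt (hAU hx))

theorem exists_admissible_of_mem_patchClass (h : ω ∈ patchClass) : ∃ A : Set Plane,
    A ⊆ upperHalf ∧ ω =ᵐ[volume] oddPatch A ∧ Admissible (A.indicator 1) ∧
    kineticEnergy ω = 2 * interaction (A.indicator 1) (A.indicator 1) := by
  obtain ⟨-, A, hA, hbd, hAU, hA1, hω⟩ := h
  have hm := hA.measurableSet
  refine ⟨A, hAU, hω, ⟨measurable_indicator_one hm, indicator_one_le_one A, ?_⟩, ?_⟩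
  · rw [imp_indicator_one hm hAU, ← ofReal_setIntegral_coord hm hAU hbd, hA1, ENNReal.ofReal_one]
  · rw [kineticEnergy_congr hω, kineticEnergy_oddPatch hAU hm hbd]

theorem integrable_oddPatch (hA : MeasurableSet A) (hbd : Bornology.IsBounded A) :
    Integrable (oddPatch A) := by
  have h : Integrable (A.indicator fun _ => (1 : ℝ)) :=
    (integrable_indicator_iff hA).2 (integrableOn_const hbd.measure_lt_top.ne)
  exact h.sub (measurePreserving_reflect.integrable_comp_of_integrable h)

theorem CenteredMaximizer.oddPatch_core_mem_patchClass (h : CenteredMaximizer θ) :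
    oddPatch (core θ) ∈ patchClass := by
  have ho := isOpen_core h.admissible.meas
  refine ⟨integrable_oddPatch ho.measurableSet h.isBounded_core, core θ, ho, h.isBounded_core,
    core_subset_upperHalf, ?_, ae_eq_refl _⟩
  have := ofReal_setIntegral_coord ho.measurableSet core_subset_upperHalf h.isBounded_core
  rw [h.lintegral_core] at this
  exact ENNReal.ofReal_eq_one.1 this

theorem CenteredMaximizer.kineticEnergy_oddPatch_core (h : CenteredMaximizer θ) :
    kineticEnergy (oddPatch (core θ)) = 2 * interactionMax := by
  rw [kineticEnergy_oddPatch core_subset_upperHalf (measurableSet_core h.admissible.meas)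
    h.isBounded_core, h.interaction_core]

/-- The core is open and bounded, so the relaxed maximum is attained even in the narrower class of
bounded open patches. -/
theorem maxKineticEnergy_eq : maxKineticEnergy = 2 * interactionMax := by
  refine le_antisymm (iSup₂_le fun ω hω => ?_) ?_
  · obtain ⟨A, -, -, hA, he⟩ := exists_admissible_of_mem_patchClass hω
    rw [he]
    exact mul_le_mul_right hA.interaction_le _
  · obtain ⟨θ, h⟩ := exists_isCenteredMaximizer
    rw [← h.kineticEnergy_oddPatch_core]
    exact le_iSup₂ (f := fun (ω : Plane → ℝ) (_ : ω ∈ patchClass) => kineticEnergy ω) _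
      h.oddPatch_core_mem_patchClass

theorem oddPatch_eq_toReal (A : Set Plane) (x : Plane) : oddPatch A x =
    (A.indicator (1 : Plane → ℝ≥0∞) x).toReal -
      (A.indicator (1 : Plane → ℝ≥0∞) (reflect x)).toReal := by
  rw [toReal_indicator_one, toReal_indicator_one]; rfl

theorem reflect_translate (τ : ℝ) (x : Plane) :
    reflect (translate τ x) = translate τ (reflect x) :=
  plane_ext (by simp [reflect]) (by simp [reflect])

/-- The identity with the core is known only in the upper half-plane. Below it both indicators
vanish, because `A` and the core lie above, and the reflected copies agree since reflection
preserves null sets. -/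
theorem CenteredMaximizer.shift_oddPatch_ae_eq {τ : ℝ} (hAU : A ⊆ upperHalf)
    (h : CenteredMaximizer fun x => A.indicator 1 (translate τ x)) :
    shift τ (oddPatch A) =ᵐ[volume] oddPatch (core fun x => A.indicator 1 (translate τ x)) := by
  set θ : Plane → ℝ≥0∞ := fun x => A.indicator 1 (translate τ x) with hθ
  have hae : ∀ᵐ x, θ x = (core θ).indicator 1 x := by
    have h1 := h.ae_eq_core
    rw [EventuallyEq, ae_restrict_iff' measurableSet_upperHalf] at h1
    filter_upwards [h1] with x hx
    by_cases hxU : x ∈ upperHalf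
    · exact hx hxU
    · have hxA : translate τ x ∉ A := fun hA => hxU (by
        rw [← translate_preimage_upperHalf τ]; exact hAU hA)
      rw [indicator_of_notMem fun hc => hxU (core_subset_upperHalf hc)]
      exact indicator_of_notMem hxA _
  filter_upwards [hae, measurePreserving_reflect.quasiMeasurePreserving.ae hae] with x h1 h2
  rw [oddPatch_eq_toReal, ← h1, ← h2]
  change oddPatch A (translate τ x) = _
  rw [oddPatch_eq_toReal, reflect_translate]

theorem shift_congr {ω' : Plane → ℝ} (h : ω =ᵐ[volume] ω') (τ : ℝ) :
    shift τ ω =ᵐ[volume] shift τ ω' :=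
  (measurePreserving_translate τ).quasiMeasurePreserving.ae h

theorem CenteredMaximizer.stream_oddPatch_core (h : CenteredMaximizer θ) {x : Plane}
    (hx : x ∈ upperHalf) : stream (oddPatch (core θ)) x = (pot θ x).toReal := by
  have hm := measurableSet_core h.admissible.meas
  rw [stream_oddPatch core_subset_upperHalf hm h.isBounded_core hx,
    ← greenPotential_eq_toReal_pot h.admissible.meas h.admissible.le_one
      h.toReal_ae_eq_core.symm hx, greenPotential]
  have hpt : ∀ y, green x y * (core θ).indicator (fun _ => (1 : ℝ)) y =
      (core θ).indicator (green x) y := fun y => by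
    by_cases hy : y ∈ core θ <;> simp [hy]
  simp_rw [hpt]
  rw [integral_indicator hm, Measure.restrict_restrict hm, inter_eq_left.2 core_subset_upperHalf]

end

end Sadovskii

end

/-! ### Existence and structure of the maximizers in both classes -/

theorem theorem1p2 :
    -- both maximal energies are finite, and maximizers exist in both classes
    maxKineticEnergy < ∞ ∧ patchMaximizers.Nonempty ∧
    maxEnergy < ∞ ∧ halfMaximizers.Nonempty ∧
    ∃ C₀ C₁ C₂ : ℝ, 0 < C₀ ∧ 0 < C₁ ∧ C₁ < C₂ ∧
      -- the maximizers among odd patches of bounded open sets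
      (∀ ω ∈ patchMaximizers, ∃ (τ W : ℝ) (Ω : Set Plane),
        IsOpen Ω ∧ Bornology.IsBounded Ω ∧ Ω ⊆ upperHalf ∧
        shift τ ω =ᵐ[volume] oddPatch Ω ∧
        0 < W ∧ W = 1 / 3 * (kineticEnergy ω).toReal ∧ W = 4 / 3 * maxEnergy.toReal ∧
        Ω = {x | x ∈ upperHalf ∧ 0 < stream (shift τ ω) x - W * x 1} ∧
        IsSteiner Ω ∧
        Ω ⊆ Metric.ball 0 C₀ ∧
        ENNReal.ofReal C₁ < volume Ω ∧ volume Ω < ENNReal.ofReal C₂) ∧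
      -- the maximizers among all measurable patches in the half-plane
      (∀ ω ∈ halfMaximizers, ∃ (τ W : ℝ) (Ω : Set Plane),
        IsOpen Ω ∧ Bornology.IsBounded Ω ∧ Ω ⊆ upperHalf ∧
        shift τ ω =ᵐ[volume.restrict upperHalf] Ω.indicator (fun _ => (1 : ℝ)) ∧
        0 < W ∧ W = 4 / 3 * maxEnergy.toReal ∧
        Ω = {x | x ∈ upperHalf ∧ 0 < greenPotential (shift τ ω) x - W * x 1} ∧
        IsSteiner Ω ∧
        Ω ⊆ Metric.ball 0 C₀ ∧
        ENNReal.ofReal C₁ < mass ω ∧ mass ω < ENNReal.ofReal C₂) := by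
  have hM : interactionMax < ∞ := interactionMax_ne_top.lt_top
  obtain ⟨θ₀, h₀⟩ := exists_isCenteredMaximizer
  obtain ⟨R, hR, hcore⟩ := exists_core_subset_ball
  -- The summand `1 + 1 / (2 R)` makes the upper bound by the area of the ball strict and keeps the
  -- upper constant above the lower one.
  have hvol : ∀ θ, CenteredMaximizer θ → ENNReal.ofReal (1 / (2 * R)) < volume (core θ) ∧
      volume (core θ) <
        ENNReal.ofReal ((volume (Metric.ball (0 : Plane) R)).toReal + (1 + 1 / (2 * R))) := by
    intro θ h
    refine ⟨inv_lt_volume_of_lintegral_eq_one hR (measurableSet_core h.admissible.meas) (hcore θ h)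
      h.lintegral_core, (measure_mono (hcore θ h)).trans_lt ?_⟩
    rw [ENNReal.lt_ofReal_iff_toReal_lt measure_ball_lt_top.ne]
    have : 0 < 1 / (2 * R) := by positivity
    linarith
  refine ⟨?_, ⟨_, h₀.oddPatch_core_mem_patchClass, ?_⟩, ?_, ⟨_, h₀.indicator_core_mem_halfClass, ?_⟩,
    R, 1 / (2 * R), (volume (Metric.ball (0 : Plane) R)).toReal + (1 + 1 / (2 * R)), hR,
    by positivity, ?_, fun ω hω => ?_, fun ω hω => ?_⟩
  · rw [maxKineticEnergy_eq]
    exact ENNReal.mul_lt_top (by simp) hM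
  · rw [h₀.kineticEnergy_oddPatch_core, maxKineticEnergy_eq]
  · rw [maxEnergy_eq]
    exact ENNReal.mul_lt_top (by simp) hM
  · rw [h₀.energy_indicator_core, maxEnergy_eq]
  · have : 0 ≤ (volume (Metric.ball (0 : Plane) R)).toReal := ENNReal.toReal_nonneg
    linarith
  · obtain ⟨hωK, hmax⟩ := hω
    obtain ⟨A, hAU, hωA, hA, he⟩ := exists_admissible_of_mem_patchClass hωK
    have hkin := hmax
    rw [he, maxKineticEnergy_eq, ENNReal.mul_right_inj (by simp) (by simp)] at hmax
    obtain ⟨τ, h⟩ := exists_centeredMaximizer hA hmax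
    have hshift := (shift_congr hωA τ).trans (h.shift_oddPatch_ae_eq hAU)
    refine ⟨τ, speed, _, isOpen_core h.admissible.meas, h.isBounded_core, core_subset_upperHalf,
      hshift, speed_pos, ?_, speed_eq_maxEnergy, ?_, h.isSteiner_core h.isBounded_core, hcore _ h,
      hvol _ h⟩
    · rw [hkin, maxKineticEnergy_eq, speed, ENNReal.toReal_mul]
      norm_num
      ring
    · refine core_eq_of_toReal_pot h.admissible fun x hx => ?_
      rw [stream_congr hshift, h.stream_oddPatch_core hx]
  · obtain ⟨θ, τ, hθ, hae, h⟩ := exists_centeredMaximizer_of_mem_halfMaximizers hω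
    have hshift := shift_ae_eq hae τ
    have hmass : mass ω = volume (core fun x => θ (translate τ x)) := by
      rw [mass_eq_lintegral hθ.le_one hae, ← setLIntegral_comp_translate hθ.meas τ,
        lintegral_congr_ae h.ae_eq_core, setLIntegral_indicator_one
          (measurableSet_core h.admissible.meas) core_subset_upperHalf]
    rw [hmass]
    exact ⟨τ, speed, _, isOpen_core h.admissible.meas, h.isBounded_core, core_subset_upperHalf,
      hshift.trans h.toReal_ae_eq_core, speed_pos, speed_eq_maxEnergy,
      core_eq_of_toReal_pot h.admissible fun x hx =>
        greenPotential_eq_toReal_pot h.admissible.meas h.admissible.le_one hshift hx,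
      h.isSteiner_core h.isBounded_core, hcore _ h, hvol _ h⟩
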